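/- Let $\mathbb{P}^3=\operatorname{Proj}\mathbb{C}[x_0,x_1,x_2,x_3]$ be complex projective three-space, let $\mathcal{O}(k)$, $k\in\mathbb{Z}$, be Serre's twisting sheaves on it, let $\Omega^p$ be the sheaf of algebraic differential $p$-forms of $\mathbb{P}^3$ over $\mathbb{C}$, and write $\Omega^p(k)=\Omega^p\otimes_{\mathcal{O}_{\mathbb{P}^3}}\mathcal{O}(k)$. Let $H^q(\mathbb{P}^3,-)$ denote sheaf cohomology. Then, for every integer $r$: \begin{align*} H^0(\mathbb{P}^3,\Omega^1(-r))&=0 \quad\text{if } r>-2, & H^0(\mathbb{P}^3,\Omega^2(-r))&=0 \quad\text{if } r>-3,\\ H^1(\mathbb{P}^3,\Omega^1(-r))&=0 \quad\text{if } r\neq 0, & H^1(\mathbb{P}^3,\Omega^2(-r))&=0,\\ H^2(\mathbb{P}^3,\Omega^1(-r))&=0, & H^2(\mathbb{P}^3,\Omega^2(-r))&=0 \quad\text{if } r\neq 0,\\ H^3(\mathbb{P}^3,\Omega^1(-r))&=0 \quad\text{if } r<3, & H^3(\mathbb{P}^3,\Omega^2(-r))&=0 \quad\text{if } r<2. \end{align*}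 -/

import Mathlib

noncomputable section

open CategoryTheory AlgebraicGeometry TopologicalSpace Opposite

namespace ProjForms

universe u

/-! ### Sheaves of modules on a scheme: tensor products, differential forms, cohomology -/

/-- The sheaf of `𝒪_X`-modules associated with a presheaf of `𝒪_X`-modules. -/
def sheafOfPresheaf {X : Scheme.{u}}
    (M : PresheafOfModules.{u} (X.presheaf ⋙ forget₂ CommRingCat.{u} RingCat.{u})) : X.Modules :=
  (PresheafOfModules.sheafification (𝟙 X.ringCatSheaf.obj)).obj M

/-- The tensor product `F ⊗_{𝒪_X} G` of sheaves of modules: the sheaf associated with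
`U ↦ F(U) ⊗_{𝒪_X(U)} G(U)`. -/
def tensor {X : Scheme.{u}} (F G : X.Modules) : X.Modules :=
  sheafOfPresheaf (PresheafOfModules.Monoidal.tensorObj (R := X.presheaf) F.val G.val)

/-- The cohomology group `H^n(X, F)`: derived functor cohomology, on the Zariski site of `X`, of
the abelian sheaf underlying `F`. -/
def cohomology {X : Scheme.{u}} (n : ℕ) (F : X.Modules) : Type u :=
  Sheaf.H.{u} ((SheafOfModules.toSheaf X.ringCatSheaf).obj F) n

instance {X : Scheme.{u}} (n : ℕ) (F : X.Modules) : AddCommGroup (cohomology n F) :=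
  inferInstanceAs (AddCommGroup (Sheaf.H.{u} ((SheafOfModules.toSheaf X.ringCatSheaf).obj F) n))

section ExteriorPower

variable {C : Type*} [Category* C] {R : Cᵒᵖ ⥤ CommRingCat.{u}}

/-- The semilinear restriction map `m₁ ∧ ⋯ ∧ m_p ↦ m₁|_V ∧ ⋯ ∧ m_p|_V`. -/
def exteriorPowerMap (M : PresheafOfModules.{u} (R ⋙ forget₂ CommRingCat.{u} RingCat.{u})) (p : ℕ)
    {U V : Cᵒᵖ} (f : U ⟶ V) :
    ModuleCat.exteriorPower (R := R.obj U) (M.obj U) p ⟶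
      (ModuleCat.restrictScalars (R.map f).hom).obj
        (ModuleCat.exteriorPower (R := R.obj V) (M.obj V) p) :=
  ModuleCat.exteriorPower.desc (R := R.obj U)
    (N := (ModuleCat.restrictScalars (R.map f).hom).obj
        (ModuleCat.exteriorPower (R := R.obj V) (M.obj V) p))
    { toFun := fun m ↦ ModuleCat.exteriorPower.mk (R := R.obj V) (M := M.obj V)
        (fun i ↦ M.map f (m i))
      map_update_add' := by
        intro _ m i x y
        have key (z : M.obj U) : (fun j ↦ M.map f (Function.update m i z j)) =
            Function.update (fun j ↦ (M.map f (m j) : M.obj V)) i (M.map f z) := by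
          funext j
          rcases eq_or_ne j i with rfl | h
          · simp
          · simp [h]
        rw [key, key, key, map_add]
        exact (exteriorPower.ιMulti (R.obj V) p (M := M.obj V)).map_update_add _ _ _ _
      map_update_smul' := by
        intro _ m i c x
        have key (z : M.obj U) : (fun j ↦ M.map f (Function.update m i z j)) =
            Function.update (fun j ↦ (M.map f (m j) : M.obj V)) i (M.map f z) := by
          funext j
          rcases eq_or_ne j i with rfl | h
          · simp
          · simp [h]
        rw [key, key]
        refine Eq.trans ?_ ((exteriorPower.ιMulti (R.obj V) p (M := M.obj V)).map_update_smul
          (fun j ↦ M.map f (m j)) i (R.map f c) (M.map f x))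
        congr 2
        exact M.map_smul f c x
      map_eq_zero_of_eq' := by
        intro m i j h hij
        exact (exteriorPower.ιMulti (R.obj V) p (M := M.obj V)).map_eq_zero_of_eq _
          (congrArg (M.map f) h) hij }

lemma exteriorPowerMap_mk (M : PresheafOfModules.{u} (R ⋙ forget₂ CommRingCat.{u} RingCat.{u}))
    (p : ℕ) {U V : Cᵒᵖ} (f : U ⟶ V) (m : Fin p → M.obj U) :
    (exteriorPowerMap M p f).hom (ModuleCat.exteriorPower.mk (R := R.obj U) (M := M.obj U) m) =
      ModuleCat.exteriorPower.mk (R := R.obj V) (M := M.obj V) (fun i ↦ M.map f (m i)) :=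
  ModuleCat.exteriorPower.desc_mk _ _

/-- The presheaf `U ↦ ⋀^p_{R(U)} M(U)`. -/
def presheafExteriorPower (M : PresheafOfModules.{u} (R ⋙ forget₂ CommRingCat.{u} RingCat.{u})) (p : ℕ) :
    PresheafOfModules.{u} (R ⋙ forget₂ CommRingCat.{u} RingCat.{u}) where
  obj U := ModuleCat.exteriorPower (R := R.obj U) (M.obj U) p
  map f := exteriorPowerMap M p f
  map_id U := by
    refine ModuleCat.exteriorPower.hom_ext (R := R.obj U) ?_
    ext m
    refine (exteriorPowerMap_mk M p (𝟙 U) m).trans ?_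
    simp
    rfl
  map_comp {U V W} f g := by
    refine ModuleCat.exteriorPower.hom_ext (R := R.obj U) ?_
    ext m
    refine (exteriorPowerMap_mk M p (f ≫ g) m).trans ?_
    refine Eq.trans ?_ (congrArg (exteriorPowerMap M p g).hom (exteriorPowerMap_mk M p f m)).symm
    refine Eq.trans ?_ (exteriorPowerMap_mk M p g _).symm
    simp
    rfl

end ExteriorPower

section Differentials

variable {X : Scheme.{u}} {R : CommRingCat.{u}} (f : X ⟶ Spec R)

/-- The structure maps `R → 𝒪_X(U)` of a scheme `X` over `Spec R`. -/
def structureMap : (Functor.const (X.Opens)ᵒᵖ).obj R ⟶ X.presheaf where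
  app U := (Scheme.ΓSpecIso R).inv ≫ f.appTop ≫ X.presheaf.map (homOfLE le_top : U.unop ⟶ ⊤).op
  naturality U V i := by
    simp [← Functor.map_comp]
    rfl

/-- The sheaf `Ω^p_{X/R}` of differential `p`-forms of a scheme `X` over `Spec R`: the sheaf
associated with `U ↦ ⋀^p_{𝒪_X(U)} Ω_{𝒪_X(U)/R}`. -/
def differentialForms (p : ℕ) : X.Modules :=
  sheafOfPresheaf (presheafExteriorPower
    (PresheafOfModules.DifferentialsConstruction.relativeDifferentials' (structureMap f)) p)

end Differentials

/-! ### Serre's twisting sheaves on `Proj 𝒜` -/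

section Twist

variable {A σ : Type u} [CommRing A] [SetLike σ A] [AddSubgroupClass σ A]
variable (𝒜 : ℕ → σ) [GradedRing 𝒜] (k : ℤ)

/-- The local ring `A_𝔭` of `A` (all denominators outside of `𝔭`, of any degree) at a point `𝔭`
of `Proj 𝒜`. -/
abbrev LocAt (x : ProjectiveSpectrum 𝒜) : Type u :=
  Localization.AtPrime x.asHomogeneousIdeal.toIdeal

variable {𝒜} in
/-- `f` is given on all of `U` by one fraction `r / s` of homogeneous elements with
`deg r - deg s = k`. -/
def IsFractionOfDegree {U : Opens (ProjectiveSpectrum.top 𝒜)} (f : ∀ x : U, LocAt 𝒜 x.1) : Prop :=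
  ∃ (i j : ℕ) (r : 𝒜 i) (s : 𝒜 j) (hs : ∀ x : U, s.1 ∉ x.1.asHomogeneousIdeal),
    (i : ℤ) = j + k ∧ ∀ x : U, f x = Localization.mk r.1 ⟨s.1, hs x⟩

/-- The predicate `IsFractionOfDegree` passes to smaller open sets. -/
def isFractionOfDegreePrelocal :
    TopCat.PrelocalPredicate fun x : ProjectiveSpectrum.top 𝒜 ↦ LocAt 𝒜 x where
  pred f := IsFractionOfDegree k f
  res := by
    rintro V U i f ⟨a, b, r, s, hs, hd, hf⟩
    exact ⟨a, b, r, s, fun x ↦ hs (i x), hd, fun x ↦ hf (i x)⟩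

/-- The predicate "`f` is locally a fraction of homogeneous elements, of total degree `k`". -/
def isLocallyFractionOfDegree :
    TopCat.LocalPredicate fun x : ProjectiveSpectrum.top 𝒜 ↦ LocAt 𝒜 x :=
  (isFractionOfDegreePrelocal 𝒜 k).sheafify

/-- The sheaf of sets underlying `𝒪(k)`. -/
def twistInType : TopCat.Sheaf (Type u) (ProjectiveSpectrum.top 𝒜) :=
  TopCat.subsheafToTypes (isLocallyFractionOfDegree 𝒜 k)

variable {𝒜} in
lemma exists_homogeneous_notMem (x : ProjectiveSpectrum 𝒜) :
    ∃ (d : ℕ) (s : A), 0 < d ∧ s ∈ 𝒜 d ∧ s ∉ x.asHomogeneousIdeal := by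
  by_contra! h
  exact x.not_irrelevant_le ((HomogeneousIdeal.irrelevant_le 𝒜).mpr fun d hd s hs ↦ h d s hd hs)

/-- The sections of `𝒪(k)` over `U`, as a subgroup of all dependent functions. -/
def twistSections (U : (Opens (ProjectiveSpectrum.top 𝒜))ᵒᵖ) :
    AddSubgroup (∀ x : U.unop, LocAt 𝒜 x.1) where
  carrier := {f | (isLocallyFractionOfDegree 𝒜 k).pred f}
  zero_mem' x := by
    obtain ⟨d, s, hd, hs, hsx⟩ := exists_homogeneous_notMem x.1
    have hle : (0 : ℤ) ≤ (k.natAbs * d : ℕ) + k := by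
      have : k.natAbs * 1 ≤ k.natAbs * d := Nat.mul_le_mul_left _ hd
      omega
    have hpow (y : ProjectiveSpectrum 𝒜) (hy : s ∉ y.asHomogeneousIdeal) :
        s ^ k.natAbs ∉ y.asHomogeneousIdeal := fun h ↦ hy (y.isPrime.mem_of_pow_mem _ h)
    refine ⟨U.unop ⊓ ProjectiveSpectrum.basicOpen 𝒜 s, ⟨x.2, hsx⟩, Opens.infLELeft _ _,
      ((k.natAbs * d : ℕ) + k : ℤ).toNat, k.natAbs * d, ⟨0, zero_mem _⟩,
      ⟨s ^ k.natAbs, by simpa using SetLike.pow_mem_graded k.natAbs hs⟩,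
      fun y ↦ hpow y.1 y.2.2, Int.toNat_of_nonneg hle, fun y ↦ ?_⟩
    exact (Localization.mk_zero _).symm
  add_mem' {a b} ha hb x := by
    rcases ha x with ⟨Va, ma, ia, na, da, ra, sa, hsa, hda, wa⟩
    rcases hb x with ⟨Vb, mb, ib, nb, db, rb, sb, hsb, hdb, wb⟩
    refine ⟨Va ⊓ Vb, ⟨ma, mb⟩, Opens.infLELeft _ _ ≫ ia, da + nb, da + db,
      ⟨sa.1 * rb.1 + sb.1 * ra.1, add_mem (SetLike.mul_mem_graded sa.2 rb.2) ?_⟩,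
      ⟨sa.1 * sb.1, SetLike.mul_mem_graded sa.2 sb.2⟩,
      fun y h ↦ (y.1.isPrime.mem_or_mem h).elim (hsa ⟨y.1, y.2.1⟩) (hsb ⟨y.1, y.2.2⟩),
      by push_cast; omega, fun y ↦ ?_⟩
    · have : da + nb = db + na := by omega
      rw [this]
      exact SetLike.mul_mem_graded sb.2 ra.2
    · have h1 := wa ⟨y.1, y.2.1⟩
      have h2 := wb ⟨y.1, y.2.2⟩
      refine (congrArg₂ (· + ·) h1 h2).trans ?_
      refine (Localization.add_mk _ _ _ _).trans ?_
      rfl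
  neg_mem' {a} ha x := by
    rcases ha x with ⟨V, m, i, n, d, ⟨r, hr⟩, s, hs, hd, w⟩
    refine ⟨V, m, i, n, d, ⟨-r, neg_mem hr⟩, s, hs, hd, fun y ↦ ?_⟩
    exact (congrArg Neg.neg (w y)).trans (Localization.neg_mk _ _)

lemma smul_mem_twistSections (U : (Opens (ProjectiveSpectrum.top 𝒜))ᵒᵖ)
    (c : (ProjectiveSpectrum.Proj.structureSheaf 𝒜).presheaf.obj U) (f : twistSections 𝒜 k U) :
    (fun x ↦ (c.1 x).val * f.1 x) ∈ twistSections 𝒜 k U := by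
  intro x
  rcases c.2 x with ⟨Va, ma, ia, na, ra, sa, hsa, wa⟩
  rcases f.2 x with ⟨Vb, mb, ib, nb, db, rb, sb, hsb, hdb, wb⟩
  refine ⟨Va ⊓ Vb, ⟨ma, mb⟩, Opens.infLELeft _ _ ≫ ia, na + nb, na + db,
    ⟨ra.1 * rb.1, SetLike.mul_mem_graded ra.2 rb.2⟩,
    ⟨sa.1 * sb.1, SetLike.mul_mem_graded sa.2 sb.2⟩,
    fun y h ↦ (y.1.isPrime.mem_or_mem h).elim (hsa ⟨y.1, y.2.1⟩) (hsb ⟨y.1, y.2.2⟩),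
    by push_cast; omega, fun y ↦ ?_⟩
  have h1 := congrArg HomogeneousLocalization.val (wa ⟨y.1, y.2.1⟩)
  have h2 := wb ⟨y.1, y.2.2⟩
  refine (congrArg₂ (· * ·) h1 h2).trans ?_
  exact (congrArg (· * _) (HomogeneousLocalization.val_mk _)).trans (Localization.mk_mul _ _ _ _)

/-- The sections of `𝒪_{Proj 𝒜}` act on those of `𝒪(k)` by pointwise multiplication. -/
instance twistModule (U : (Opens (ProjectiveSpectrum.top 𝒜))ᵒᵖ) :
    Module ((ProjectiveSpectrum.Proj.structureSheaf 𝒜).presheaf.obj U) (twistSections 𝒜 k U) where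
  smul c f := ⟨fun x ↦ (c.1 x).val * f.1 x, smul_mem_twistSections 𝒜 k U c f⟩
  one_smul f := Subtype.ext <| funext fun x ↦
    (congrArg (· * f.1 x) (HomogeneousLocalization.val_one)).trans (one_mul _)
  mul_smul _ _ f := Subtype.ext <| funext fun x ↦
    (congrArg (· * f.1 x) (HomogeneousLocalization.val_mul _ _)).trans (mul_assoc _ _ _)
  smul_zero _ := Subtype.ext <| funext fun _ ↦ mul_zero _
  smul_add _ _ _ := Subtype.ext <| funext fun _ ↦ mul_add _ _ _
  add_smul _ _ f := Subtype.ext <| funext fun x ↦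
    (congrArg (· * f.1 x) (HomogeneousLocalization.val_add _ _)).trans (add_mul _ _ _)
  zero_smul f := Subtype.ext <| funext fun x ↦
    (congrArg (· * f.1 x) (HomogeneousLocalization.val_zero)).trans (zero_mul _)

/-- The abelian presheaf underlying `𝒪(k)`. -/
def twistPresheaf : TopCat.Presheaf AddCommGrpCat.{u} (ProjectiveSpectrum.top 𝒜) where
  obj U := AddCommGrpCat.of (twistSections 𝒜 k U)
  map i := AddCommGrpCat.ofHom
    { toFun := (twistInType 𝒜 k).1.map i
      map_zero' := rfl
      map_add' := fun _ _ ↦ rfl }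

instance (U : (Proj 𝒜).Opensᵒᵖ) :
    Module ((Proj 𝒜).ringCatSheaf.obj.obj U) ((twistPresheaf 𝒜 k).obj U) :=
  twistModule 𝒜 k U

lemma twistPresheaf_isSheaf : (twistPresheaf 𝒜 k).IsSheaf :=
  (TopCat.Presheaf.isSheaf_iff_isSheaf_comp (forget AddCommGrpCat) _).2 (twistInType 𝒜 k).2

/-- Serre's twisting sheaf `𝒪(k)` on `Proj 𝒜`. -/
def twistingSheaf : (Proj 𝒜).Modules where
  val := PresheafOfModules.ofPresheaf (R := (Proj 𝒜).ringCatSheaf.obj) (twistPresheaf 𝒜 k)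
    (fun _ _ _ _ _ ↦ rfl)
  isSheaf := twistPresheaf_isSheaf 𝒜 k

variable {𝒜} in
/-- The twist `F(k) = F ⊗ 𝒪(k)`. -/
def twist (F : (Proj 𝒜).Modules) : (Proj 𝒜).Modules := tensor F (twistingSheaf 𝒜 k)

end Twist

/-! ### Projective space over `ℂ` -/

/-- The grading of `ℂ[x₀, …, xₙ]` by total degree. -/
abbrev grading (n : ℕ) : ℕ → Submodule ℂ (MvPolynomial (Fin (n + 1)) ℂ) :=
  MvPolynomial.homogeneousSubmodule (Fin (n + 1)) ℂ

instance (n : ℕ) : GradedAlgebra (grading n) := MvPolynomial.gradedAlgebra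

/-- The projective space `ℙⁿ` over `ℂ`. -/
abbrev ProjectiveSpace (n : ℕ) : Scheme.{0} := Proj (grading n)

/-- The structure morphism `ℙⁿ ⟶ Spec ℂ`. -/
def structureMorphism (n : ℕ) : ProjectiveSpace n ⟶ Spec (CommRingCat.of ℂ) :=
  Proj.toSpecZero (grading n) ≫ Spec.map (CommRingCat.ofHom (algebraMap ℂ (grading n 0)))

/-- The sheaf `Ω^p_{ℙⁿ}` of differential `p`-forms on `ℙⁿ` over `ℂ`. -/
def Omega (n p : ℕ) : (ProjectiveSpace n).Modules := differentialForms (structureMorphism n) p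

end ProjForms

end

noncomputable section

open CategoryTheory AlgebraicGeometry TopologicalSpace Opposite

namespace ProjForms

universe u

/-! On `ℙⁿ` a `1`-form twisted by `k` is a family `∑ vᵢ dxᵢ` in homogeneous coordinates, with `vᵢ`
in `𝒪(k - 1)`, whose contraction `∑ xᵢ vᵢ` with the Euler vector field vanishes. A twisted `2`-form
is likewise an antisymmetric matrix with entries in `𝒪(k - 2)` all of whose rows contract to zero.
This gives two short exact sequences, `0 → Ω¹(k) → 𝒪(k-1)ⁿ⁺¹ → 𝒪(k) → 0` and `0 → Ω²(k) →
(antisymmetric matrices over 𝒪(k-2)) → Ω¹(k) → 0` (`eulerSequenceOne_shortExact`,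
`eulerSequenceTwo_shortExact`).

The cohomology of `𝒪(k)` vanishes strictly between degrees `0` and `n`, and in every positive degree
when `k > -(n + 1)` (`HH_subsingleton_linear_top`). The long exact sequences then settle degrees two
and three. In degree zero, sections are families of polynomials, and in the stated range these are
constants annihilated by linearly independent coordinates. In degree one the question is whether
global sections lift. For `Ω¹(k)` Euler's relation `∑ xᵢ ∂ᵢq = k q` lifts them when `k ≠ 0`. For
`Ω²(k)` a section of `Ω¹(k)` is the contraction of `1/k` times its exterior derivative up to sign,
and when `k = 0` there are no nonzero sections to lift (`sum_X_mul_curl_eq`).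

Derived functor cohomology is reached from Čech complexes by dimension shifting
(`HH_subsingleton_of_cechExact`). Its only input about affine open sets is the splitting of
functions on `D(f) ∩ D(g)` when `f + g = 1`. The Čech complex of `𝒪(k)` is contracted monomial by
monomial (`exists_isNumerator_coboundary`).

It remains to identify the sheafified exterior powers of Kähler differentials with these models. The
gradient in homogeneous coordinates induces the comparison map, and on `D(h)` inside the chart `xᵢ ≠
0` the assignment `v ↦ ∑ xᵢ vₐ d(xₐ/xᵢ)` is its inverse (`bijective_kaehlerOne`,
`bijective_kaehlerTwo`). Twisting is multiplication by sections of `𝒪(k)`, which has a generator on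
each chart (`bijective_twMulBilin`). -/

/-- Sheaves of abelian groups on a topological space. -/
abbrev AbSheaf (X : TopCat.{u}) : Type (u + 1) :=
  CategoryTheory.Sheaf (Opens.grothendieckTopology X) AddCommGrpCat.{u}

/-! ### Sections, gluing and left exactness for abelian sheaves -/

section Sections

variable {X : TopCat.{u}}

/-- Restriction of sections of a presheaf of abelian groups. -/
def res (F : TopCat.Presheaf AddCommGrpCat.{u} X) {U V : Opens X} (h : V ≤ U) :
    F.obj (op U) →+ F.obj (op V) := (F.map (homOfLE h).op).hom

lemma res_self (F : TopCat.Presheaf AddCommGrpCat.{u} X) {U : Opens X} (h : U ≤ U)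
    (s : F.obj (op U)) : res F h s = s := by
  simp [res]

lemma res_res (F : TopCat.Presheaf AddCommGrpCat.{u} X) {U V W : Opens X} (h : V ≤ U) (h' : W ≤ V)
    (s : F.obj (op U)) : res F h' (res F h s) = res F (h'.trans h) s := by
  have : (homOfLE (h'.trans h)).op = (homOfLE h).op ≫ (homOfLE h').op := rfl
  simp [res, this]

lemma app_res {F G : TopCat.Presheaf AddCommGrpCat.{u} X} (φ : F ⟶ G) {U V : Opens X} (h : V ≤ U)
    (s : F.obj (op U)) : (φ.app (op V)).hom (res F h s) = res G h ((φ.app (op U)).hom s) :=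
  NatTrans.naturality_apply φ (homOfLE h).op s

lemma eq_of_res_eq (F : AbSheaf X) {ι : Type*} {U : ι → Opens X}
    {V : Opens X} (hU : ∀ i, U i ≤ V) (hV : V ≤ iSup U) (s t : F.obj.obj (op V))
    (h : ∀ i, res F.obj (hU i) s = res F.obj (hU i) t) : s = t :=
  TopCat.Sheaf.eq_of_locally_eq' F U V (fun i ↦ homOfLE (hU i)) hV s t h

lemma exists_res_eq (F : AbSheaf X) {ι : Type*} {U : ι → Opens X}
    {V : Opens X} (hU : ∀ i, U i ≤ V) (hV : V ≤ iSup U) (s : ∀ i, F.obj.obj (op (U i)))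
    (h : ∀ i j, res F.obj (inf_le_left : U i ⊓ U j ≤ U i) (s i) =
      res F.obj (inf_le_right : U i ⊓ U j ≤ U j) (s j)) :
    ∃ t : F.obj.obj (op V), ∀ i, res F.obj (hU i) t = s i := by
  obtain ⟨t, ht, -⟩ := TopCat.Sheaf.existsUnique_gluing' F U V (fun i ↦ homOfLE (hU i)) hV s h
  exact ⟨t, ht⟩

lemma exists_res_eq₂ (F : AbSheaf X) {U V : Opens X}
    (s : F.obj.obj (op U)) (t : F.obj.obj (op V))
    (h : res F.obj (inf_le_left : U ⊓ V ≤ U) s = res F.obj (inf_le_right : U ⊓ V ≤ V) t) :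
    ∃ w : F.obj.obj (op (U ⊔ V)), res F.obj le_sup_left w = s ∧ res F.obj le_sup_right w = t := by
  let f : Bool → Opens X := fun b ↦ bif b then U else V
  let s' : ∀ b : Bool, F.obj.obj (op (f b)) := fun b ↦ match b with
    | true => s
    | false => t
  obtain ⟨w, hw⟩ := exists_res_eq F (U := f) (V := U ⊔ V)
    (Bool.forall_bool.2 ⟨le_sup_right, le_sup_left⟩) (sup_le (le_iSup f true) (le_iSup f false)) s'
    (by
      rintro (_ | _) (_ | _)
      · rfl
      · have := congrArg (res F.obj (le_of_eq (inf_comm V U))) h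
        rw [res_res, res_res] at this
        exact this.symm
      · exact h
      · rfl)
  exact ⟨w, hw true, hw false⟩

variable {S : ShortComplex (AbSheaf X)} (hS : S.ShortExact)
include hS

lemma f_app_injective (U : Opens X) : Function.Injective (S.f.hom.app (op U)).hom := by
  have := hS.mono_f
  have h2 : Mono ((sheafToPresheaf (Opens.grothendieckTopology X) AddCommGrpCat.{u}).map S.f) := inferInstance
  have h3 : Mono (S.f.hom.app (op U)) := (NatTrans.mono_iff_mono_app _).1 h2 (op U)
  exact (AddCommGrpCat.mono_iff_injective _).1 h3

lemma exists_f_app_eq {U : Opens X} (s : S.X₂.obj.obj (op U))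
    (h : (S.g.hom.app (op U)).hom s = 0) : ∃ t, (S.f.hom.app (op U)).hom t = s :=
  TopCat.Sheaf.sections_exact_of_left_exact hS.1 hS.2 s h

omit hS in
lemma g_app_f_app {U : Opens X} (s : S.X₁.obj.obj (op U)) :
    (S.g.hom.app (op U)).hom ((S.f.hom.app (op U)).hom s) = 0 := by
  have h : S.f.hom ≫ S.g.hom = 0 := congrArg (·.hom) S.zero
  have h2 := congrArg (fun φ ↦ (φ.app (op U)).hom s) h
  simpa using h2

lemma exists_local_g_app_eq {U : Opens X} (s : S.X₃.obj.obj (op U)) {x : X} (hx : x ∈ U) :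
    ∃ (V : Opens X) (hV : V ≤ U) (t : S.X₂.obj.obj (op V)), x ∈ V ∧
      (S.g.hom.app (op V)).hom t = res S.X₃.obj hV s := by
  have := (TopCat.Sheaf.isLocallySurjective_iff_epi S.g).mpr hS.epi_g
  obtain ⟨W, Wle, ⟨t₁, ht₁⟩, hW⟩ :=
    (TopCat.Presheaf.isLocallySurjective_iff S.g.hom).mp this U s x hx
  exact ⟨W, Wle, t₁, hW, ht₁⟩

end Sections

/-! ### Lifting sections along distinguished binary covers -/

section BinaryCovers

variable {X : TopCat.{u}} (adm : Opens X → Opens X → Prop)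

/-- The induction principle for an open set `U` saying that properties of open sets that pass to
smaller ones, hold locally on `U` and can be glued along the distinguished binary unions hold
for `U`. -/
def AdmInduction (U : Opens X) : Prop :=
  ∀ P : Opens X → Prop, P ⊥ → (∀ V W, V ≤ W → P W → P V) → (∀ x ∈ U, ∃ V, x ∈ V ∧ P V) →
    (∀ V W, adm V W → P V → P W → P (V ⊔ W)) → P U

/-- Every section over a distinguished binary intersection is a difference of sections over the
two members. -/
def BinarySurjective (F : TopCat.Presheaf AddCommGrpCat.{u} X) : Prop :=
  ∀ V W, adm V W → ∀ s : F.obj (op (V ⊓ W)), ∃ (a : F.obj (op V)) (b : F.obj (op W)),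
    res F inf_le_left a - res F inf_le_right b = s

/-- All restriction maps are surjective. -/
def Flabby (F : TopCat.Presheaf AddCommGrpCat.{u} X) : Prop :=
  ∀ (U V : Opens X) (h : V ≤ U), Function.Surjective (res F h)

variable {adm} {S : ShortComplex (AbSheaf X)} (hS : S.ShortExact)
include hS

/-- Lifts exist locally. Two lifts over `V` and `W` differ on `V ⊓ W` by a section of the kernel
sheaf; writing this as a difference of sections over `V` and `W` corrects the lifts so that they
glue. -/
lemma g_app_surjective_of_admInduction (h₁ : BinarySurjective adm S.X₁.obj) {U : Opens X}
    (hU : AdmInduction adm U) : Function.Surjective (S.g.hom.app (op U)).hom := by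
  intro q
  -- The inclusion in `U` is carried inside the induction predicate, because the section to be
  -- lifted restricts only to subsets of `U`.
  suffices h : ∃ h : U ≤ U, ∃ c, (S.g.hom.app (op U)).hom c = res S.X₃.obj h q by
    obtain ⟨h, c, hc⟩ := h
    exact ⟨c, hc.trans (res_self _ _ _)⟩
  refine hU (fun V ↦ ∃ h : V ≤ U, ∃ c, (S.g.hom.app (op V)).hom c = res S.X₃.obj h q) ?_ ?_ ?_ ?_
  · exact ⟨bot_le, 0, eq_of_res_eq S.X₃ (ι := Empty) (U := Empty.elim) (fun i ↦ i.elim) bot_le _ _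
      fun i ↦ i.elim⟩
  · rintro V W h ⟨hW, c, hc⟩
    exact ⟨h.trans hW, res _ h c, by rw [app_res, hc, res_res]⟩
  · intro x hx
    obtain ⟨V, hV, t, hxV, ht⟩ := exists_local_g_app_eq hS q hx
    exact ⟨V, hxV, hV, t, ht⟩
  · rintro V W hVW ⟨hV, c, hc⟩ ⟨hW, d, hd⟩
    obtain ⟨e, he⟩ := exists_f_app_eq hS (res S.X₂.obj (inf_le_left : V ⊓ W ≤ V) c -
      res S.X₂.obj (inf_le_right : V ⊓ W ≤ W) d) (by
        rw [map_sub, app_res, app_res, hc, hd, res_res, res_res, sub_self])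
    obtain ⟨a, b, hab⟩ := h₁ V W hVW e
    obtain ⟨w, hw₁, hw₂⟩ := exists_res_eq₂ S.X₂ (c - (S.f.hom.app (op V)).hom a)
      (d - (S.f.hom.app (op W)).hom b) (by
        have := congrArg (S.f.hom.app (op (V ⊓ W))).hom hab
        rw [map_sub, app_res, app_res, he] at this
        rw [map_sub, map_sub, sub_eq_sub_iff_sub_eq_sub, this])
    refine ⟨sup_le hV hW, w, ?_⟩
    refine eq_of_res_eq S.X₃ (ι := Bool) (U := fun b ↦ bif b then V else W)
      (Bool.forall_bool.2 ⟨le_sup_right, le_sup_left⟩)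
      (sup_le (le_iSup (fun b ↦ bif b then V else W) true)
        (le_iSup (fun b ↦ bif b then V else W) false)) _ _ ?_
    rintro (_ | _)
    · exact (app_res S.g.hom le_sup_right w).symm.trans
        ((congrArg _ hw₂).trans (by rw [map_sub, g_app_f_app, sub_zero, hd, res_res]))
    · exact (app_res S.g.hom le_sup_left w).symm.trans
        ((congrArg _ hw₁).trans (by rw [map_sub, g_app_f_app, sub_zero, hc, res_res]))

/-- A section of the quotient over `V ⊓ W` lifts to the middle sheaf, and flabbiness extends the
lift to `V`. The image of the extension serves as the first term of the difference, with `0` as the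
second. This keeps the hypothesis alive under dimension shifting. -/
lemma binarySurjective_of_shortExact (hadm : ∀ V W, adm V W → AdmInduction adm (V ⊓ W))
    (h₁ : BinarySurjective adm S.X₁.obj) (h₂ : Flabby S.X₂.obj) :
    BinarySurjective adm S.X₃.obj := by
  intro V W hVW s
  obtain ⟨t, rfl⟩ := g_app_surjective_of_admInduction hS h₁ (hadm V W hVW) s
  obtain ⟨t, rfl⟩ := h₂ V _ inf_le_left t
  exact ⟨(S.g.hom.app (op V)).hom t, 0, by rw [map_zero, sub_zero, app_res]⟩

end BinaryCovers

/-! ### The augmented Čech complex of all tuples -/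

section Cech

variable {X : TopCat.{u}} {ι : Type*} (U : ι → Opens X)

/-- The intersection of a finite tuple of members of a family of open sets. -/
def inter {p : ℕ} (σ : Fin p → ι) : Opens X :=
  ⟨⋂ j, (U (σ j) : Set X), isOpen_iInter_of_finite fun j ↦ (U (σ j)).isOpen⟩

lemma mem_inter {p : ℕ} {σ : Fin p → ι} {x : X} : x ∈ inter U σ ↔ ∀ j, x ∈ U (σ j) :=
  Set.mem_iInter

lemma inter_le_comp {p q : ℕ} (σ : Fin p → ι) (f : Fin q → Fin p) : inter U σ ≤ inter U (σ ∘ f) :=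
  fun _ hx ↦ (mem_inter U).2 fun j ↦ (mem_inter U).1 hx (f j)

/-- The augmented Čech complex of all tuples; the entry of index `p` has tuples of length `p`. -/
abbrev Cochain (F : TopCat.Presheaf AddCommGrpCat.{u} X) (p : ℕ) : Type _ :=
  ∀ σ : Fin p → ι, F.obj (op (inter U σ))

variable {U} in
/-- The Čech differential. -/
def cechD (F : TopCat.Presheaf AddCommGrpCat.{u} X) {p : ℕ} (c : Cochain U F p) :
    Cochain U F (p + 1) :=
  fun σ ↦ ∑ j : Fin (p + 1), (-1 : ℤ) ^ (j : ℕ) •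
    res F (inter_le_comp U σ j.succAbove) (c (σ ∘ j.succAbove))

/-- Exactness of the augmented Čech complex at the tuples of length `p + 1`. -/
def CechExact (F : TopCat.Presheaf AddCommGrpCat.{u} X) (p : ℕ) : Prop :=
  ∀ c : Cochain U F (p + 1), cechD F c = 0 → ∃ b : Cochain U F p, cechD F b = c

variable {U}

lemma res_congr (F : TopCat.Presheaf AddCommGrpCat.{u} X) {p : ℕ} (c : Cochain U F p)
    {V : Opens X} {σ τ : Fin p → ι} (h : σ = τ) (hσ : V ≤ inter U σ) (hτ : V ≤ inter U τ) :
    res F hσ (c σ) = res F hτ (c τ) := by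
  subst h; rfl

lemma cechD_zero (F : TopCat.Presheaf AddCommGrpCat.{u} X) (c : Cochain U F 0) (σ : Fin 1 → ι) :
    cechD F c σ = res F (inter_le_comp U σ Fin.elim0) (c (σ ∘ Fin.elim0)) := by
  refine (Fintype.sum_unique (ι := Fin 1) _).trans ?_
  rw [show ((default : Fin 1) : ℕ) = 0 from rfl, pow_zero, one_smul]
  exact res_congr F c (Subsingleton.elim _ _) _ _

/-- Deleting two positions can be done in either order. Exchanging the orders is an involution that
changes `i + j` by one, so the terms cancel in pairs. -/
lemma sum_sum_succAbove_eq_zero {M : Type*} [AddCommGroup M] {p : ℕ}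
    (f : Fin (p + 2) → Fin (p + 1) → M)
    (hf : ∀ i j, f (i.succAbove j) (j.predAbove i) = f i j) :
    ∑ i : Fin (p + 2), ∑ j : Fin (p + 1), (-1 : ℤ) ^ ((i : ℕ) + (j : ℕ)) • f i j = 0 := by
  rw [← Finset.sum_product' Finset.univ Finset.univ
    (fun (i : Fin (p + 2)) (j : Fin (p + 1)) ↦ (-1 : ℤ) ^ ((i : ℕ) + (j : ℕ)) • f i j)]
  refine Finset.sum_involution (fun a _ ↦ (a.1.succAbove a.2, a.2.predAbove a.1)) ?_ ?_ ?_ ?_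
  · rintro ⟨i, j⟩ -
    simp only [hf]
    rw [← add_smul]
    convert zero_smul ℤ _
    rcases le_or_gt i j.castSucc with h | h
    · rw [Fin.succAbove_of_le_castSucc _ _ h, Fin.predAbove_of_le_castSucc _ _ h]
      simp [pow_add, mul_comm]
    · rw [Fin.succAbove_of_castSucc_lt _ _ h, Fin.predAbove_of_castSucc_lt _ _ h]
      obtain ⟨i', rfl⟩ := Fin.exists_succ_eq.2 (Fin.ne_zero_of_lt h)
      simp [pow_add, mul_comm]
  · rintro ⟨i, j⟩ - - h
    exact Fin.succAbove_ne i j (congrArg Prod.fst h)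
  · simp
  · rintro ⟨i, j⟩ -
    exact Prod.ext (Fin.succAbove_succAbove_predAbove i j) (Fin.predAbove_predAbove_succAbove i j)

lemma cechD_cechD (F : TopCat.Presheaf AddCommGrpCat.{u} X) {p : ℕ} (c : Cochain U F p) :
    cechD F (cechD F c) = 0 := by
  funext σ
  simp only [cechD, map_sum, map_zsmul, res_res, Finset.smul_sum, smul_smul, ← pow_add]
  refine sum_sum_succAbove_eq_zero (fun i j ↦ res F _ (c ((σ ∘ i.succAbove) ∘ j.succAbove))) ?_
  intro i j
  refine res_congr F c ?_ _ _
  funext k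
  exact congrArg σ (Fin.succAbove_succAbove_succAbove_predAbove i j k)

lemma app_cechD {F G : TopCat.Presheaf AddCommGrpCat.{u} X} (φ : F ⟶ G) {p : ℕ}
    (c : Cochain U F p) (σ : Fin (p + 1) → ι) :
    (φ.app (op (inter U σ))).hom (cechD F c σ) =
      cechD G (fun τ ↦ (φ.app (op (inter U τ))).hom (c τ)) σ := by
  simp only [cechD, map_sum, map_zsmul, app_res]

lemma cechD_sub (F : TopCat.Presheaf AddCommGrpCat.{u} X) {p : ℕ} (c d : Cochain U F p) :
    cechD F (c - d) = cechD F c - cechD F d := by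
  funext σ
  simp [cechD, smul_sub]

lemma retract_app {F G : TopCat.Presheaf AddCommGrpCat.{u} X} (r : Retract F G) (V : Opens X)
    (s : F.obj (op V)) : (r.r.app (op V)).hom ((r.i.app (op V)).hom s) = s := by
  have h := r.retract
  have h2 : (r.i ≫ r.r).app (op V) = 𝟙 _ := by rw [h]; rfl
  exact congrArg (fun φ ↦ φ.hom s) h2

lemma CechExact.of_retract {F G : TopCat.Presheaf AddCommGrpCat.{u} X} (r : Retract F G) {p : ℕ}
    (h : CechExact U G p) : CechExact U F p := by
  intro c hc
  obtain ⟨b, hb⟩ := h (fun τ ↦ (r.i.app (op (inter U τ))).hom (c τ)) (by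
    funext σ
    rw [← app_cechD, hc]
    exact map_zero _)
  refine ⟨fun τ ↦ (r.r.app (op (inter U τ))).hom (b τ), ?_⟩
  funext σ
  rw [← app_cechD, hb, retract_app]

lemma Flabby.of_retract {F G : TopCat.Presheaf AddCommGrpCat.{u} X} (r : Retract F G)
    (h : Flabby G) : Flabby F := by
  intro V W hVW s
  obtain ⟨t, ht⟩ := h V W hVW ((r.i.app (op W)).hom s)
  refine ⟨(r.r.app (op V)).hom t, ?_⟩
  rw [← app_res, ht, retract_app]

variable {S : ShortComplex (AbSheaf X)} (hS : S.ShortExact)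
include hS

/-- A diagram chase: lift `q` to the middle sheaf, recognise the coboundary of the lift as a cocycle
of the kernel, and correct the lift into a cocycle. The primitive is kept as the image of a cochain
of the middle sheaf because, for the empty tuple, this is a lift of a global section. -/
lemma cechExact_of_shortExact {p : ℕ} (h₁ : CechExact U S.X₁.obj (p + 1))
    (h₂ : CechExact U S.X₂.obj p)
    (hg : ∀ σ : Fin (p + 1) → ι, Function.Surjective (S.g.hom.app (op (inter U σ))).hom) :
    ∀ q : Cochain U S.X₃.obj (p + 1), cechD _ q = 0 → ∃ e : Cochain U S.X₂.obj p,
      cechD _ (fun τ ↦ (S.g.hom.app (op (inter U τ))).hom (e τ)) = q := by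
  intro q hq
  choose c hc using fun σ ↦ hg σ (q σ)
  choose f hf using fun σ ↦ exists_f_app_eq hS (cechD _ c σ) (by
    rw [app_cechD, funext hc, hq]; rfl)
  obtain ⟨b, hb⟩ := h₁ f (by
    funext σ
    apply f_app_injective hS
    rw [app_cechD, funext hf]
    exact (congrFun (cechD_cechD _ c) σ).trans (map_zero _).symm)
  obtain ⟨e, he⟩ := h₂ (c - fun τ ↦ (S.f.hom.app (op (inter U τ))).hom (b τ)) (by
    rw [cechD_sub, sub_eq_zero]
    funext σ
    rw [← app_cechD, hb, hf])
  refine ⟨e, ?_⟩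
  funext σ
  rw [← app_cechD, he, ← hc σ]
  simp [g_app_f_app]

end Cech

/-! ### Godement sheaves and the passage from Čech to derived functor cohomology -/

section Acyclicity

variable {X : TopCat.{u}}

/-- The sheaf of all families of germs of `F`. -/
def godement (F : TopCat.Presheaf AddCommGrpCat.{u} X) : AbSheaf X where
  obj :=
    { obj V := AddCommGrpCat.of (∀ x : V.unop, F.stalk x.1)
      map i := AddCommGrpCat.ofHom
        { toFun f x := f (i.unop x)
          map_zero' := rfl
          map_add' _ _ := rfl } }
  property := (TopCat.Presheaf.isSheaf_iff_isSheaf_comp (forget AddCommGrpCat) _).2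
    (TopCat.Presheaf.toTypes_isSheaf X fun x ↦ F.stalk x)

/-- The map sending a section to its germs. -/
def toGodement (F : AbSheaf X) : F ⟶ godement F.obj where
  hom :=
    { app V := AddCommGrpCat.ofHom
        { toFun s x := TopCat.Presheaf.germ F.obj V.unop x.1 x.2 s
          map_zero' := by funext x; exact map_zero _
          map_add' _ _ := by funext x; exact map_add _ _ _ }
      naturality V W i := by
        ext s
        funext x
        exact TopCat.Presheaf.germ_res_apply' F.obj i x.1 x.2 s }

instance (F : AbSheaf X) : Mono (toGodement F) := by
  have h (V : (Opens X)ᵒᵖ) : Mono ((toGodement F).hom.app V) := by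
    refine (AddCommGrpCat.mono_iff_injective _).2 fun s t h ↦ ?_
    exact TopCat.Presheaf.section_ext F V.unop s t fun x hx ↦ congrFun (f := fun x : V.unop ↦ TopCat.Presheaf.germ F.obj V.unop x.1 x.2 s) h ⟨x, hx⟩
  have : Mono ((sheafToPresheaf (Opens.grothendieckTopology X) AddCommGrpCat.{u}).map (toGodement F)) :=
    NatTrans.mono_of_mono_app (toGodement F).hom
  exact Functor.mono_of_mono_map _ this

/-- Evaluation of a family of germs at a point. -/
def godementEval (F : TopCat.Presheaf AddCommGrpCat.{u} X) {V : Opens X} {x : X} (hx : x ∈ V) :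
    (godement F).obj.obj (op V) →+ F.stalk x where
  toFun s := (s : ∀ x : V, F.stalk x.1) ⟨x, hx⟩
  map_zero' := rfl
  map_add' _ _ := rfl

lemma godementEval_res (F : TopCat.Presheaf AddCommGrpCat.{u} X) {V W : Opens X} {x : X}
    (hx : x ∈ V) (h : V ≤ W) (s : (godement F).obj.obj (op W)) :
    godementEval F hx (res (godement F).obj h s) = godementEval F (h hx) s := rfl

lemma flabby_godement (F : TopCat.Presheaf AddCommGrpCat.{u} X) : Flabby (godement F).obj := by
  classical
  intro U V h s
  refine ⟨fun x ↦ if hx : x.1 ∈ V then s ⟨x.1, hx⟩ else 0, ?_⟩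
  funext x
  exact dif_pos x.2

/-- A section is an unconstrained family of germs, so one may choose for each point `x` an index `e
x` with `x ∈ U (e x)`. Prepending `e x` to the tuple, separately at each point, is a contracting
homotopy. -/
lemma cechExact_godement (F : TopCat.Presheaf AddCommGrpCat.{u} X) {ι : Type*} {U : ι → Opens X}
    (hU : ⨆ i, U i = ⊤) (p : ℕ) : CechExact U (godement F).obj p := by
  intro c hc
  have hx (x : X) : ∃ i, x ∈ U i := Opens.mem_iSup.1 (hU ▸ Opens.mem_top x)
  choose e he using hx
  have hmem {q : ℕ} {σ : Fin q → ι} (x : inter U σ) :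
      x.1 ∈ inter U (Fin.cons (e x.1) σ : Fin (q + 1) → ι) :=
    (mem_inter U).2 (Fin.cases (he x.1) fun j ↦ (mem_inter U).1 x.2 j)
  let b : Cochain U (godement F).obj p :=
    fun τ ↦ (fun x : inter U τ ↦ godementEval F (hmem x) (c (Fin.cons (e x.1) τ)))
  have hb {τ : Fin p → ι} {x : X} (hx : x ∈ inter U τ) :
      godementEval F hx (b τ) = godementEval F (hmem ⟨x, hx⟩) (c (Fin.cons (e x) τ)) := rfl
  refine ⟨b, ?_⟩
  funext σ
  refine funext fun x ↦ ?_
  have hσ := (mem_inter U).1 (hmem x)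
  have h := congrArg (godementEval F (hmem x)) (congrFun hc (Fin.cons (e x.1) σ))
  simp only [cechD, map_sum, map_zsmul, godementEval_res, Pi.zero_apply, map_zero] at h
  change godementEval F x.2 (cechD _ b σ) = godementEval F x.2 (c σ)
  simp only [cechD, map_sum, map_zsmul, godementEval_res, hb]
  have hc' {τ τ' : Fin (p + 1) → ι} (h : τ = τ') (h1 : x.1 ∈ inter U τ) (h2 : x.1 ∈ inter U τ') :
      godementEval F h1 (c τ) = godementEval F h2 (c τ') := by
    subst h; rfl
  rw [Fin.sum_univ_succ] at h
  simp only [Fin.val_zero, pow_zero, one_smul, Fin.val_succ, pow_succ, mul_neg, mul_one, neg_smul,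
    Finset.sum_neg_distrib] at h
  rw [add_neg_eq_zero] at h
  refine Eq.trans (Finset.sum_congr rfl fun j _ ↦ ?_) (h.symm.trans (hc' ?_ _ _))
  · refine congrArg _ (hc' ?_ (hmem ⟨x.1, inter_le_comp U σ _ x.2⟩) _)
    funext k
    refine Fin.cases ?_ (fun k ↦ ?_) k <;> simp
  · funext k; simp

variable (F : AbSheaf X)

/-- An injective sheaf is a retract of its Godement sheaf. -/
def retractGodement [Injective F] : Retract F.obj (godement F.obj).obj where
  i := (toGodement F).hom
  r := (Injective.factorThru (𝟙 F) (toGodement F)).hom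
  retract := congrArg (·.hom) (Injective.comp_factorThru (𝟙 F) (toGodement F))

lemma exists_shortExact : ∃ S : ShortComplex (AbSheaf X),
    S.ShortExact ∧ S.X₁ = F ∧ Injective S.X₂ :=
  ⟨ShortComplex.mk (Injective.ι F) (Limits.cokernel.π (Injective.ι F)) (by simp),
    { exact := ShortComplex.exact_cokernel _ }, rfl,
    (inferInstance : Injective (Injective.under F))⟩

/-- Cohomology of a sheaf of abelian groups on a topological space. -/
abbrev HH (n : ℕ) : Type u :=
  Sheaf.H.{u} F n

variable {F}

lemma HH_subsingleton_X₁ {S : ShortComplex (AbSheaf X)}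
    (hS : S.ShortExact) {n : ℕ} (h₂ : Subsingleton (HH S.X₂ (n + 1)))
    (h₃ : Subsingleton (HH S.X₃ n)) : Subsingleton (HH S.X₁ (n + 1)) := by
  refine subsingleton_of_forall_eq 0 fun x ↦ ?_
  obtain ⟨y, rfl⟩ := Abelian.Ext.covariant_sequence_exact₁ _ hS x (Subsingleton.elim (α := HH S.X₂ (n + 1)) _ _) rfl
  rw [Subsingleton.elim (α := HH S.X₃ n) y 0]
  exact Abelian.Ext.zero_comp ..

/-- A class that dies in the middle term is the connecting image of a global section of the
quotient. That section lifts, so its connecting image is zero. -/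
lemma HH_subsingleton_X₁_one {S : ShortComplex (AbSheaf X)}
    (hS : S.ShortExact) (h₂ : Subsingleton (HH S.X₂ 1))
    (h₃ : Function.Surjective (S.g.hom.app (op ⊤)).hom) : Subsingleton (HH S.X₁ 1) := by
  refine subsingleton_of_forall_eq 0 fun x ↦ ?_
  obtain ⟨y, rfl⟩ := Abelian.Ext.covariant_sequence_exact₁ _ hS x (Subsingleton.elim (α := HH S.X₂ (0 + 1)) _ _) rfl
  obtain ⟨z, hz⟩ := h₃ (Sheaf.H.equiv₀ S.X₃ Limits.isTerminalTop y)
  obtain ⟨w, rfl⟩ := (Sheaf.H.equiv₀ S.X₂ Limits.isTerminalTop).surjective z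
  have hw : Sheaf.H.map S.g 0 w = y := by
    apply (Sheaf.H.equiv₀ S.X₃ Limits.isTerminalTop).injective
    rw [← hz, ← Sheaf.H.equiv₀_naturality]
  rw [← hw]
  refine (Abelian.Ext.comp_assoc_of_second_deg_zero w (Abelian.Ext.mk₀ S.g) hS.extClass rfl).trans ?_
  rw [hS.comp_extClass]
  exact Abelian.Ext.comp_zero ..

/-- Dimension shifting. Embed `F` in an injective sheaf, which is a retract of its Godement sheaf
and hence flabby and Čech exact. The quotient inherits both hypotheses one degree lower, since
sections over finite intersections of the cover still lift to the injective sheaf. -/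
theorem HH_subsingleton_of_cechExact (adm : Opens X → Opens X → Prop)
    (hadm : ∀ V W, adm V W → AdmInduction adm (V ⊓ W)) {ι : Type*} {U : ι → Opens X}
    (hU : ⨆ i, U i = ⊤)
    (hind : ∀ (p : ℕ) (σ : Fin (p + 1) → ι), AdmInduction adm (inter U σ)) (n : ℕ) :
    ∀ F : AbSheaf X, BinarySurjective adm F.obj → CechExact U F.obj (n + 1) →
      Subsingleton (HH F (n + 1)) := by
  induction n with
  | zero =>
    intro F hF hc
    obtain ⟨S, hS, rfl, hinj⟩ := exists_shortExact F
    refine HH_subsingleton_X₁_one hS inferInstance fun q ↦ ?_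
    have hT (σ : Fin 0 → ι) : inter U σ = ⊤ := by
      ext x; simp [inter]
    obtain ⟨e, he⟩ := cechExact_of_shortExact hS hc
      ((cechExact_godement _ hU _).of_retract (retractGodement _))
      (fun σ ↦ g_app_surjective_of_admInduction hS hF (hind _ σ))
      -- The restrictions of a global section form a cocycle on tuples of length one. A primitive
      -- lives on the empty tuple, whose intersection is the whole space, and so is a global lift.
      (fun σ ↦ res S.X₃.obj le_top q) (by
        funext σ
        simp [cechD, res_res, Fin.sum_univ_succ])
    refine ⟨res _ (hT Fin.elim0).ge (e Fin.elim0), ?_⟩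
    refine eq_of_res_eq S.X₃ (fun i ↦ le_top) hU.ge _ _ fun i ↦ ?_
    have h := congrFun he (fun _ ↦ i)
    have hi : U i ≤ inter U (fun _ : Fin 1 ↦ i) := fun x hx ↦ (mem_inter U).2 fun _ ↦ hx
    have h2 := congrArg (res S.X₃.obj hi) h
    rw [res_res] at h2
    rw [← h2, app_res]
    rw [cechD_zero, res_res, res_res]
    exact res_congr S.X₃.obj (fun τ ↦ (S.g.hom.app (op (inter U τ))).hom (e τ))
      (Subsingleton.elim _ _) _ _
  | succ n ih =>
    intro F hF hc
    obtain ⟨S, hS, rfl, hinj⟩ := exists_shortExact F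
    refine HH_subsingleton_X₁ hS inferInstance (ih _ ?_ ?_)
    · exact binarySurjective_of_shortExact hS hadm hF ((flabby_godement _).of_retract (retractGodement _))
    · intro q hq
      obtain ⟨e, he⟩ := cechExact_of_shortExact hS hc
        ((cechExact_godement _ hU _).of_retract (retractGodement _))
        (fun σ ↦ g_app_surjective_of_admInduction hS hF (hind _ σ)) q hq
      exact ⟨_, he⟩

end Acyclicity

/-! ### Affine open sets satisfy the binary induction and splitting conditions -/

section AffineCovers

variable {X : Scheme.{u}} {ι : Type*} (W : ι → X.Opens)

/-- The covers of an affine open set, contained in a member of `W`, by the loci where `f` and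
`1 - f` do not vanish. -/
def affineAdm (V V' : Opens X.carrier) : Prop :=
  ∃ (U : X.Opens) (_ : IsAffineOpen U) (i : ι) (_ : U ≤ W i) (f g : Γ(X, U)), f + g = 1 ∧
    V = X.basicOpen f ∧ V' = X.basicOpen g

lemma basicOpen_sup_eq_of_add_eq_one {U : X.Opens} {f g : Γ(X, U)} (h : f + g = 1) :
    X.basicOpen f ⊔ X.basicOpen g = U := by
  have := iSup_basicOpen_of_span_eq_top U {f, g} (by
    rw [Ideal.eq_top_iff_one, ← h]
    exact add_mem (Ideal.subset_span (by simp)) (Ideal.subset_span (by simp)))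
  rwa [iSup_pair] at this

variable {W} in
-- Induction on the number of generators of the unit ideal. Write `1 = a f₀ + g` with `g` in the
-- ideal of the others. Then `D(a f₀) ⊆ D(f₀)`, while on `D(g)` the element `g` is a unit, so the
-- remaining functions generate the unit ideal there. With no generators the open set is empty.
lemma affineAdm_of_span_eq_top {P : Opens X.carrier → Prop} (h₀ : P ⊥)
    (hmono : ∀ V W, V ≤ W → P W → P V) (hP : ∀ V V', affineAdm W V V' → P V → P V' → P (V ⊔ V'))
    {i : ι} (n : ℕ) : ∀ (U : X.Opens) (_ : IsAffineOpen U) (_ : U ≤ W i) (f : Fin n → Γ(X, U)),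
      Ideal.span (Set.range f) = ⊤ → (∀ j, P (X.basicOpen (f j))) → P U := by
  induction n with
  | zero =>
    intro U hU hi f hf _
    have := iSup_basicOpen_of_span_eq_top U _ hf
    simp only [Set.range_eq_empty, Set.mem_empty_iff_false, iSup_false, iSup_bot] at this
    exact this ▸ h₀
  | succ n ih =>
    intro U hU hi f hf hPf
    have h1 : (1 : Γ(X, U)) ∈ Ideal.span (insert (f 0) (Set.range fun j : Fin n ↦ f j.succ)) := by
      rw [← Fin.range_cons, Fin.cons_self_tail f |> (show Fin.cons (f 0) (fun j ↦ f j.succ) = f from ·), hf]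
      trivial
    obtain ⟨a, g, hg, hag⟩ := Ideal.mem_span_insert.1 h1
    rw [← basicOpen_sup_eq_of_add_eq_one hag.symm]
    refine hP _ _ ⟨U, hU, i, hi, _, _, hag.symm, rfl, rfl⟩ (hmono _ _ ?_ (hPf 0))
      (ih _ (hU.basicOpen g) ((X.basicOpen_le g).trans hi)
        (fun j ↦ X.presheaf.map (homOfLE (X.basicOpen_le g)).op (f j.succ)) ?_ fun j ↦ ?_)
    · rw [X.basicOpen_mul]
      exact inf_le_right
    · have hu := RingedSpace.isUnit_res_basicOpen X.toRingedSpace g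
      refine Ideal.eq_top_of_isUnit_mem _ ?_ hu
      have := Ideal.mem_map_of_mem (X.presheaf.map (homOfLE (X.basicOpen_le g)).op).hom hg
      rw [Ideal.map_span, ← Set.range_comp] at this
      exact this
    · refine hmono _ _ ?_ (hPf j.succ)
      rw [X.basicOpen_res]
      exact inf_le_right

/-- Refine the local open sets to basic ones. Finitely many of these already generate the unit
ideal, by quasi-compactness. -/
lemma admInduction_affine {U : X.Opens} (hU : IsAffineOpen U) {i : ι} (hi : U ≤ W i) :
    AdmInduction (affineAdm W) U := by
  intro P h₀ hmono hloc hP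
  have h (x : U) : ∃ f : Γ(X, U), x.1 ∈ X.basicOpen f ∧ P (X.basicOpen f) := by
    obtain ⟨V, hxV, hV⟩ := hloc x.1 x.2
    obtain ⟨f, hf, hx⟩ := hU.exists_basicOpen_le (V := V) ⟨x.1, hxV⟩ x.2
    exact ⟨f, hx, hmono _ _ hf hV⟩
  choose f hf₁ hf₂ using h
  have hspan : Ideal.span (Set.range f) = ⊤ := by
    rw [← hU.self_le_iSup_basicOpen_iff]
    intro x hx
    rw [iSup_range', Opens.mem_iSup]
    exact ⟨_, hf₁ ⟨x, hx⟩⟩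
  obtain ⟨t, ht₁, ht₂⟩ := (Ideal.span_eq_top_iff_finite _).mp hspan
  obtain ⟨n, e⟩ : ∃ n, Nonempty (Fin n ≃ t) := ⟨_, ⟨t.equivFin.symm⟩⟩
  obtain ⟨e⟩ := e
  refine affineAdm_of_span_eq_top h₀ hmono hP n U hU hi (fun j ↦ (e j).1) ?_ fun j ↦ ?_
  · rw [← ht₂]
    congr 1
    ext y
    constructor
    · rintro ⟨j, rfl⟩
      exact (e j).2
    · intro hy
      exact ⟨e.symm ⟨y, hy⟩, by simp⟩
  · obtain ⟨x, hx⟩ := ht₁ (e j).2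
    simp only [← hx]
    exact hf₂ x

lemma admInduction_inf_of_affineAdm {V V' : Opens X.carrier} (h : affineAdm W V V') :
    AdmInduction (affineAdm W) (V ⊓ V') := by
  obtain ⟨U, hU, i, hi, f, g, hfg, rfl, rfl⟩ := h
  rw [← X.basicOpen_mul]
  exact admInduction_affine W (hU.basicOpen _) ((X.basicOpen_le _).trans hi)

/-- Write `s = m / (f g)^N`. The powers `f^N` and `g^N` are still coprime, and `p f^N + q g^N = 1`
gives `s = q m / f^N + p m / g^N`. -/
lemma exists_sub_eq_of_add_eq_one {U : X.Opens} (hU : IsAffineOpen U) {f g : Γ(X, U)}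
    (h : f + g = 1) (s : Γ(X, X.basicOpen f ⊓ X.basicOpen g)) :
    ∃ (a : Γ(X, X.basicOpen f)) (b : Γ(X, X.basicOpen g)),
      X.presheaf.map (homOfLE inf_le_left).op a - X.presheaf.map (homOfLE inf_le_right).op b = s := by
  have hle : X.basicOpen f ⊓ X.basicOpen g ≤ U := inf_le_left.trans (X.basicOpen_le f)
  let := (X.presheaf.map (homOfLE hle).op).hom.toAlgebra
  have hloc : IsLocalization.Away (f * g) Γ(X, X.basicOpen f ⊓ X.basicOpen g) :=
    hU.isLocalization_of_eq_basicOpen (f * g) (homOfLE hle) (X.basicOpen_mul f g).symm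
  obtain ⟨N, m, hm⟩ := IsLocalization.Away.surj (f * g) s
  have hcop : IsCoprime (f ^ N) (g ^ N) := IsCoprime.pow ⟨1, 1, by simpa using h⟩
  obtain ⟨p, q, hpq⟩ := hcop
  let ρf := X.presheaf.map (homOfLE (X.basicOpen_le f)).op
  let ρg := X.presheaf.map (homOfLE (X.basicOpen_le g)).op
  have huf : IsUnit (ρf f) := RingedSpace.isUnit_res_basicOpen X.toRingedSpace f
  have hug : IsUnit (ρg g) := RingedSpace.isUnit_res_basicOpen X.toRingedSpace g
  obtain ⟨f', hf'⟩ := huf.exists_right_inv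
  obtain ⟨g', hg'⟩ := hug.exists_right_inv
  let rf := X.presheaf.map
    (homOfLE (inf_le_left : X.basicOpen f ⊓ X.basicOpen g ≤ X.basicOpen f)).op
  let rg := X.presheaf.map
    (homOfLE (inf_le_right : X.basicOpen f ⊓ X.basicOpen g ≤ X.basicOpen g)).op
  let ρ := X.presheaf.map (homOfLE hle).op
  have h1 (y) : rf (ρf y) = ρ y := by
    simp only [rf, ρf, ρ, ← ConcreteCategory.comp_apply, ← Functor.map_comp]; rfl
  have h2 (y) : rg (ρg y) = ρ y := by
    simp only [rg, ρg, ρ, ← ConcreteCategory.comp_apply, ← Functor.map_comp]; rfl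
  change s * ρ (f * g) ^ N = ρ m at hm
  refine ⟨ρf (q * m) * f' ^ N, - (ρg (p * m) * g' ^ N), ?_⟩
  change rf _ - rg _ = s
  have hf'' := congrArg rf hf'
  have hg'' := congrArg rg hg'
  have hpq' := congrArg ρ hpq
  simp only [map_mul, map_one, h1, h2, map_neg, map_pow, map_add] at hf'' hg'' hpq' hm ⊢
  rw [← hm]
  have e1 : ρ f ^ N * rf f' ^ N = 1 := by rw [← mul_pow, hf'', one_pow]
  have e2 : ρ g ^ N * rg g' ^ N = 1 := by rw [← mul_pow, hg'', one_pow]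
  linear_combination (ρ q * s * ρ g ^ N) * e1 + (ρ p * s * ρ f ^ N) * e2 + s * hpq'

end AffineCovers

/-! ### Calculus of sections of twisting sheaves as functions to local rings -/

section TwistFunctions

variable {A σ : Type u} [CommRing A] [SetLike σ A] [AddSubgroupClass σ A]
variable {𝒜 : ℕ → σ} [GradedRing 𝒜] {k l : ℤ} {U V : Opens (ProjectiveSpectrum.top 𝒜)}

/-- A function on `U` with values in the local rings is a section of `𝒪(k)`. -/
def IsTwist (k : ℤ) (U : Opens (ProjectiveSpectrum.top 𝒜)) (f : ∀ x : U, LocAt 𝒜 x.1) : Prop :=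
  (isLocallyFractionOfDegree 𝒜 k).pred f

lemma mem_twistSections {f : ∀ x : U, LocAt 𝒜 x.1} :
    f ∈ twistSections 𝒜 k (op U) ↔ IsTwist k U f := Iff.rfl

lemma IsTwist.res {f : ∀ x : U, LocAt 𝒜 x.1} (hf : IsTwist k U f) (h : V ≤ U) :
    IsTwist k V (fun x : V ↦ f ⟨x.1, h x.2⟩) :=
  (isLocallyFractionOfDegree 𝒜 k).res (homOfLE h) f hf

lemma IsTwist.of_locally {f : ∀ x : U, LocAt 𝒜 x.1}
    (h : ∀ x : U, ∃ (V : Opens (ProjectiveSpectrum.top 𝒜)) (_ : x.1 ∈ V) (hV : V ≤ U),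
      IsTwist k V (fun x : V ↦ f ⟨x.1, hV x.2⟩)) : IsTwist k U f :=
  (isLocallyFractionOfDegree 𝒜 k).locality f fun x ↦
    let ⟨V, hx, hV, hf⟩ := h x
    ⟨V, hx, homOfLE hV, hf⟩

lemma isTwist_zero : IsTwist k U 0 := (twistSections 𝒜 k (op U)).zero_mem

lemma IsTwist.add {f g : ∀ x : U, LocAt 𝒜 x.1} (hf : IsTwist k U f) (hg : IsTwist k U g) :
    IsTwist k U (fun x ↦ f x + g x) := (twistSections 𝒜 k (op U)).add_mem hf hg

lemma IsTwist.sub {f g : ∀ x : U, LocAt 𝒜 x.1} (hf : IsTwist k U f) (hg : IsTwist k U g) :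
    IsTwist k U (fun x ↦ f x - g x) := (twistSections 𝒜 k (op U)).sub_mem hf hg

lemma IsTwist.neg {f : ∀ x : U, LocAt 𝒜 x.1} (hf : IsTwist k U f) :
    IsTwist k U (fun x ↦ - f x) := (twistSections 𝒜 k (op U)).neg_mem hf

lemma IsTwist.sum {ι : Type*} {s : Finset ι} {f : ι → ∀ x : U, LocAt 𝒜 x.1}
    (hf : ∀ i ∈ s, IsTwist k U (f i)) : IsTwist k U (fun x ↦ ∑ i ∈ s, f i x) := by
  have := (twistSections 𝒜 k (op U)).sum_mem hf
  convert (mem_twistSections.1 this) using 1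
  funext x
  exact (Finset.sum_apply x s f).symm

lemma IsTwist.mul {f g : ∀ x : U, LocAt 𝒜 x.1} (hf : IsTwist k U f) (hg : IsTwist l U g) :
    IsTwist (k + l) U (fun x ↦ f x * g x) := by
  intro x
  rcases hf x with ⟨Va, ma, ia, na, da, ra, sa, hsa, hda, wa⟩
  rcases hg x with ⟨Vb, mb, ib, nb, db, rb, sb, hsb, hdb, wb⟩
  refine ⟨Va ⊓ Vb, ⟨ma, mb⟩, Opens.infLELeft _ _ ≫ ia, na + nb, da + db,
    ⟨ra.1 * rb.1, SetLike.mul_mem_graded ra.2 rb.2⟩,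
    ⟨sa.1 * sb.1, SetLike.mul_mem_graded sa.2 sb.2⟩,
    fun y h ↦ (y.1.isPrime.mem_or_mem h).elim (hsa ⟨y.1, y.2.1⟩) (hsb ⟨y.1, y.2.2⟩),
    by push_cast; omega, fun y ↦ ?_⟩
  have h1 := wa ⟨y.1, y.2.1⟩
  have h2 := wb ⟨y.1, y.2.2⟩
  exact (congrArg₂ (· * ·) h1 h2).trans (Localization.mk_mul _ _ _ _)

lemma isTwist_mk {i j : ℕ} {r s : A} (hr : r ∈ 𝒜 i) (hs : s ∈ 𝒜 j)
    (h : ∀ x : U, s ∉ x.1.asHomogeneousIdeal) (hk : (i : ℤ) = j + k) :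
    IsTwist k U (fun x ↦ Localization.mk r ⟨s, h x⟩) :=
  fun x ↦ ⟨U, x.2, 𝟙 U, i, j, ⟨r, hr⟩, ⟨s, hs⟩, h, hk, fun _ ↦ rfl⟩

lemma isTwist_algebraMap {i : ℕ} {r : A} (hr : r ∈ 𝒜 i) (hk : (i : ℤ) = k) :
    IsTwist k U (fun x ↦ algebraMap A (LocAt 𝒜 x.1) r) := by
  have h (x : U) : (1 : A) ∉ x.1.asHomogeneousIdeal := x.1.isPrime.one_notMem
  convert isTwist_mk (U := U) hr SetLike.GradedOne.one_mem h (by simpa using hk) using 1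
  funext x
  exact (Localization.mk_one_eq_algebraMap r).symm

lemma IsTwist.pow {f : ∀ x : U, LocAt 𝒜 x.1} (hf : IsTwist k U f) (n : ℕ) :
    IsTwist (n * k) U (fun x ↦ f x ^ n) := by
  induction n with
  | zero =>
    simpa using isTwist_algebraMap (U := U) (𝒜 := 𝒜) (k := 0) SetLike.GradedOne.one_mem rfl
  | succ n ih =>
    have := ih.mul hf
    simp only [pow_succ]
    convert this using 1
    push_cast; ring

lemma algebraMap_mul_mk_one (x : ProjectiveSpectrum 𝒜) {s : A} (h : s ∉ x.asHomogeneousIdeal) :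
    algebraMap A (LocAt 𝒜 x) s * Localization.mk 1 ⟨s, h⟩ = 1 := by
  rw [← Localization.mk_one_eq_algebraMap, Localization.mk_mul, mul_one, one_mul]
  exact Localization.mk_self (⟨s, h⟩ : x.asHomogeneousIdeal.toIdeal.primeCompl)

/-- On the locus where an element of degree one does not vanish, `𝒪(k)` has a generator. -/
lemma exists_isTwist_mul_eq_one {s : A} (hs : s ∈ 𝒜 1) (h : ∀ x : U, s ∉ x.1.asHomogeneousIdeal)
    (k : ℤ) : ∃ (e e' : ∀ x : U, LocAt 𝒜 x.1), IsTwist k U e ∧ IsTwist (-k) U e' ∧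
      ∀ x, e x * e' x = 1 := by
  have key (n : ℕ) : ∃ (e e' : ∀ x : U, LocAt 𝒜 x.1), IsTwist n U e ∧ IsTwist (-n) U e' ∧
      ∀ x, e x * e' x = 1 := by
    have h1 := (isTwist_algebraMap (U := U) (𝒜 := 𝒜) hs rfl).pow n
    have h2 := (isTwist_mk (U := U) (k := -1) SetLike.GradedOne.one_mem hs h rfl).pow n
    rw [Nat.cast_one, mul_one] at h1
    rw [mul_neg, mul_one] at h2
    refine ⟨_, _, h1, h2, fun x ↦ ?_⟩
    rw [← mul_pow]
    exact (congrArg (· ^ n) (algebraMap_mul_mk_one x.1 (h x))).trans (one_pow n)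
  obtain ⟨n, rfl | rfl⟩ := k.eq_nat_or_neg
  · exact key n
  · obtain ⟨e, e', he, he', h⟩ := key n
    exact ⟨e', e, he', by simpa using he, fun x ↦ (mul_comm _ _).trans (h x)⟩

/-- The degree zero part of the local ring at a point of `Proj 𝒜`. -/
abbrev HomogLocAt (𝒜 : ℕ → σ) [GradedRing 𝒜] (x : ProjectiveSpectrum 𝒜) : Type u :=
  HomogeneousLocalization.AtPrime 𝒜 x.asHomogeneousIdeal.toIdeal

/-- Sections of `𝒪(0)` are sections of the structure sheaf. -/
lemma IsTwist.exists_section {f : ∀ x : U, LocAt 𝒜 x.1} (hf : IsTwist 0 U f) :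
    ∃ c : (ProjectiveSpectrum.Proj.structureSheaf 𝒜).presheaf.obj (op U),
      ∀ x, (c.1 x).val = f x := by
  have h (x : U) : ∃ c : HomogLocAt 𝒜 x.1,
      c.val = f x := by
    obtain ⟨V, hx, i, a, b, r, s, hs, hk, hV⟩ := hf x
    obtain rfl : a = b := by omega
    refine ⟨.mk ⟨a, r, s, hs ⟨x.1, hx⟩⟩, ?_⟩
    rw [HomogeneousLocalization.val_mk]
    exact (hV ⟨x.1, hx⟩).symm
  choose c hc using h
  refine ⟨⟨c, fun x ↦ ?_⟩, hc⟩
  obtain ⟨V, hx, i, a, b, r, s, hs, hk, hV⟩ := hf x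
  obtain rfl : a = b := by omega
  refine ⟨V, hx, i, a, r, s, hs, fun y ↦ ?_⟩
  apply HomogeneousLocalization.val_injective
  rw [HomogeneousLocalization.val_mk]
  exact (hc _).trans (hV y)

lemma isTwist_val (c : (ProjectiveSpectrum.Proj.structureSheaf 𝒜).presheaf.obj (op U)) :
    IsTwist 0 U (fun x ↦ (c.1 x).val) := by
  intro x
  obtain ⟨V, hx, i, a, r, s, hs, hV⟩ := c.2 x
  refine ⟨V, hx, i, a, a, r, s, hs, by simp, fun y ↦ ?_⟩
  exact (congrArg HomogeneousLocalization.val (hV y)).trans (HomogeneousLocalization.val_mk _)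

end TwistFunctions

/-! ### Subsheaves of direct sums of `𝒪(k)` cut out by pointwise linear conditions -/

section LinearSheaves

variable {A σ : Type u} [CommRing A] [SetLike σ A] [AddSubgroupClass σ A]
variable (𝒜 : ℕ → σ) [GradedRing 𝒜] (T : Type u) (k : ℤ)
variable (P : ∀ x : ProjectiveSpectrum 𝒜, Submodule (LocAt 𝒜 x) (T → LocAt 𝒜 x))

/-- The families, indexed by `T`, of sections of `𝒪(k)` satisfying a pointwise linear condition. -/
def linearPredicate :
    TopCat.LocalPredicate fun x : ProjectiveSpectrum.top 𝒜 ↦ (T → LocAt 𝒜 x) where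
  pred {U} f := (∀ t, IsTwist k U (fun x ↦ f x t)) ∧ ∀ x : U, f x ∈ P x.1
  res i _ h := ⟨fun t ↦ (h.1 t).res i.le, fun x ↦ h.2 (i x)⟩
  locality _ h := ⟨fun t ↦ IsTwist.of_locally fun x ↦
    let ⟨V, hx, i, hf⟩ := h x
    ⟨V, hx, i.le, hf.1 t⟩, fun x ↦
    let ⟨_, hx, _, hf⟩ := h x
    hf.2 ⟨x.1, hx⟩⟩

/-- The sections over `U` of the sheaf of families of sections of `𝒪(k)` satisfying a linear
condition. -/
def linearSections (U : (Opens (ProjectiveSpectrum.top 𝒜))ᵒᵖ) :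
    AddSubgroup (∀ x : U.unop, T → LocAt 𝒜 x.1) where
  carrier := {f | (linearPredicate 𝒜 T k P).pred f}
  zero_mem' := ⟨fun _ ↦ isTwist_zero, fun x ↦ (P x.1).zero_mem⟩
  add_mem' ha hb := ⟨fun t ↦ (ha.1 t).add (hb.1 t), fun x ↦ (P x.1).add_mem (ha.2 x) (hb.2 x)⟩
  neg_mem' ha := ⟨fun t ↦ (ha.1 t).neg, fun x ↦ (P x.1).neg_mem (ha.2 x)⟩

instance linearModule (U : (Opens (ProjectiveSpectrum.top 𝒜))ᵒᵖ) :
    Module ((ProjectiveSpectrum.Proj.structureSheaf 𝒜).presheaf.obj U)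
      (linearSections 𝒜 T k P U) where
  smul c f := ⟨fun x ↦ (c.1 x).val • f.1 x,
    fun t ↦ by simpa using (isTwist_val (U := U.unop) c).mul (f.2.1 t),
    fun x ↦ (P x.1).smul_mem _ (f.2.2 x)⟩
  one_smul f := Subtype.ext <| funext fun x ↦
    (congrArg (· • f.1 x) (HomogeneousLocalization.val_one)).trans (one_smul _ _)
  mul_smul _ _ f := Subtype.ext <| funext fun x ↦
    (congrArg (· • f.1 x) (HomogeneousLocalization.val_mul _ _)).trans (mul_smul _ _ _)
  smul_zero _ := Subtype.ext <| funext fun _ ↦ smul_zero _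
  smul_add _ _ _ := Subtype.ext <| funext fun _ ↦ smul_add _ _ _
  add_smul _ _ f := Subtype.ext <| funext fun x ↦
    (congrArg (· • f.1 x) (HomogeneousLocalization.val_add _ _)).trans (add_smul _ _ _)
  zero_smul f := Subtype.ext <| funext fun x ↦
    (congrArg (· • f.1 x) (HomogeneousLocalization.val_zero)).trans (zero_smul _ _)

/-- The abelian presheaf of families of sections of `𝒪(k)` satisfying a linear condition. -/
def linearPresheaf : TopCat.Presheaf AddCommGrpCat.{u} (ProjectiveSpectrum.top 𝒜) where
  obj U := AddCommGrpCat.of (linearSections 𝒜 T k P U)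
  map i := AddCommGrpCat.ofHom
    { toFun := (TopCat.subsheafToTypes (linearPredicate 𝒜 T k P)).1.map i
      map_zero' := rfl
      map_add' := fun _ _ ↦ rfl }

instance (U : (Proj 𝒜).Opensᵒᵖ) :
    Module ((Proj 𝒜).ringCatSheaf.obj.obj U) ((linearPresheaf 𝒜 T k P).obj U) :=
  linearModule 𝒜 T k P U

lemma linearPresheaf_isSheaf : (linearPresheaf 𝒜 T k P).IsSheaf :=
  (TopCat.Presheaf.isSheaf_iff_isSheaf_comp (forget AddCommGrpCat) _).2
    (TopCat.subsheafToTypes (linearPredicate 𝒜 T k P)).2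

/-- The sheaf of modules of families of sections of `𝒪(k)` satisfying a linear condition. -/
def linearSheaf : (Proj 𝒜).Modules where
  val := PresheafOfModules.ofPresheaf (R := (Proj 𝒜).ringCatSheaf.obj) (linearPresheaf 𝒜 T k P)
    (fun _ _ _ _ _ ↦ rfl)
  isSheaf := linearPresheaf_isSheaf 𝒜 T k P

/-- The abelian sheaf of families of sections of `𝒪(k)` satisfying a linear condition. -/
def linearAbSheaf : AbSheaf (ProjectiveSpectrum.top 𝒜) :=
  ⟨linearPresheaf 𝒜 T k P, linearPresheaf_isSheaf 𝒜 T k P⟩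

variable {𝒜 T k P}

/-- The section given by a family of functions. -/
def linearMk {U : Opens (ProjectiveSpectrum.top 𝒜)} (f : ∀ x : U, T → LocAt 𝒜 x.1)
    (h₁ : ∀ t, IsTwist k U (fun x ↦ f x t)) (h₂ : ∀ x : U, f x ∈ P x.1) :
    (linearPresheaf 𝒜 T k P).obj (op U) := ⟨f, h₁, h₂⟩

/-- The family of functions of a section. -/
def linearVal {U : Opens (ProjectiveSpectrum.top 𝒜)} (s : (linearPresheaf 𝒜 T k P).obj (op U)) :
    ∀ x : U, T → LocAt 𝒜 x.1 := (show linearSections 𝒜 T k P (op U) from s).1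

section
variable {U : Opens (ProjectiveSpectrum.top 𝒜)} (s t : (linearPresheaf 𝒜 T k P).obj (op U))

lemma linearVal_isTwist (i : T) : IsTwist k U (fun x ↦ linearVal s x i) :=
  (show linearSections 𝒜 T k P (op U) from s).2.1 i

lemma linearVal_mem (x : U) : linearVal s x ∈ P x.1 :=
  (show linearSections 𝒜 T k P (op U) from s).2.2 x

variable {s t} in
lemma linear_ext (h : ∀ x i, linearVal s x i = linearVal t x i) : s = t :=
  Subtype.ext <| funext fun x ↦ funext (h x)

/-- Evaluation of a section at a point, as a homomorphism. -/
def linearEval (x : U) (i : T) : (linearPresheaf 𝒜 T k P).obj (op U) →+ LocAt 𝒜 x.1 where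
  toFun s := linearVal s x i
  map_zero' := rfl
  map_add' _ _ := rfl

end

/-- The morphism of sheaves given by a linear map with coefficients in the base ring, provided
that it respects the degrees and the linear conditions. -/
def linearHom {T' : Type u} {l : ℤ}
    {Q : ∀ x : ProjectiveSpectrum 𝒜, Submodule (LocAt 𝒜 x) (T' → LocAt 𝒜 x)}
    (φ : ∀ x : ProjectiveSpectrum 𝒜, (T → LocAt 𝒜 x) →+ (T' → LocAt 𝒜 x))
    (h₁ : ∀ (U : Opens (ProjectiveSpectrum.top 𝒜)) (f : ∀ x : U, T → LocAt 𝒜 x.1),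
      (∀ t, IsTwist k U (fun x ↦ f x t)) → ∀ t, IsTwist l U (fun x ↦ φ x.1 (f x) t))
    (h₂ : ∀ x v, v ∈ P x → φ x v ∈ Q x) :
    linearAbSheaf 𝒜 T k P ⟶ linearAbSheaf 𝒜 T' l Q where
  hom :=
    { app U := AddCommGrpCat.ofHom
        { toFun s := linearMk (U := U.unop) (fun x ↦ φ x.1 (linearVal s x))
            (h₁ U.unop _ (linearVal_isTwist s)) fun x ↦ h₂ x.1 _ (linearVal_mem s x)
          map_zero' := linear_ext fun x i ↦ congrFun (map_zero (φ x.1)) i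
          map_add' s t := linear_ext fun x i ↦ congrFun (map_add (φ x.1) (linearVal s x) (linearVal t x)) i }
      naturality _ _ _ := rfl }

end LinearSheaves

/-! ### Standard charts of projective space and common denominators -/

section ProjectiveSpace

variable {n : ℕ}

/-- The underlying space of `ℙⁿ`. -/
abbrev PSpace (n : ℕ) : TopCat.{0} := ProjectiveSpectrum.top (grading n)

/-- The standard affine open subsets of `ℙⁿ`. -/
def chart (i : Fin (n + 1)) : Opens (PSpace n) := Proj.basicOpen (grading n) (MvPolynomial.X i)

lemma X_mem_grading (i : Fin (n + 1)) : MvPolynomial.X i ∈ grading n 1 :=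
  MvPolynomial.isHomogeneous_X ℂ i

lemma X_notMem {U : Opens (PSpace n)} {i : Fin (n + 1)} (h : U ≤ chart i) (x : U) :
    MvPolynomial.X i ∉ x.1.asHomogeneousIdeal := h x.2

lemma iSup_chart : ⨆ i, chart (n := n) i = ⊤ := by
  refine Proj.iSup_basicOpen_eq_top' (grading n) (fun i ↦ MvPolynomial.X i)
    (fun i ↦ ⟨1, X_mem_grading i⟩) ?_
  refine Algebra.eq_top_iff.2 fun p ↦ ?_
  induction p using MvPolynomial.induction_on with
  | C a =>
    exact Subalgebra.algebraMap_mem _ (⟨MvPolynomial.C a, MvPolynomial.isHomogeneous_C _ a⟩ : grading n 0)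
  | add p q hp hq => exact add_mem hp hq
  | mul_X p i hp => exact mul_mem hp (Algebra.subset_adjoin ⟨i, rfl⟩)

/-- The distinguished binary covers on `ℙⁿ`. -/
def projAdm (n : ℕ) : Opens (PSpace n) → Opens (PSpace n) → Prop :=
  affineAdm (X := ProjectiveSpace n) (fun i ↦ chart i)

/-- On a subset of a chart, `𝒪(k)` has an invertible generator `e`. Multiplying by its inverse
reduces the splitting to functions, and multiplying by `e` brings it back. -/
lemma exists_res_sub_res_eq {T : Type} {k : ℤ} {U V V' : Opens (PSpace n)} (hV : V ≤ U)
    (hV' : V' ≤ U) {i : Fin (n + 1)} (hi : U ≤ chart i)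
    (h : ∀ c : (ProjectiveSpectrum.Proj.structureSheaf (grading n)).presheaf.obj (op (V ⊓ V')),
      ∃ (a : (ProjectiveSpectrum.Proj.structureSheaf (grading n)).presheaf.obj (op V))
        (b : (ProjectiveSpectrum.Proj.structureSheaf (grading n)).presheaf.obj (op V')),
        ∀ x : (V ⊓ V' : Opens (PSpace n)),
          (a.1 ⟨x.1, x.2.1⟩).val - (b.1 ⟨x.1, x.2.2⟩).val = (c.1 x).val)
    (s : (linearPresheaf (grading n) T k fun _ ↦ ⊤).obj (op (V ⊓ V'))) :
    ∃ a b, res (linearPresheaf (grading n) T k fun _ ↦ ⊤) (inf_le_left : V ⊓ V' ≤ V) a -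
      res (linearPresheaf (grading n) T k fun _ ↦ ⊤) (inf_le_right : V ⊓ V' ≤ V') b = s := by
  obtain ⟨e, e', he, he', hee⟩ := exists_isTwist_mul_eq_one (X_mem_grading i)
    (X_notMem (U := U) hi) k
  have hs (t : T) : IsTwist 0 _ (fun x ↦ linearVal s x t * e' ⟨x.1, hV x.2.1⟩) := by
    simpa using (linearVal_isTwist s t).mul (he'.res (inf_le_left.trans hV))
  choose c hc using fun t ↦ (hs t).exists_section
  choose a b hab using fun t ↦ h (c t)
  refine ⟨linearMk (fun x t ↦ ((a t).1 x).val * e ⟨x.1, hV x.2⟩) (fun t ↦ ?_) (fun _ ↦ trivial),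
    linearMk (fun x t ↦ ((b t).1 x).val * e ⟨x.1, hV' x.2⟩) (fun t ↦ ?_) (fun _ ↦ trivial),
    linear_ext fun x t ↦ ?_⟩
  · simpa using (isTwist_val (a t)).mul (he.res hV)
  · simpa using (isTwist_val (b t)).mul (he.res hV')
  · have h1 := hab t x
    have h2 := hc t x
    have h3 := hee ⟨x.1, hV x.2.1⟩
    change ((a t).1 ⟨x.1, x.2.1⟩).val * e ⟨x.1, hV x.2.1⟩ -
      ((b t).1 ⟨x.1, x.2.2⟩).val * e ⟨x.1, hV x.2.1⟩ = linearVal s x t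
    linear_combination e ⟨x.1, hV x.2.1⟩ * (h1.trans h2) + linearVal s x t * h3

lemma binarySurjective_linear (T : Type) (k : ℤ) :
    BinarySurjective (projAdm n) (linearPresheaf (grading n) T k fun _ ↦ ⊤) := by
  rintro V V' ⟨U, hU, i, hi, f, g, hfg, rfl, rfl⟩ s
  refine exists_res_sub_res_eq ((ProjectiveSpace n).basicOpen_le f)
    ((ProjectiveSpace n).basicOpen_le g) hi (fun c ↦ ?_) s
  obtain ⟨a, b, hab⟩ := exists_sub_eq_of_add_eq_one (X := ProjectiveSpace n) hU hfg c
  refine ⟨a, b, fun x ↦ ?_⟩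
  rw [← hab]
  exact (HomogeneousLocalization.val_sub _ _).symm

/-- The product of the variables with index in `I`. -/
def varProd (I : Finset (Fin (n + 1))) : MvPolynomial (Fin (n + 1)) ℂ :=
  ∏ i ∈ I, MvPolynomial.X i

lemma varProd_mem_grading (I : Finset (Fin (n + 1))) : varProd I ∈ grading n I.card := by
  have := MvPolynomial.IsHomogeneous.prod I (fun i ↦ (MvPolynomial.X i : MvPolynomial (Fin (n + 1)) ℂ))
    (fun _ ↦ 1) fun i _ ↦ MvPolynomial.isHomogeneous_X ℂ i
  simpa [varProd] using this

lemma varProd_ne_zero (I : Finset (Fin (n + 1))) : varProd I ≠ 0 :=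
  Finset.prod_ne_zero_iff.2 fun i _ ↦ MvPolynomial.X_ne_zero i

lemma varProd_pow_eq_monomial (I : Finset (Fin (n + 1))) (N : ℕ) :
    varProd I ^ N = MvPolynomial.monomial (∑ i ∈ I, Finsupp.single i N) 1 := by
  rw [MvPolynomial.monomial_sum_one, varProd, ← Finset.prod_pow]
  refine Finset.prod_congr rfl fun i _ ↦ ?_
  rw [MvPolynomial.X_pow_eq_monomial]

lemma varProd_mul_compl (I : Finset (Fin (n + 1))) :
    varProd I * varProd Iᶜ = varProd Finset.univ := Finset.prod_mul_prod_compl I _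

/-- The intersection of the standard affine open subsets with index in `I`. -/
def chartInter (I : Finset (Fin (n + 1))) : Opens (PSpace n) :=
  Proj.basicOpen (grading n) (varProd I)

lemma mem_chartInter {I : Finset (Fin (n + 1))} {x : PSpace n} :
    x ∈ chartInter I ↔ ∀ i ∈ I, x ∈ chart i := by
  have := x.isPrime
  refine Iff.trans (not_congr (Ideal.IsPrime.prod_mem_iff
    (p := x.asHomogeneousIdeal.toIdeal))) ?_
  push Not
  rfl

lemma inter_chart {p : ℕ} (σ : Fin p → Fin (n + 1)) :
    inter chart σ = chartInter (Finset.univ.image σ) := by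
  ext x
  refine (mem_inter chart).trans (Iff.trans ?_ mem_chartInter.symm)
  simp

lemma isAffineOpen_chartInter {I : Finset (Fin (n + 1))} (hI : I.Nonempty) :
    IsAffineOpen (X := ProjectiveSpace n) (chartInter I) :=
  Proj.isAffineOpen_basicOpen (grading n) _ (varProd_mem_grading I) hI.card_pos

/-- The generic point of `ℙⁿ`. -/
def genericPt (n : ℕ) : PSpace n where
  asHomogeneousIdeal := ⊥
  isPrime := Ideal.isPrime_bot
  not_irrelevant_le h := by
    have : (MvPolynomial.X 0 : MvPolynomial (Fin (n + 1)) ℂ) ∈ HomogeneousIdeal.irrelevant (grading n) := by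
      rw [HomogeneousIdeal.mem_irrelevant_iff, GradedRing.proj_apply,
        DirectSum.decompose_of_mem_ne _ (X_mem_grading 0) one_ne_zero]
    exact MvPolynomial.X_ne_zero (R := ℂ) (0 : Fin (n + 1)) (h this)

lemma genericPt_mem (I : Finset (Fin (n + 1))) : genericPt n ∈ chartInter I :=
  varProd_ne_zero I

lemma algebraMap_locAt_injective (x : ProjectiveSpectrum (grading n)) :
    Function.Injective (algebraMap (MvPolynomial (Fin (n + 1)) ℂ) (LocAt (grading n) x)) :=
  IsLocalization.injective _ x.asHomogeneousIdeal.toIdeal.primeCompl_le_nonZeroDivisors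

/-- The homomorphism from the polynomial ring to its localization at a point of `ℙⁿ`. -/
abbrev toLocAt (x : ProjectiveSpectrum (grading n)) :
    MvPolynomial (Fin (n + 1)) ℂ →+* LocAt (grading n) x := algebraMap _ _

/-- A polynomial which, divided by the `N`-th power of the product of all variables, gives a section
of `𝒪(k)` on the intersection of the standard affine open subsets with index in `I`. -/
def IsNumerator (N : ℕ) (k : ℤ) (I : Finset (Fin (n + 1))) (r : MvPolynomial (Fin (n + 1)) ℂ) : Prop :=
  ∀ m ∈ r.support, (m.degree : ℤ) = (n + 1) * N + k ∧ ∀ i ∉ I, N ≤ m i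

/-- The exponent condition makes `r` divisible by the `N`-th power of the variables outside `I`.
Cancelling it leaves a denominator involving only variables indexed by `I` and lowers the degree by
`N` for each variable outside `I`. -/
lemma IsNumerator.exists_eq {N : ℕ} {k : ℤ} {I : Finset (Fin (n + 1))}
    {r : MvPolynomial (Fin (n + 1)) ℂ} (h : IsNumerator N k I r) :
    ∃ r', r = varProd Iᶜ ^ N * r' ∧ ∀ m ∈ r'.support, (m.degree : ℤ) = I.card * N + k := by
  have hdvd : varProd Iᶜ ^ N ∣ r := by
    rw [varProd_pow_eq_monomial, MvPolynomial.monomial_one_dvd_iff_modMonomial_eq_zero]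
    ext m
    rw [MvPolynomial.coeff_zero]
    by_cases hm : (∑ i ∈ Iᶜ, Finsupp.single i N) ≤ m
    · exact MvPolynomial.coeff_modMonomial_of_le _ hm
    · rw [MvPolynomial.coeff_modMonomial_of_not_le _ hm]
      by_contra hne
      refine hm fun i ↦ ?_
      rw [Finsupp.finsetSum_apply]
      by_cases hi : i ∈ I
      · rw [Finset.sum_eq_zero]
        · exact Nat.zero_le _
        · intro j hj
          rw [Finsupp.single_apply, if_neg]
          rintro rfl
          exact (Finset.mem_compl.1 hj) hi
      · rw [Finset.sum_eq_single i]
        · rw [Finsupp.single_eq_same]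
          exact (h m (MvPolynomial.mem_support_iff.2 hne)).2 i hi
        · intro j _ hj
          rw [Finsupp.single_apply, if_neg hj]
        · exact fun h ↦ absurd (Finset.mem_compl.2 hi) h
  obtain ⟨r', rfl⟩ := hdvd
  refine ⟨r', rfl, fun m hm ↦ ?_⟩
  have hm' : (∑ i ∈ Iᶜ, Finsupp.single i N) + m ∈ (varProd Iᶜ ^ N * r').support := by
    rw [varProd_pow_eq_monomial, MvPolynomial.mem_support_iff, MvPolynomial.coeff_monomial_mul,
      one_mul]
    exact MvPolynomial.mem_support_iff.1 hm
  have := (h _ hm').1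
  rw [map_add, map_sum] at this
  simp only [Finsupp.degree_single, Finset.sum_const, smul_eq_mul, Finset.card_compl,
    Fintype.card_fin] at this
  have hle : I.card ≤ n + 1 := by simpa using I.card_le_univ
  push_cast [Nat.cast_sub hle] at this
  linear_combination this

lemma mem_grading_of_degree {d : ℕ} {r : MvPolynomial (Fin (n + 1)) ℂ}
    (h : ∀ m ∈ r.support, m.degree = d) : r ∈ grading n d := by
  rw [MvPolynomial.mem_homogeneousSubmodule]
  intro m hm
  rw [← h m (MvPolynomial.mem_support_iff.2 hm), Finsupp.degree_eq_weight_one]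
  rfl

lemma degree_of_mem_grading {d : ℕ} {r : MvPolynomial (Fin (n + 1)) ℂ} (h : r ∈ grading n d)
    {m : Fin (n + 1) →₀ ℕ} (hm : m ∈ r.support) : m.degree = d := by
  rw [MvPolynomial.mem_homogeneousSubmodule] at h
  rw [← h (MvPolynomial.mem_support_iff.1 hm), Finsupp.degree_eq_weight_one]
  rfl

lemma IsNumerator.exists_isTwist {N : ℕ} {k : ℤ} {I : Finset (Fin (n + 1))}
    {r : MvPolynomial (Fin (n + 1)) ℂ} (h : IsNumerator N k I r) :
    ∃ f, IsTwist k (chartInter I) f ∧ ∀ x,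
      f x * toLocAt x.1 (varProd Finset.univ ^ N) = toLocAt x.1 r := by
  obtain ⟨r', rfl, hd⟩ := h.exists_eq
  have hx (x : chartInter I) : varProd I ^ N ∉ x.1.asHomogeneousIdeal :=
    fun h ↦ x.2 (x.1.isPrime.mem_of_pow_mem _ h)
  have hM : varProd I ^ N ∈ grading n (N * I.card) := by
    simpa using SetLike.pow_mem_graded N (varProd_mem_grading I)
  have key (f : ∀ x : chartInter I, LocAt (grading n) x.1) (hf : ∀ x, f x =
      toLocAt x.1 r' * Localization.mk 1 ⟨_, hx x⟩) (x : chartInter I) :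
      f x * toLocAt x.1 (varProd Finset.univ ^ N) =
        toLocAt x.1 (varProd Iᶜ ^ N * r') := by
    rw [hf, ← varProd_mul_compl I, mul_pow, map_mul, map_mul]
    have := algebraMap_mul_mk_one x.1 (hx x)
    linear_combination toLocAt x.1 r' * toLocAt x.1 (varProd Iᶜ ^ N) * this
  -- The prescribed degree is an integer that may be negative. A natural degree can be read off only
  -- from a monomial that occurs.
  by_cases h0 : r' = 0
  · refine ⟨0, isTwist_zero, key _ fun x ↦ ?_⟩
    rw [h0, map_zero, zero_mul]
    rfl
  · obtain ⟨m, hm⟩ := MvPolynomial.support_nonempty.2 h0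
    have hr' : r' ∈ grading n m.degree := mem_grading_of_degree fun m' hm' ↦ by
      have h1 := hd m hm
      have h2 := hd m' hm'
      omega
    refine ⟨_, isTwist_mk hr' hM hx (by rw [hd m hm]; push_cast; ring), key _ fun x ↦ ?_⟩
    rw [← Localization.mk_one_eq_algebraMap, Localization.mk_mul, mul_one, one_mul]

/-- Functions on `D₊(f)` form the degree zero part of the localization at `f`, whose elements have a
power of `f` as denominator. -/
lemma exists_section_mul_pow_eq {A σ : Type} [CommRing A] [SetLike σ A] [AddSubgroupClass σ A]
    (𝒜 : ℕ → σ) [GradedRing 𝒜] {f : A} {d : ℕ} (hf : f ∈ 𝒜 d) (hd : 0 < d)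
    (c : (ProjectiveSpectrum.Proj.structureSheaf 𝒜).presheaf.obj (op (Proj.basicOpen 𝒜 f))) :
    ∃ (N : ℕ) (a : A), a ∈ 𝒜 (N * d) ∧ ∀ x : (Proj.basicOpen 𝒜 f : Opens (ProjectiveSpectrum.top 𝒜)),
      (c.1 x).val * algebraMap A (LocAt 𝒜 x.1) (f ^ N) = algebraMap A _ a := by
  obtain ⟨z, hz⟩ : ∃ z, (ProjectiveSpectrum.Proj.awayToSection 𝒜 f).hom z = c :=
    ⟨(Proj.basicOpenIsoAway 𝒜 f hf hd).inv.hom c,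
      congrArg (fun φ ↦ φ.hom c) (Proj.basicOpenIsoAway 𝒜 f hf hd).inv_hom_id⟩
  obtain ⟨N, a, ha, rfl⟩ := HomogeneousLocalization.Away.mk_surjective 𝒜 hf z
  refine ⟨N, a, ha, fun x ↦ ?_⟩
  rw [← hz]
  refine (congrArg (· * _) (ProjectiveSpectrum.Proj.awayToSection_apply 𝒜 f _ x)).trans ?_
  rw [HomogeneousLocalization.Away.val_mk, Localization.mk_eq_mk', IsLocalization.map_mk']
  exact IsLocalization.mk'_spec _ _ _

/-- Every section over an intersection of charts is a polynomial over a power of the product of all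
variables. All large `N` are allowed so that finitely many sections can share one denominator. -/
lemma IsTwist.exists_isNumerator {k : ℤ} {I : Finset (Fin (n + 1))} (hI : I.Nonempty)
    {f : ∀ x : chartInter I, LocAt (grading n) x.1} (hf : IsTwist k (chartInter I) f) :
    ∃ N₀ : ℕ, ∀ N ≥ N₀, ∃ r, IsNumerator N k I r ∧ ∀ x,
      f x * toLocAt x.1 (varProd Finset.univ ^ N) = toLocAt x.1 r := by
  obtain ⟨i, hi⟩ := hI
  have hX (x : chartInter I) : MvPolynomial.X i ∉ x.1.asHomogeneousIdeal := mem_chartInter.1 x.2 i hi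
  set l := k.natAbs
  -- With `l = |k|`, the product of `f` with `(∏_{j ∈ I} x_j)^l / x_i^d` has degree zero precisely
  -- for this `d`. The size of `l` guarantees `d ≥ 0`.
  obtain ⟨d, hd⟩ : ∃ d : ℕ, (d : ℤ) = l * I.card + k := by
    have : 1 ≤ I.card := Finset.card_pos.2 ⟨i, hi⟩
    have : (l : ℤ) ≤ l * I.card := le_mul_of_one_le_right (by omega) (by omega)
    exact ⟨(l * I.card + k).toNat, Int.toNat_of_nonneg (by omega)⟩
  have hx (x : chartInter I) : (MvPolynomial.X i : MvPolynomial (Fin (n + 1)) ℂ) ^ d ∉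
      x.1.asHomogeneousIdeal := fun h ↦ hX x (x.1.isPrime.mem_of_pow_mem _ h)
  have hXd : (MvPolynomial.X i : MvPolynomial (Fin (n + 1)) ℂ) ^ d ∈ grading n d := by
    simpa using SetLike.pow_mem_graded d (X_mem_grading i)
  have hM (I : Finset (Fin (n + 1))) (N : ℕ) : varProd I ^ N ∈ grading n (N * I.card) := by
    simpa using SetLike.pow_mem_graded N (varProd_mem_grading I)
  have h0 := (hf.mul (isTwist_algebraMap (hM I l) rfl)).mul
    (isTwist_mk (k := -d) SetLike.GradedOne.one_mem hXd hx (by simp))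
  rw [show k + ((l * I.card : ℕ) : ℤ) + -d = 0 by rw [hd]; push_cast; ring] at h0
  obtain ⟨c, hc⟩ := h0.exists_section
  obtain ⟨N₁, a, ha, hca⟩ := exists_section_mul_pow_eq (grading n) (varProd_mem_grading I)
    (Finset.card_pos.2 ⟨i, hi⟩) c
  have haX : a * MvPolynomial.X i ^ d ∈ grading n (N₁ * I.card + d) := SetLike.mul_mem_graded ha hXd
  refine ⟨N₁ + l, fun N hN ↦ ?_⟩
  -- Clearing denominators gives `f = a x_i^d / (∏_{j ∈ I} x_j)^(N₁ + l)`. The next witness expands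
  -- this fraction to the `(N₁ + l + N)`-th power of the product of all variables.
  obtain ⟨N, rfl⟩ := Nat.exists_eq_add_of_le hN
  refine ⟨varProd Iᶜ ^ (N₁ + l + N) * (varProd I ^ N * (a * MvPolynomial.X i ^ d)), ?_, fun x ↦ ?_⟩
  · intro m hm
    constructor
    · rw [degree_of_mem_grading (SetLike.mul_mem_graded (hM _ _) (SetLike.mul_mem_graded (hM _ _) haX)) hm]
      rw [Finset.card_compl, Fintype.card_fin]
      have hle : I.card ≤ n + 1 := by simpa using I.card_le_univ
      push_cast [Nat.cast_sub hle]
      rw [hd]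
      ring
    · intro j hj
      rw [varProd_pow_eq_monomial, MvPolynomial.mem_support_iff, MvPolynomial.coeff_monomial_mul'] at hm
      by_cases hle : (∑ i ∈ Iᶜ, Finsupp.single i (N₁ + l + N)) ≤ m
      · have := hle j
        rw [Finsupp.finsetSum_apply, Finset.sum_eq_single j, Finsupp.single_eq_same] at this
        · exact this
        · intro j' _ hj'
          rw [Finsupp.single_apply, if_neg hj']
        · exact fun h ↦ absurd (Finset.mem_compl.2 hj) h
      · rw [if_neg hle] at hm
        exact absurd rfl hm
  · have h1 := hca x
    have h2 := hc x
    have h3 := algebraMap_mul_mk_one x.1 (hx x)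
    rw [← varProd_mul_compl I]
    generalize Localization.mk (1 : MvPolynomial (Fin (n + 1)) ℂ) _ = y at h2 h3
    generalize (c.1 x).val = z at h1 h2
    change z = f x * toLocAt x.1 (varProd I ^ l) * y at h2
    simp only [map_mul, map_pow, mul_pow, pow_add] at h1 h2 h3 ⊢
    linear_combination (toLocAt x.1 (varProd Iᶜ)) ^ (N₁ + l + N) * (toLocAt x.1 (varProd I)) ^ N *
      (toLocAt x.1 (MvPolynomial.X i) ^ d * (h1 - toLocAt x.1 (varProd I) ^ N₁ * h2) -
        f x * toLocAt x.1 (varProd I) ^ (l + N₁) * h3)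

end ProjectiveSpace

/-! ### Čech cohomology and global sections of `𝒪(k)` -/

section CechProjective

variable {n : ℕ}

lemma toLocAt_varProd_ne_zero (x : ProjectiveSpectrum (grading n)) (N : ℕ) :
    toLocAt x (varProd Finset.univ ^ N) ≠ 0 :=
  fun h ↦ pow_ne_zero N (varProd_ne_zero Finset.univ)
    (algebraMap_locAt_injective x (h.trans (map_zero _).symm))

/-- The numerators of a Čech cocycle of `𝒪(k)` are the coboundary of a family of numerators. -/
lemma exists_isNumerator_coboundary {N p : ℕ} {k : ℤ} (hk : p < n ∨ -(n + 1 : ℤ) < k)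
    (r : (Fin (p + 1) → Fin (n + 1)) → MvPolynomial (Fin (n + 1)) ℂ)
    (hr : ∀ σ, IsNumerator N k (Finset.univ.image σ) (r σ))
    (hd : ∀ σ : Fin (p + 2) → Fin (n + 1),
      ∑ j : Fin (p + 2), (-1 : ℤ) ^ (j : ℕ) • r (σ ∘ j.succAbove) = 0) :
    ∃ h : (Fin p → Fin (n + 1)) → MvPolynomial (Fin (n + 1)) ℂ,
      (∀ τ, IsNumerator N k (Finset.univ.image τ) (h τ)) ∧
      ∀ σ : Fin (p + 1) → Fin (n + 1),
        ∑ j : Fin (p + 1), (-1 : ℤ) ^ (j : ℕ) • h (σ ∘ j.succAbove) = r σ := by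
  classical
  -- Each occurring monomial, once divided by the common denominator, must have a nonnegative
  -- exponent at some index `e`. If `p < n`, a tuple of length `p + 1` misses an index. Otherwise
  -- all exponents of `m` being at most `N - 1` would bound its degree by `(n + 1)(N - 1)`, below
  -- `(n + 1)N + k`.
  have he (m : Fin (n + 1) →₀ ℕ) : ∃ e : Fin (n + 1), ∀ σ, m ∈ (r σ).support → N ≤ m e := by
    by_cases hm : ∃ σ, m ∈ (r σ).support
    · obtain ⟨σ, hσ⟩ := hm
      suffices h : ∃ e, N ≤ m e from h.imp fun e he _ _ ↦ he
      obtain ⟨hdeg, hN⟩ := hr σ m hσ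
      rcases hk with hk | hk
      · have hcard : (Finset.univ.image σ).card < Fintype.card (Fin (n + 1)) := by
          refine Finset.card_image_le.trans_lt ?_
          simpa using hk
        obtain ⟨e, he⟩ : ∃ e, e ∉ Finset.univ.image σ := by
          by_contra! h
          exact hcard.ne (by rw [Finset.eq_univ_iff_forall.2 h, Finset.card_univ])
        exact ⟨e, hN e he⟩
      · by_contra! h
        have h1 : (m.degree : ℤ) ≤ ∑ _i : Fin (n + 1), ((N : ℤ) - 1) := by
          rw [Finsupp.degree_eq_sum]
          push_cast
          exact Finset.sum_le_sum fun i _ ↦ by have := h i; omega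
        rw [Finset.sum_const, Finset.card_univ, Fintype.card_fin, nsmul_eq_mul] at h1
        push_cast at h1
        linarith
    · push Not at hm
      exact ⟨0, fun σ h ↦ absurd h (hm σ)⟩
  choose e he using he
  -- The contracting homotopy works one monomial at a time: the coefficient of `m` in `h τ` is its
  -- coefficient in `r` at the tuple `τ` preceded by `e m`.
  let h (τ : Fin p → Fin (n + 1)) : MvPolynomial (Fin (n + 1)) ℂ :=
    ∑ i, ∑ m ∈ (r (Fin.cons i τ : Fin (p + 1) → Fin (n + 1))).support with e m = i,
      MvPolynomial.monomial m (MvPolynomial.coeff m (r (Fin.cons i τ : Fin (p + 1) → Fin (n + 1))))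
  have hcoeff (τ : Fin p → Fin (n + 1)) (m : Fin (n + 1) →₀ ℕ) : MvPolynomial.coeff m (h τ) =
      MvPolynomial.coeff m (r (Fin.cons (e m) τ : Fin (p + 1) → Fin (n + 1))) := by
    simp only [h, MvPolynomial.coeff_sum, MvPolynomial.coeff_monomial]
    rw [Finset.sum_eq_single (e m)]
    · rw [Finset.sum_ite_eq']
      split_ifs with hm
      · rfl
      · by_contra hne
        exact hm (Finset.mem_filter.2 ⟨MvPolynomial.mem_support_iff.2 fun h ↦ hne h.symm, rfl⟩)
    · intro i _ hi
      refine Finset.sum_eq_zero fun m' hm' ↦ if_neg ?_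
      rintro rfl
      exact hi (Finset.mem_filter.1 hm').2.symm
    · exact fun h ↦ absurd (Finset.mem_univ _) h
  refine ⟨h, fun τ m hm ↦ ?_, fun σ ↦ ?_⟩
  · rw [MvPolynomial.mem_support_iff, hcoeff, ← MvPolynomial.mem_support_iff] at hm
    refine ⟨(hr _ m hm).1, fun i hi ↦ ?_⟩
    -- Dropping `e m` from the tuple imposes a new exponent condition at `e m`, which holds by the
    -- choice of `e`.
    by_cases hie : i = e m
    · exact hie ▸ he m _ hm
    · refine (hr _ m hm).2 i fun hmem ↦ ?_
      obtain ⟨j, -, hj⟩ := Finset.mem_image.1 hmem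
      induction j using Fin.cases with
      | zero => exact hie hj.symm
      | succ j => exact hi (Finset.mem_image.2 ⟨j, Finset.mem_univ _, hj⟩)
  · ext m
    -- The cocycle relation at `(e m, σ)` is the homotopy identity for the coefficient of `m`.
    have := congrArg (MvPolynomial.coeff m) (hd (Fin.cons (e m) σ))
    have hsucc (j : Fin (p + 1)) : (Fin.cons (e m) σ : Fin (p + 2) → Fin (n + 1)) ∘ j.succ.succAbove =
        Fin.cons (e m) (σ ∘ j.succAbove) := by
      funext i
      induction i using Fin.cases with
      | zero => simp
      | succ i => simp
    have hzero : (Fin.cons (e m) σ : Fin (p + 2) → Fin (n + 1)) ∘ (0 : Fin (p + 2)).succAbove = σ := by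
      funext i
      simp
    rw [Fin.sum_univ_succ, hzero] at this
    simp only [hsucc, MvPolynomial.coeff_add, MvPolynomial.coeff_zero, Fin.val_zero, Fin.val_succ, pow_zero, one_smul, pow_succ, mul_neg_one,
      neg_smul, Finset.sum_neg_distrib] at this
    rw [MvPolynomial.coeff_neg] at this
    simp only [MvPolynomial.coeff_sum, MvPolynomial.coeff_smul, hcoeff] at this ⊢
    linear_combination -this

lemma linearVal_cechD {T : Type} {k : ℤ}
    {P : ∀ x : ProjectiveSpectrum (grading n), Submodule (LocAt (grading n) x) (T → LocAt (grading n) x)}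
    {p : ℕ} (c : Cochain chart (linearPresheaf (grading n) T k P) p) (σ : Fin (p + 1) → Fin (n + 1))
    (x : inter chart σ) (t : T) :
    linearVal (cechD _ c σ) x t = ∑ j : Fin (p + 1), (-1 : ℤ) ^ (j : ℕ) •
      linearVal (c (σ ∘ j.succAbove)) ⟨x.1, inter_le_comp chart σ j.succAbove x.2⟩ t := by
  change linearEval x t (cechD _ c σ) = _
  rw [cechD, map_sum]
  refine Finset.sum_congr rfl fun j _ ↦ ?_
  rw [map_zsmul]
  rfl

/-- There are finitely many tuples and components, so one denominator serves them all. The cocycle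
then becomes a family of polynomials to which the monomial homotopy applies. -/
lemma cechExact_linear {T : Type} [Finite T] {p : ℕ} {k : ℤ} (hp : 0 < p)
    (hk : p < n ∨ -(n + 1 : ℤ) < k) :
    CechExact (chart (n := n)) (linearPresheaf (grading n) T k fun _ ↦ ⊤) p := by
  intro c hc
  have hne {q : ℕ} (hq : 0 < q) (σ : Fin q → Fin (n + 1)) : (Finset.univ.image σ).Nonempty :=
    ⟨σ ⟨0, hq⟩, Finset.mem_image_of_mem _ (Finset.mem_univ _)⟩
  have hle {q : ℕ} (σ : Fin q → Fin (n + 1)) : inter chart σ ≤ chartInter (Finset.univ.image σ) :=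
    (inter_chart σ).le
  have hge {q : ℕ} (σ : Fin q → Fin (n + 1)) : chartInter (Finset.univ.image σ) ≤ inter chart σ :=
    (inter_chart σ).ge
  have h1 (σ : Fin (p + 1) → Fin (n + 1)) (t : T) :=
    ((linearVal_isTwist (c σ) t).res (hge σ)).exists_isNumerator (hne (by omega) σ)
  choose N₀ hN₀ using h1
  obtain ⟨N, hN⟩ : ∃ N, ∀ σ t, N₀ σ t ≤ N := by
    obtain ⟨N, hN⟩ := (Set.finite_range fun x : (Fin (p + 1) → Fin (n + 1)) × T ↦ N₀ x.1 x.2).bddAbove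
    exact ⟨N, fun σ t ↦ hN ⟨(σ, t), rfl⟩⟩
  choose r hr hr' using fun σ t ↦ hN₀ σ t N (hN σ t)
  have h2 (t : T) := exists_isNumerator_coboundary (N := N) hk (fun σ ↦ r σ t) (fun σ ↦ hr σ t) ?_
  · choose h hh hh' using h2
    choose b hb hb' using fun t τ ↦ (hh t τ).exists_isTwist
    refine ⟨fun τ ↦ linearMk (fun x t ↦ b t τ ⟨x.1, hle τ x.2⟩) (fun t ↦ (hb t τ).res (hle τ))
      (fun _ ↦ trivial), ?_⟩
    funext σ
    refine linear_ext fun x t ↦ mul_right_cancel₀ (toLocAt_varProd_ne_zero x.1 N) ?_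
    refine Eq.trans ?_ (hr' σ t ⟨x.1, hle σ x.2⟩).symm
    rw [← hh' t σ, map_sum, linearVal_cechD, Finset.sum_mul]
    refine Finset.sum_congr rfl fun j _ ↦ ?_
    rw [map_zsmul, smul_mul_assoc]
    exact congrArg _ (hb' t _ ⟨x.1, _⟩)
  · intro σ
    -- The generic point lies in every intersection of charts and polynomials embed in its local
    -- ring, so polynomial identities may be tested there.
    apply algebraMap_locAt_injective (genericPt n)
    let x : inter chart σ := ⟨genericPt n, hge σ (genericPt_mem _)⟩
    have h3 : linearVal (cechD _ c σ) x t = 0 := by rw [hc]; rfl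
    rw [linearVal_cechD] at h3
    rw [map_sum, map_zero, ← zero_mul (toLocAt x.1 (varProd Finset.univ ^ N)), ← h3, Finset.sum_mul]
    refine Finset.sum_congr rfl fun j _ ↦ ?_
    rw [map_zsmul, smul_mul_assoc]
    exact congrArg _ (hr' _ t ⟨genericPt n, genericPt_mem _⟩).symm

/-- Vanishing of the intermediate cohomology of a direct sum of twisting sheaves, and of its top
cohomology for small twists. -/
lemma HH_subsingleton_linear_top {T : Type} [Finite T] {q : ℕ} {k : ℤ}
    (hk : q + 1 < n ∨ -(n + 1 : ℤ) < k) :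
    Subsingleton (HH (linearAbSheaf (grading n) T k fun _ ↦ ⊤) (q + 1)) :=
  HH_subsingleton_of_cechExact (projAdm n) (fun _ _ h ↦ admInduction_inf_of_affineAdm _ h)
    iSup_chart (fun p σ ↦ by
      have hne : (Finset.univ.image σ).Nonempty := Finset.univ_nonempty.image σ
      rw [inter_chart]
      exact admInduction_affine (X := ProjectiveSpace n) _ (isAffineOpen_chartInter hne) (i := σ 0)
        fun x hx ↦ mem_chartInter.1 hx _ (Finset.mem_image_of_mem _ (Finset.mem_univ _)))
    q _ (binarySurjective_linear T k) (cechExact_linear q.succ_pos hk)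

/-- The global sections of `𝒪(k)` are the homogeneous polynomials of degree `k`. -/
lemma IsTwist.exists_polynomial (hn : 0 < n) {k : ℤ} {f : ∀ x : (⊤ : Opens (PSpace n)), LocAt (grading n) x.1}
    (hf : IsTwist k ⊤ f) : ∃ q : MvPolynomial (Fin (n + 1)) ℂ,
      (∀ m ∈ q.support, (m.degree : ℤ) = k) ∧ ∀ x, f x = toLocAt x.1 q := by
  have h (i : Fin (n + 1)) := (hf.res (le_top : chartInter {i} ≤ ⊤)).exists_isNumerator
    (Finset.singleton_nonempty i)
  choose N₀ hN₀ using h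
  obtain ⟨N, hN⟩ : ∃ N, ∀ i, N₀ i ≤ N := by
    obtain ⟨N, hN⟩ := (Set.finite_range N₀).bddAbove
    exact ⟨N, fun i ↦ hN ⟨i, rfl⟩⟩
  choose r hr hr' using fun i ↦ hN₀ i N (hN i)
  have heq (i : Fin (n + 1)) : r i = r 0 := algebraMap_locAt_injective (genericPt n)
    ((hr' i ⟨genericPt n, genericPt_mem _⟩).symm.trans (hr' 0 ⟨genericPt n, genericPt_mem _⟩))
  -- The numerators on all charts coincide. For each `i` there is a chart `j ≠ i` because `n > 0`,
  -- and on it `x_i` does not occur in the denominator. Hence the whole denominator cancels.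
  have hnum : IsNumerator N k ∅ (r 0) := by
    intro m hm
    refine ⟨(hr 0 m hm).1, fun i _ ↦ ?_⟩
    obtain ⟨j, hj⟩ : ∃ j : Fin (n + 1), i ≠ j := by
      have : Nontrivial (Fin (n + 1)) := Fin.nontrivial_iff_two_le.2 (by omega)
      exact (exists_ne i).imp fun _ h ↦ h.symm
    rw [← heq j] at hm
    exact (hr j m hm).2 i (by simpa using hj)
  obtain ⟨q, hq, hdeg⟩ := hnum.exists_eq
  refine ⟨q, by simpa using hdeg, fun x ↦ mul_right_cancel₀ (toLocAt_varProd_ne_zero x.1 N) ?_⟩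
  obtain ⟨i, hi⟩ := Opens.mem_iSup.1 ((iSup_chart (n := n)).ge x.2)
  refine (hr' i ⟨x.1, mem_chartInter.2 fun j hj ↦ ?_⟩).trans ?_
  · rw [Finset.mem_singleton.1 hj]
    exact hi
  · rw [heq, hq, Finset.compl_empty, map_mul, mul_comm]

end CechProjective

/-! ### Short exactness checked on sections -/

section ShortExactCriterion

variable {X : TopCat.{u}} (S : ShortComplex (AbSheaf X))

/-- Only surjectivity needs shrinking. A morphism killed by `g` factors through `f` section by
section, and injectivity of `f` makes the chosen preimages additive and compatible with restriction.
-/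
lemma shortExact_of_sections
    (hf : ∀ U : Opens X, Function.Injective (S.f.hom.app (op U)).hom)
    (hfg : ∀ (U : Opens X) (s : S.X₂.obj.obj (op U)), (S.g.hom.app (op U)).hom s = 0 →
      ∃ t, (S.f.hom.app (op U)).hom t = s)
    (hg : ∀ (U : Opens X) (s : S.X₃.obj.obj (op U)) (x : X), x ∈ U → ∃ (V : Opens X) (h : V ≤ U),
      x ∈ V ∧ ∃ t, (S.g.hom.app (op V)).hom t = res S.X₃.obj h s) : S.ShortExact := by
  have hmono : Mono S.f := Sheaf.mono_of_injective _ fun U ↦ hf U.unop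
  have hepi : Epi S.g := by
    rw [← Sheaf.isLocallySurjective_iff_epi']
    refine ⟨fun {U} s x hx ↦ ?_⟩
    obtain ⟨V, hV, hxV, t, ht⟩ := hg U s x hx
    exact ⟨V, homOfLE hV, ⟨t, ht⟩, hxV⟩
  refine ⟨?_⟩
  rw [S.exact_iff_exact_up_to_refinements]
  intro A φ hφ
  have h (U : (Opens X)ᵒᵖ) (s : A.obj.obj U) : ∃ t, (S.f.hom.app U).hom t = (φ.hom.app U).hom s :=
    hfg U.unop _ (congrArg (fun ψ : A ⟶ S.X₃ ↦ (ψ.hom.app U).hom s) hφ)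
  choose t ht using h
  refine ⟨A, 𝟙 A, inferInstance, ⟨
    { app U := AddCommGrpCat.ofHom (AddMonoidHom.mk' (t U) fun a b ↦ hf U.unop ?_)
      naturality U V i := ?_ }⟩, ?_⟩
  · exact (ht U _).trans (by rw [map_add, map_add, ← ht, ← ht])
  · ext s
    apply hf V.unop
    refine (ht V _).trans ?_
    refine (NatTrans.naturality_apply φ.hom i s).trans ?_
    refine Eq.trans ?_ (NatTrans.naturality_apply S.f.hom i _).symm
    exact congrArg _ (ht U s).symm
  · ext U s
    exact (ht U s).symm

end ShortExactCriterion

/-! ### The two Euler sequences -/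

section EulerSequences

variable {n : ℕ}

/-- The germ of a homogeneous coordinate. -/
abbrev coord (x : ProjectiveSpectrum (grading n)) (i : Fin (n + 1)) : LocAt (grading n) x :=
  toLocAt x (MvPolynomial.X i)

instance (x : ProjectiveSpectrum (grading n)) : CharZero (LocAt (grading n) x) :=
  charZero_of_injective_ringHom (algebraMap_locAt_injective x)

lemma IsTwist.of_eq {k l : ℤ} {U : Opens (PSpace n)} {f : ∀ x : U, LocAt (grading n) x.1}
    (hf : IsTwist k U f) (h : k = l) : IsTwist l U f := h ▸ hf

lemma isTwist_toLocAt {k : ℤ} {U : Opens (PSpace n)} {q : MvPolynomial (Fin (n + 1)) ℂ}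
    (hq : ∀ m ∈ q.support, (m.degree : ℤ) = k) : IsTwist k U (fun x ↦ toLocAt x.1 q) := by
  by_cases h0 : q = 0
  · subst h0
    simp only [map_zero]
    exact isTwist_zero
  · obtain ⟨m, hm⟩ := MvPolynomial.support_nonempty.2 h0
    refine isTwist_algebraMap (i := m.degree) (mem_grading_of_degree fun m' hm' ↦ ?_) (hq m hm)
    have h1 := hq m hm
    have h2 := hq m' hm'
    omega

lemma isTwist_coord {U : Opens (PSpace n)} (i : Fin (n + 1)) :
    IsTwist 1 U (fun x ↦ coord x.1 i) :=
  isTwist_algebraMap (X_mem_grading i) rfl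

lemma exists_isTwist_coord_mul_eq_one {U : Opens (PSpace n)} {i : Fin (n + 1)} (h : U ≤ chart i) :
    ∃ y : ∀ x : U, LocAt (grading n) x.1, IsTwist (-1) U y ∧ ∀ x, coord x.1 i * y x = 1 :=
  ⟨_, isTwist_mk SetLike.GradedOne.one_mem (X_mem_grading i) (X_notMem h) rfl,
    fun x ↦ algebraMap_mul_mk_one x.1 (X_notMem h x)⟩

/-- The families `v` with `∑ xᵢ vᵢ = 0`. -/
def eulerOne (x : ProjectiveSpectrum (grading n)) :
    Submodule (LocAt (grading n) x) (Fin (n + 1) → LocAt (grading n) x) where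
  carrier := {v | ∑ i, coord x i * v i = 0}
  zero_mem' := by simp
  add_mem' {v w} hv hw := by
    simp only [Set.mem_ofPred_eq, Pi.add_apply, mul_add, Finset.sum_add_distrib] at *
    rw [hv, hw, add_zero]
  smul_mem' c v hv := by
    simp only [Set.mem_ofPred_eq, Pi.smul_apply, smul_eq_mul, mul_left_comm _ c, ← Finset.mul_sum] at *
    rw [hv, mul_zero]

lemma mem_eulerOne {x : ProjectiveSpectrum (grading n)} {v : Fin (n + 1) → LocAt (grading n) x} :
    v ∈ eulerOne x ↔ ∑ i, coord x i * v i = 0 := Iff.rfl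

/-- The antisymmetric matrices. -/
def antisymmetric (x : ProjectiveSpectrum (grading n)) :
    Submodule (LocAt (grading n) x) (Fin (n + 1) × Fin (n + 1) → LocAt (grading n) x) where
  carrier := {w | ∀ a b, w (a, b) = - w (b, a)}
  zero_mem' := by simp
  add_mem' {v w} hv hw a b := by
    simp only [Pi.add_apply]
    rw [hv a b, hw a b, neg_add]
  smul_mem' c v hv a b := by
    simp only [Pi.smul_apply, smul_eq_mul]
    rw [hv a b, mul_neg]

lemma mem_antisymmetric {x : ProjectiveSpectrum (grading n)}
    {w : Fin (n + 1) × Fin (n + 1) → LocAt (grading n) x} :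
    w ∈ antisymmetric x ↔ ∀ a b, w (a, b) = - w (b, a) := Iff.rfl

/-- The antisymmetric matrices `w` with `∑ x_b w_{ab} = 0`. -/
def eulerTwo (x : ProjectiveSpectrum (grading n)) :
    Submodule (LocAt (grading n) x) (Fin (n + 1) × Fin (n + 1) → LocAt (grading n) x) where
  carrier := {w | w ∈ antisymmetric x ∧ ∀ a, (fun b ↦ w (a, b)) ∈ eulerOne x}
  zero_mem' := ⟨zero_mem _, fun _ ↦ zero_mem (eulerOne x)⟩
  add_mem' hv hw := ⟨add_mem hv.1 hw.1, fun a ↦ add_mem (hv.2 a) (hw.2 a)⟩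
  smul_mem' c _ hv := ⟨Submodule.smul_mem _ c hv.1, fun a ↦ Submodule.smul_mem _ c (hv.2 a)⟩

lemma mem_eulerTwo {x : ProjectiveSpectrum (grading n)}
    {w : Fin (n + 1) × Fin (n + 1) → LocAt (grading n) x} :
    w ∈ eulerTwo x ↔ w ∈ antisymmetric x ∧ ∀ a, (fun b ↦ w (a, b)) ∈ eulerOne x := Iff.rfl

/-- Contraction of a family with the Euler vector field. -/
def contractOne (x : ProjectiveSpectrum (grading n)) :
    (Fin (n + 1) → LocAt (grading n) x) →+ (Unit → LocAt (grading n) x) where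
  toFun v _ := ∑ i, coord x i * v i
  map_zero' := by ext; simp
  map_add' v w := by ext; simp [mul_add, Finset.sum_add_distrib]

/-- Contraction of a matrix with the Euler vector field. -/
def contractTwo (x : ProjectiveSpectrum (grading n)) :
    (Fin (n + 1) × Fin (n + 1) → LocAt (grading n) x) →+ (Fin (n + 1) → LocAt (grading n) x) where
  toFun w a := ∑ b, coord x b * w (a, b)
  map_zero' := by ext; simp
  map_add' v w := by ext; simp [mul_add, Finset.sum_add_distrib]

/-- The symmetric matrix `xₐ x_b` pairs with an antisymmetric one to a number equal to its own
negative. -/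
lemma contractTwo_mem {x : ProjectiveSpectrum (grading n)}
    {w : Fin (n + 1) × Fin (n + 1) → LocAt (grading n) x} (hw : w ∈ antisymmetric x) :
    contractTwo x w ∈ eulerOne x := by
  rw [mem_eulerOne]
  refine CharZero.eq_neg_self_iff.1 ?_
  change ∑ a, coord x a * ∑ b, coord x b * w (a, b) = -∑ a, coord x a * ∑ b, coord x b * w (a, b)
  simp only [Finset.mul_sum]
  conv_rhs => rw [Finset.sum_comm]
  rw [← Finset.sum_neg_distrib]
  refine Finset.sum_congr rfl fun a _ ↦ ?_
  rw [← Finset.sum_neg_distrib]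
  refine Finset.sum_congr rfl fun b _ ↦ ?_
  rw [hw a b]
  ring

/-- The model of `Ω¹(k)`. -/
abbrev omegaOne (n : ℕ) (k : ℤ) : AbSheaf (PSpace n) :=
  linearAbSheaf (grading n) (Fin (n + 1)) (k - 1) eulerOne

/-- The model of `Ω²(k)`. -/
abbrev omegaTwo (n : ℕ) (k : ℤ) : AbSheaf (PSpace n) :=
  linearAbSheaf (grading n) (Fin (n + 1) × Fin (n + 1)) (k - 2) eulerTwo

/-- The sheaf of antisymmetric matrices of sections of a twisting sheaf. -/
abbrev antisymmetricSheaf (n : ℕ) (k : ℤ) : AbSheaf (PSpace n) :=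
  linearAbSheaf (grading n) (Fin (n + 1) × Fin (n + 1)) k antisymmetric

/-- The direct sum of copies of a twisting sheaf. -/
abbrev freeSheaf (n : ℕ) (T : Type) (k : ℤ) : AbSheaf (PSpace n) :=
  linearAbSheaf (grading n) T k fun _ ↦ ⊤

lemma isTwist_contract {k l : ℤ} (h : l + 1 = k) {U : Opens (PSpace n)}
    {f : ∀ x : U, Fin (n + 1) → LocAt (grading n) x.1}
    (hf : ∀ i, IsTwist l U (fun x ↦ f x i)) : IsTwist k U (fun x ↦ ∑ i, coord x.1 i * f x i) :=
  IsTwist.sum fun i _ ↦ ((isTwist_coord i).mul (hf i)).of_eq (by omega)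

/-- The Euler sequence. -/
def eulerSequenceOne (n : ℕ) (k : ℤ) : ShortComplex (AbSheaf (PSpace n)) where
  X₁ := omegaOne n k
  X₂ := freeSheaf n (Fin (n + 1)) (k - 1)
  X₃ := freeSheaf n Unit k
  f := linearHom (fun _ ↦ AddMonoidHom.id _) (fun _ _ h ↦ h) (fun _ _ _ ↦ trivial)
  g := linearHom contractOne (fun _ _ h _ ↦ isTwist_contract (by omega) h) (fun _ _ _ ↦ trivial)
  zero := by
    ext U s
    exact linear_ext fun x _ ↦ linearVal_mem (U := U.unop) s x

/-- The second Euler sequence. -/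
def eulerSequenceTwo (n : ℕ) (k : ℤ) : ShortComplex (AbSheaf (PSpace n)) where
  X₁ := omegaTwo n k
  X₂ := antisymmetricSheaf n (k - 2)
  X₃ := omegaOne n k
  f := linearHom (fun _ ↦ AddMonoidHom.id _) (fun _ _ h ↦ h) (fun _ _ h ↦ h.1)
  g := linearHom contractTwo (fun _ _ h a ↦ isTwist_contract (by omega) fun b ↦ h (a, b))
    (fun _ _ h ↦ contractTwo_mem h)
  zero := by
    ext U s
    exact linear_ext fun x a ↦ (linearVal_mem (U := U.unop) s x).2 a

/-- For surjectivity on the chart `xᵢ ≠ 0`, put `s / xᵢ` in position `i` and zero elsewhere. -/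
lemma eulerSequenceOne_shortExact (k : ℤ) : (eulerSequenceOne n k).ShortExact := by
  refine shortExact_of_sections _ (fun U s t h ↦ ?_) (fun U s h ↦ ?_) fun U s x hx ↦ ?_
  · exact linear_ext fun x i ↦ congrArg (fun s : (freeSheaf n (Fin (n + 1)) (k - 1)).obj.obj (op U) ↦ linearEval x i s) h
  · exact ⟨linearMk (linearVal s) (linearVal_isTwist s)
      fun x ↦ congrArg (fun s ↦ linearEval x () s) h, rfl⟩
  · obtain ⟨i, hi⟩ := Opens.mem_iSup.1 ((iSup_chart (n := n)).ge (Opens.mem_top x))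
    obtain ⟨y, hy, hxy⟩ := exists_isTwist_coord_mul_eq_one (U := U ⊓ chart i) inf_le_right
    have hs := (linearVal_isTwist s ()).res (inf_le_left : U ⊓ chart i ≤ U)
    refine ⟨U ⊓ chart i, inf_le_left, ⟨hx, hi⟩,
      linearMk (fun x j ↦ if j = i then linearVal s ⟨x.1, x.2.1⟩ () * y x else 0) (fun j ↦ ?_)
        (fun _ ↦ trivial), linear_ext fun x _ ↦ ?_⟩
    · by_cases hj : j = i
      · simp only [hj, if_true]
        exact (hs.mul hy).of_eq (by omega)
      · simp only [hj, if_false]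
        exact isTwist_zero
    · change ∑ j, coord x.1 j * (if j = i then linearVal s ⟨x.1, x.2.1⟩ () * y x else 0) =
        linearVal s ⟨x.1, x.2.1⟩ ()
      simp only [mul_ite, mul_zero, Finset.sum_ite_eq', Finset.mem_univ, if_true]
      linear_combination linearVal s ⟨x.1, x.2.1⟩ () * hxy x

/-- For surjectivity on the chart `xᵢ ≠ 0`, take the antisymmetric matrix of `v ∧ dxᵢ / xᵢ`. Its
contraction is `v`, because the other term contains `∑ x_b v_b = 0`. -/
lemma eulerSequenceTwo_shortExact (k : ℤ) : (eulerSequenceTwo n k).ShortExact := by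
  refine shortExact_of_sections _ (fun U s t h ↦ ?_) (fun U s h ↦ ?_) fun U s x hx ↦ ?_
  · exact linear_ext fun x i ↦ congrArg (fun s : (antisymmetricSheaf n (k - 2)).obj.obj (op U) ↦ linearEval x i s) h
  · exact ⟨linearMk (linearVal s) (linearVal_isTwist s) fun x ↦ ⟨linearVal_mem s x, fun a ↦
      congrArg (fun s ↦ linearEval x a s) h⟩, rfl⟩
  · obtain ⟨i, hi⟩ := Opens.mem_iSup.1 ((iSup_chart (n := n)).ge (Opens.mem_top x))
    obtain ⟨y, hy, hxy⟩ := exists_isTwist_coord_mul_eq_one (U := U ⊓ chart i) inf_le_right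
    let v (x : (U ⊓ chart i : Opens (PSpace n))) (a : Fin (n + 1)) : LocAt (grading n) x.1 :=
      linearVal s ⟨x.1, x.2.1⟩ a
    have hv (a : Fin (n + 1)) : IsTwist (k - 1) (U ⊓ chart i) (fun x ↦ v x a) :=
      (linearVal_isTwist s a).res inf_le_left
    have hE (x : (U ⊓ chart i : Opens (PSpace n))) : ∑ b, coord x.1 b * v x b = 0 :=
      linearVal_mem s ⟨x.1, x.2.1⟩
    refine ⟨U ⊓ chart i, inf_le_left, ⟨hx, hi⟩,
      linearMk (fun x j ↦ (if j.2 = i then v x j.1 * y x else 0) -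
        (if j.1 = i then v x j.2 * y x else 0)) (fun j ↦ ?_) (fun x a b ↦ ?_),
        linear_ext fun x a ↦ ?_⟩
    · have key (a b : Fin (n + 1)) : IsTwist (k - 2) (U ⊓ chart i)
          (fun x ↦ if b = i then v x a * y x else 0) := by
        by_cases hj : b = i
        · simp only [hj, if_true]
          exact ((hv a).mul hy).of_eq (by omega)
        · simp only [hj, if_false]
          exact isTwist_zero
      exact (key j.1 j.2).sub (key j.2 j.1)
    · simp only
      ring
    · change ∑ b, coord x.1 b * ((if b = i then v x a * y x else 0) -
        (if a = i then v x b * y x else 0)) = v x a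
      have h2 : ∑ b, coord x.1 b * (if a = i then v x b * y x else 0) = 0 := by
        by_cases ha : a = i
        · simp only [ha, if_true, ← mul_assoc, ← Finset.sum_mul, hE, zero_mul]
        · simp [ha]
      simp only [mul_sub, Finset.sum_sub_distrib, h2]
      simp only [mul_ite, mul_zero, Finset.sum_ite_eq', Finset.mem_univ, if_true]
      linear_combination v x a * hxy x

lemma HH_subsingleton_of_retract {X : TopCat.{u}} {F G : AbSheaf X} (i : F ⟶ G) (r : G ⟶ F)
    (h : i ≫ r = 𝟙 F) {q : ℕ} (hG : Subsingleton (HH G q)) : Subsingleton (HH F q) := by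
  refine subsingleton_of_forall_eq 0 fun x ↦ ?_
  have h1 : Sheaf.H.map r q (Sheaf.H.map i q x) = x := by
    rw [← Sheaf.H.map_comp_apply, h, Sheaf.H.map_id_apply]
  rw [← h1, Subsingleton.elim (α := HH G q) (Sheaf.H.map i q x) 0, map_zero]

/-- Antisymmetrisation `w ↦ (w - wᵀ) / 2` makes this sheaf a retract of a direct sum of copies of
`𝒪(k)`. -/
lemma HH_subsingleton_antisymmetric {q : ℕ} {k : ℤ} (hk : q + 1 < n ∨ -(n + 1 : ℤ) < k) :
    Subsingleton (HH (antisymmetricSheaf n k) (q + 1)) := by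
  have hC : MvPolynomial.C (1 / 2 : ℂ) ∈ grading n 0 := MvPolynomial.isHomogeneous_C _ _
  let i : antisymmetricSheaf n k ⟶ freeSheaf n (Fin (n + 1) × Fin (n + 1)) k :=
    linearHom (fun _ ↦ AddMonoidHom.id _) (fun _ _ h ↦ h) (fun _ _ _ ↦ trivial)
  let r : freeSheaf n (Fin (n + 1) × Fin (n + 1)) k ⟶ antisymmetricSheaf n k :=
    linearHom (fun x ↦
      { toFun w j := toLocAt x (MvPolynomial.C (1 / 2 : ℂ)) * (w j - w j.swap)
        map_zero' := by ext; simp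
        map_add' v w := by ext; simp only [Pi.add_apply]; ring })
      (fun U f hf j ↦ ((isTwist_algebraMap hC rfl).mul ((hf j).sub (hf j.swap))).of_eq (by simp))
      (fun x w _ a b ↦ by
        change toLocAt x (MvPolynomial.C (1 / 2 : ℂ)) * (w (a, b) - w (b, a)) =
          -(toLocAt x (MvPolynomial.C (1 / 2 : ℂ)) * (w (b, a) - w (a, b)))
        ring)
  refine HH_subsingleton_of_retract i r ?_ (HH_subsingleton_linear_top hk)
  · ext U s
    refine linear_ext fun x j ↦ ?_
    have h := linearVal_mem (U := U.unop) s x j.2 j.1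
    change toLocAt x.1 (MvPolynomial.C (1 / 2 : ℂ)) * (linearVal s x j - linearVal s x (j.2, j.1)) =
      linearVal s x j
    have h2 : toLocAt x.1 (MvPolynomial.C (1 / 2 : ℂ)) * 2 = 1 := by
      have : (2 : LocAt (grading n) x.1) = toLocAt x.1 (MvPolynomial.C 2) := by
        rw [map_ofNat, map_ofNat]
      rw [this, ← map_mul, ← map_mul]
      norm_num
    have h3 : linearVal s x (j.2, j.1) = - linearVal s x j := h
    rw [h3]
    linear_combination linearVal s x j * h2

end EulerSequences

/-! ### Vanishing for the models of `Ω¹(k)` and `Ω²(k)` -/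

section Vanishing

variable {n : ℕ}

lemma HH_zero_subsingleton {X : TopCat.{u}} {F : AbSheaf X}
    (h : ∀ s : F.obj.obj (op ⊤), s = 0) : Subsingleton (HH F 0) := by
  have : Subsingleton (F.obj.obj (op (⊤ : Opens X))) := subsingleton_of_forall_eq 0 h
  exact (Sheaf.H.equiv₀ F (T := (⊤ : Opens X)) Limits.isTerminalTop).toEquiv.subsingleton

/-- The coefficients are constants, so evaluating the relation at the `i`-th unit vector isolates
the `i`-th one. -/
lemma eq_zero_of_sum_X_mul_eq_zero {q : Fin (n + 1) → MvPolynomial (Fin (n + 1)) ℂ}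
    (hq : ∀ i, ∀ m ∈ (q i).support, m = 0) (h : ∑ i, MvPolynomial.X i * q i = 0) : q = 0 := by
  have hC (i : Fin (n + 1)) : q i = MvPolynomial.C (MvPolynomial.coeff 0 (q i)) := by
    ext m
    rw [MvPolynomial.coeff_C]
    split_ifs with hm
    · rw [hm]
    · by_contra hne
      exact hm (hq i m (MvPolynomial.mem_support_iff.2 hne)).symm
  funext i
  have := congrArg (MvPolynomial.eval (Pi.single i (1 : ℂ))) h
  rw [map_sum, Finset.sum_eq_single i, map_mul, hC i, MvPolynomial.eval_C, MvPolynomial.eval_X,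
    Pi.single_eq_same, one_mul, map_zero] at this
  · rw [hC i, this, map_zero]
    rfl
  · intro j _ hj
    rw [map_mul, MvPolynomial.eval_X, Pi.single_eq_of_ne hj, zero_mul]
  · exact fun h ↦ absurd (Finset.mem_univ _) h

/-- Global sections of a sheaf of families of sections of `𝒪(k)` are families of polynomials. -/
lemma exists_polynomial_family (hn : 0 < n) {T : Type} {k : ℤ}
    {P : ∀ x : ProjectiveSpectrum (grading n), Submodule (LocAt (grading n) x) (T → LocAt (grading n) x)}
    (s : (linearAbSheaf (grading n) T k P).obj.obj (op ⊤)) :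
    ∃ q : T → MvPolynomial (Fin (n + 1)) ℂ, (∀ t, ∀ m ∈ (q t).support, (m.degree : ℤ) = k) ∧
      ∀ x t, linearVal s x t = toLocAt x.1 (q t) := by
  choose q hq hq' using fun t ↦ (linearVal_isTwist s t).exists_polynomial hn
  exact ⟨q, hq, fun x t ↦ hq' t x⟩

lemma sum_X_mul_eq_zero_of_mem_eulerOne {q : Fin (n + 1) → MvPolynomial (Fin (n + 1)) ℂ}
    {x : ProjectiveSpectrum (grading n)} (h : (fun i ↦ toLocAt x (q i)) ∈ eulerOne x) :
    ∑ i, MvPolynomial.X i * q i = 0 := by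
  apply algebraMap_locAt_injective x
  rw [map_sum, map_zero, ← mem_eulerOne.1 h]
  exact Finset.sum_congr rfl fun i _ ↦ map_mul _ _ _

lemma eq_zero_of_degree_nonpos {k : ℤ} (hk : k ≤ 0) {q : MvPolynomial (Fin (n + 1)) ℂ}
    (hq : ∀ m ∈ q.support, (m.degree : ℤ) = k) : ∀ m ∈ q.support, m = 0 := by
  intro m hm
  have := hq m hm
  exact (Finsupp.degree_eq_zero_iff m).1 (by omega)

/-- A global section is a family of polynomials of degree `k - 1 ≤ 0` related by the coordinates.
These polynomials are constants, and zero if the degree is negative. -/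
lemma HH_zero_omegaOne (hn : 0 < n) {k : ℤ} (hk : k < 2) : Subsingleton (HH (omegaOne n k) 0) := by
  refine HH_zero_subsingleton fun s ↦ ?_
  obtain ⟨q, hq, hs⟩ := exists_polynomial_family hn s
  have h : (fun i ↦ toLocAt (genericPt n) (q i)) ∈ eulerOne (genericPt n) := by
    have := linearVal_mem s ⟨genericPt n, trivial⟩
    rwa [funext (hs _)] at this
  have h0 := eq_zero_of_sum_X_mul_eq_zero (fun i ↦ eq_zero_of_degree_nonpos (by omega) (hq i))
    (sum_X_mul_eq_zero_of_mem_eulerOne h)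
  refine linear_ext fun x i ↦ (hs x i).trans ?_
  rw [h0]
  exact map_zero _

lemma HH_zero_omegaTwo (hn : 0 < n) {k : ℤ} (hk : k < 3) : Subsingleton (HH (omegaTwo n k) 0) := by
  refine HH_zero_subsingleton fun s ↦ ?_
  obtain ⟨q, hq, hs⟩ := exists_polynomial_family hn s
  have h (a : Fin (n + 1)) : (fun i ↦ toLocAt (genericPt n) (q (a, i))) ∈ eulerOne (genericPt n) := by
    have := (linearVal_mem s ⟨genericPt n, trivial⟩).2 a
    simpa only [hs] using this
  have h0 (a : Fin (n + 1)) := eq_zero_of_sum_X_mul_eq_zero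
    (fun i ↦ eq_zero_of_degree_nonpos (by omega) (hq (a, i))) (sum_X_mul_eq_zero_of_mem_eulerOne (h a))
  refine linear_ext fun x i ↦ (hs x i).trans ?_
  rw [show q i = 0 from congrFun (h0 i.1) i.2]
  exact map_zero _

lemma degree_pderiv {k : ℤ} {q : MvPolynomial (Fin (n + 1)) ℂ}
    (hq : ∀ m ∈ q.support, (m.degree : ℤ) = k) (c : ℂ) (i : Fin (n + 1)) :
    ∀ m ∈ (MvPolynomial.C c * MvPolynomial.pderiv i q).support, (m.degree : ℤ) = k - 1 := by
  intro m hm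
  rw [MvPolynomial.mem_support_iff, MvPolynomial.coeff_C_mul, MvPolynomial.coeff_pderiv] at hm
  have := hq (m + Finsupp.single i 1) (MvPolynomial.mem_support_iff.2 fun h ↦ hm (by simp [h]))
  rw [map_add, Finsupp.degree_single] at this
  push_cast at this
  omega

lemma sum_X_mul_pderiv {k : ℤ} {q : MvPolynomial (Fin (n + 1)) ℂ}
    (hq : ∀ m ∈ q.support, (m.degree : ℤ) = k) :
    ∑ i, MvPolynomial.X i * MvPolynomial.pderiv i q = MvPolynomial.C (k : ℂ) * q := by
  by_cases h0 : q = 0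
  · simp [h0]
  · obtain ⟨m, hm⟩ := MvPolynomial.support_nonempty.2 h0
    have h : q ∈ grading n m.degree := mem_grading_of_degree fun m' hm' ↦ by
      have h1 := hq m hm
      have h2 := hq m' hm'
      omega
    rw [((MvPolynomial.mem_homogeneousSubmodule _ _).1 h).sum_X_mul_pderiv, ← hq m hm]
    simp

/-- The obstruction is lifting global sections along the Euler sequence. Euler's relation supplies
the lift `(∂ᵢ q / k)ᵢ` of `q`, which is where `k ≠ 0` enters. -/
lemma HH_one_omegaOne (hn : 1 < n) {k : ℤ} (hk : k ≠ 0) : Subsingleton (HH (omegaOne n k) 1) := by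
  refine HH_subsingleton_X₁_one (eulerSequenceOne_shortExact k)
    (HH_subsingleton_linear_top (Or.inl hn)) fun s ↦ ?_
  obtain ⟨q, hq, hs⟩ := exists_polynomial_family (by omega) s
  refine ⟨linearMk (fun x i ↦ toLocAt x.1 (MvPolynomial.C (1 / k : ℂ) * MvPolynomial.pderiv i (q ())))
    (fun i ↦ isTwist_toLocAt (degree_pderiv (hq ()) _ i)) (fun _ ↦ trivial),
    linear_ext fun x _ ↦ (?_ : _ = _).trans (hs x ()).symm⟩
  change ∑ i, coord x.1 i * toLocAt x.1 (MvPolynomial.C (1 / k : ℂ) * MvPolynomial.pderiv i (q ())) = _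
  simp only [← map_mul, ← map_sum, mul_left_comm _ (MvPolynomial.C (1 / k : ℂ)), ← Finset.mul_sum]
  rw [sum_X_mul_pderiv (hq ()), ← mul_assoc, ← MvPolynomial.C_mul, one_div_mul_cancel (by exact_mod_cast hk),
    MvPolynomial.C_1, one_mul]

/-- A polynomial vector field annihilated by the Euler field is, up to a factor, the contraction of
its exterior derivative. -/
lemma sum_X_mul_curl_eq {k : ℤ} {q : Fin (n + 1) → MvPolynomial (Fin (n + 1)) ℂ}
    (hq : ∀ t, ∀ m ∈ (q t).support, (m.degree : ℤ) = k - 1) (hE : ∑ i, MvPolynomial.X i * q i = 0)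
    (a : Fin (n + 1)) : ∑ b, MvPolynomial.X b * (MvPolynomial.C (1 / k : ℂ) *
      MvPolynomial.pderiv b (q a) - MvPolynomial.C (1 / k : ℂ) * MvPolynomial.pderiv a (q b)) = q a := by
  have h1 := sum_X_mul_pderiv (hq a)
  -- Differentiating `∑ x_b q_b = 0` with respect to `xₐ` adds one more `q a` to the `k - 1` coming
  -- from Euler's relation, for a total of `k`.
  have h2 : q a + ∑ b, MvPolynomial.X b * MvPolynomial.pderiv a (q b) = 0 := by
    have := congrArg (MvPolynomial.pderiv a) hE
    rw [map_sum, map_zero] at this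
    simp only [Derivation.leibniz, smul_eq_mul, MvPolynomial.pderiv_X, Finset.sum_add_distrib] at this
    have h3 : ∑ x, q x * (Pi.single a 1 : Fin (n + 1) → MvPolynomial (Fin (n + 1)) ℂ) x = q a := by
      rw [Finset.sum_eq_single a]
      · simp
      · intro b _ hb
        simp [hb]
      · simp
    linear_combination this - h3
  -- For `k = 0` the degrees would be `-1`, so every `q a` is zero and the value of `1 / 0` is
  -- irrelevant.
  by_cases hk : k = 0
  · have hqa (a : Fin (n + 1)) : q a = 0 := by
      by_contra h0
      obtain ⟨m, hm⟩ := MvPolynomial.support_nonempty.2 h0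
      have := hq a m hm
      omega
    simp [hqa]
  · have hC : MvPolynomial.C (σ := Fin (n + 1)) (1 / k : ℂ) * (k : MvPolynomial (Fin (n + 1)) ℂ) = 1 := by
      rw [← map_intCast (MvPolynomial.C (σ := Fin (n + 1)) (R := ℂ)), ← map_mul,
        one_div_mul_cancel (by exact_mod_cast hk), map_one]
    simp only [mul_sub, Finset.sum_sub_distrib, mul_left_comm _ (MvPolynomial.C (1 / k : ℂ)),
      ← Finset.mul_sum]
    rw [h1]
    push_cast
    rw [map_sub, map_intCast, map_one]
    linear_combination MvPolynomial.C (1 / k : ℂ) * (-h2) + q a * hC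

/-- Global sections lift along the second Euler sequence in every twist. This is why `H¹(Ω²(k))`
vanishes with no condition on `k`. -/
lemma exists_contractTwo_eq (hn : 0 < n) {k : ℤ} (s : (omegaOne n k).obj.obj (op ⊤)) :
    ∃ t : (antisymmetricSheaf n (k - 2)).obj.obj (op ⊤),
      ∀ x, contractTwo x.1 (linearVal t x) = linearVal s x := by
  obtain ⟨q, hq, hs⟩ := exists_polynomial_family hn s
  have hE : ∑ i, MvPolynomial.X i * q i = 0 := sum_X_mul_eq_zero_of_mem_eulerOne (x := genericPt n) (by
    have := linearVal_mem s ⟨genericPt n, trivial⟩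
    rwa [funext (hs _)] at this)
  have h := sum_X_mul_curl_eq hq hE
  let w (j : Fin (n + 1) × Fin (n + 1)) : MvPolynomial (Fin (n + 1)) ℂ :=
    MvPolynomial.C (1 / k : ℂ) * MvPolynomial.pderiv j.2 (q j.1) -
      MvPolynomial.C (1 / k : ℂ) * MvPolynomial.pderiv j.1 (q j.2)
  have hw (j : Fin (n + 1) × Fin (n + 1)) :
      IsTwist (k - 2) (⊤ : Opens (PSpace n)) (fun x ↦ toLocAt x.1 (w j)) := by
    have h1 := (isTwist_toLocAt (U := ⊤) (degree_pderiv (hq j.1) (1 / k) j.2)).sub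
      (isTwist_toLocAt (degree_pderiv (hq j.2) (1 / k) j.1))
    convert h1.of_eq (show k - 1 - 1 = k - 2 by ring) using 2 with x
    exact map_sub _ _ _
  refine ⟨linearMk (fun x j ↦ toLocAt x.1 (w j)) hw fun x ↦ mem_antisymmetric.2 fun a b ↦ ?_,
    fun x ↦ funext fun a ↦ ?_⟩
  · rw [← map_neg]
    exact congrArg _ (neg_sub _ _).symm
  · refine Eq.trans ?_ ((congrArg (toLocAt x.1) (h a)).trans (hs x a).symm)
    rw [map_sum]
    change ∑ b, coord x.1 b * toLocAt x.1 (w (a, b)) = _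
    exact Finset.sum_congr rfl fun b _ ↦ (map_mul (toLocAt x.1) _ _).symm

lemma HH_one_omegaTwo (hn : 1 < n) {k : ℤ} : Subsingleton (HH (omegaTwo n k) 1) := by
  refine HH_subsingleton_X₁_one (eulerSequenceTwo_shortExact k)
    (HH_subsingleton_antisymmetric (Or.inl hn)) fun s ↦ ?_
  obtain ⟨t, ht⟩ := exists_contractTwo_eq (by omega) (k := k) s
  exact ⟨t, linear_ext fun x a ↦ congrFun (ht x) a⟩

/-- The group lies between `H^(q+1)(𝒪(k))` and `H^(q+2)(𝒪(k-1)ⁿ⁺¹)`. The bound `-n < k` is `-(n + 1)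
< k - 1`. -/
lemma HH_succ_omegaOne {q : ℕ} {k : ℤ} (hq : q + 1 < n) (hk : q + 2 < n ∨ -(n : ℤ) < k) :
    Subsingleton (HH (omegaOne n k) (q + 2)) :=
  HH_subsingleton_X₁ (eulerSequenceOne_shortExact k)
    (HH_subsingleton_linear_top (hk.imp (fun h ↦ by omega) fun h ↦ by omega))
    (HH_subsingleton_linear_top (Or.inl hq))

/-- The group lies between `H^(q+1)(Ω¹(k))` and the cohomology of a retract of copies of `𝒪(k-2)`,
so the bound on `k` shifts by one more. -/
lemma HH_succ_omegaTwo {q : ℕ} {k : ℤ} (hq : Subsingleton (HH (omegaOne n k) (q + 1)))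
    (hk : q + 2 < n ∨ -(n : ℤ) + 1 < k) : Subsingleton (HH (omegaTwo n k) (q + 2)) :=
  HH_subsingleton_X₁ (eulerSequenceTwo_shortExact k)
    (HH_subsingleton_antisymmetric (hk.imp (fun h ↦ by omega) fun h ↦ by omega)) hq

end Vanishing

/-! ### Recognising an associated sheaf on a basis -/

section Sheafification

/-- On underlying abelian sheaves, the adjoint of `φ` is the sheafification of `φ` followed by the
counit at a sheaf, and both are isomorphisms. Passing to abelian sheaves reflects isomorphisms. -/
lemma nonempty_iso_of_isIso_presheafToSheaf_map {C : Type u} [Category.{u} C]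
    {J : GrothendieckTopology C} {R : Sheaf J RingCat.{u}} {P : PresheafOfModules.{u} R.obj}
    (M : SheafOfModules.{u} R) (φ : P ⟶ M.val)
    (h : IsIso ((presheafToSheaf J AddCommGrpCat.{u}).map ((PresheafOfModules.toPresheaf _).map φ))) :
    Nonempty ((PresheafOfModules.sheafification (𝟙 R.obj)).obj P ≅ M) := by
  let ψ : P ⟶ (PresheafOfModules.restrictScalars (𝟙 R.obj)).obj
    ((SheafOfModules.forget _).obj M) := φ
  let f := (PresheafOfModules.sheafificationHomEquiv (𝟙 R.obj)).symm ψ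
  have hf : IsIso f := by
    have e : (SheafOfModules.toSheaf.{u} R).map f =
        (presheafToSheaf J AddCommGrpCat.{u}).map ((PresheafOfModules.toPresheaf _).map φ) ≫
          (sheafificationAdjunction J AddCommGrpCat.{u}).counit.app
            ((SheafOfModules.toSheaf R).obj M) :=
      (PresheafOfModules.toSheaf_map_sheafificationHomEquiv_symm _ _).trans
        (Adjunction.homEquiv_counit ..)
    rw [← isIso_iff_of_reflects_iso f (SheafOfModules.toSheaf.{u} R), e]
    have h2 : IsIso ((sheafificationAdjunction J AddCommGrpCat.{u}).counit.app
        ((SheafOfModules.toSheaf R).obj M)) := inferInstance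
    exact @IsIso.comp_isIso _ _ _ _ _ _ _ h h2
  exact ⟨asIso f⟩

/-- Isomorphisms of sheaves of modules on a scheme, in the category used for cohomology. -/
abbrev SheafIso (X : Scheme.{u}) (F G : SheafOfModules.{u} X.ringCatSheaf) := F ≅ G

variable {X : Scheme.{u}}
  {P : PresheafOfModules.{u} (X.presheaf ⋙ forget₂ CommRingCat.{u} RingCat.{u})} {M : X.Modules}

/-- Bijectivity on a basis gives local injectivity and local surjectivity, which is what
sheafification inverts. -/
lemma isIso_presheafToSheaf_map (φ : P ⟶ M.val) (B : X.Opens → Prop)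
    (hB : ∀ (V : X.Opens) (x : X), x ∈ V → ∃ U ≤ V, x ∈ U ∧ B U)
    (h : ∀ U, B U → Function.Bijective (φ.app (op U)).hom) :
    IsIso ((presheafToSheaf (Opens.grothendieckTopology X) AddCommGrpCat.{u}).map
      ((PresheafOfModules.toPresheaf _).map φ)) := by
  rw [← GrothendieckTopology.W_iff, GrothendieckTopology.W_iff_isLocallyBijective]
  constructor
  · refine ⟨fun {V} a b hab x hx ↦ ?_⟩
    obtain ⟨U, hUV, hxU, hU⟩ := hB V.unop x hx
    refine ⟨U, homOfLE hUV, (h U hU).1 ?_, hxU⟩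
    have h1 := NatTrans.naturality_apply ((PresheafOfModules.toPresheaf _).map φ) (homOfLE hUV).op a
    have h2 := NatTrans.naturality_apply ((PresheafOfModules.toPresheaf _).map φ) (homOfLE hUV).op b
    exact h1.trans ((congrArg _ hab).trans h2.symm)
  · refine ⟨fun {V} s x hx ↦ ?_⟩
    obtain ⟨U, hUV, hxU, hU⟩ := hB V x hx
    obtain ⟨t, ht⟩ := (h U hU).2 (M.val.map (homOfLE hUV).op s)
    exact ⟨U, homOfLE hUV, ⟨t, ht⟩, hxU⟩

/-- The sheaf associated with a presheaf of modules that maps isomorphically, on a basis, to a sheaf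
of modules is isomorphic to that sheaf. -/
lemma nonempty_iso_sheafOfPresheaf (φ : P ⟶ M.val) (B : X.Opens → Prop)
    (hB : ∀ (V : X.Opens) (x : X), x ∈ V → ∃ U ≤ V, x ∈ U ∧ B U)
    (h : ∀ U, B U → Function.Bijective (φ.app (op U)).hom) :
    Nonempty (SheafIso X (sheafOfPresheaf P) M) :=
  nonempty_iso_of_isIso_presheafToSheaf_map _ _ (isIso_presheafToSheaf_map φ B hB h)

lemma cohomology_subsingleton_of_iso {X : Scheme.{u}} {F G : X.Modules}
    (e : Nonempty (SheafIso X F G)) {q : ℕ}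
    (h : Subsingleton (HH (X := X.carrier) ((SheafOfModules.toSheaf.{u} X.ringCatSheaf).obj G) q)) :
    Subsingleton (cohomology q F) :=
  have i := (SheafOfModules.toSheaf.{u} X.ringCatSheaf).mapIso e.some
  HH_subsingleton_of_retract (X := X.carrier) i.hom i.inv i.hom_inv_id h

end Sheafification

/-! ### The basis of distinguished open subsets of charts -/

section Basis

variable {n : ℕ}

/-- The open subsets of the form `D(h)` in a standard affine open subset. -/
def IsDistinguished (i : Fin (n + 1)) (U : (ProjectiveSpace n).Opens) : Prop :=
  ∃ h : Γ(ProjectiveSpace n, chart i), U = (ProjectiveSpace n).basicOpen h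

lemma isAffineOpen_chart (i : Fin (n + 1)) : IsAffineOpen (X := ProjectiveSpace n) (chart i) :=
  Proj.isAffineOpen_basicOpen (grading n) _ (X_mem_grading i) one_pos

lemma exists_isDistinguished {V : (ProjectiveSpace n).Opens} {x : ProjectiveSpace n} (hx : x ∈ V) :
    ∃ U ≤ V, x ∈ U ∧ ∃ i, IsDistinguished i U := by
  obtain ⟨i, hi⟩ := Opens.mem_iSup.1 ((iSup_chart (n := n)).ge (Opens.mem_top x))
  obtain ⟨f, hf, hxf⟩ := (isAffineOpen_chart i).exists_basicOpen_le ⟨x, hx⟩ hi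
  exact ⟨_, hf, hxf, i, f, rfl⟩

lemma cohomology_subsingleton_of_linear {F : (ProjectiveSpace n).Modules} {T : Type} {k : ℤ}
    {P : ∀ x : ProjectiveSpectrum (grading n), Submodule (LocAt (grading n) x) (T → LocAt (grading n) x)}
    (e : Nonempty (SheafIso (ProjectiveSpace n) F (linearSheaf (grading n) T k P))) {q : ℕ}
    (h : Subsingleton (HH (linearAbSheaf (grading n) T k P) q)) :
    Subsingleton (cohomology q F) :=
  cohomology_subsingleton_of_iso e h

end Basis

/-! ### Partial derivatives on the local rings -/

section LocalizedDerivation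

/-- Derivations of a commutative ring extend to its localizations. -/
lemma exists_localizedDerivation {R A L : Type*} [CommRing R] [CommRing A] [Algebra R A] [CommRing L]
    [Algebra A L] (S : Submonoid A) [IsLocalization S L] (D : Derivation R A A) :
    ∃ δ : L →+ L, (∀ a b, δ (a * b) = a * δ b + b * δ a) ∧
      ∀ a, δ (algebraMap A L a) = algebraMap A L (D a) := by
  -- A derivation is the same as a ring homomorphism `a ↦ a + ε D a` to the dual numbers. It extends
  -- to the localization because a dual number is a unit when its constant term is.
  let g : A →+* TrivSqZeroExt L L :=
    { toFun a := TrivSqZeroExt.inl (algebraMap A L a) + TrivSqZeroExt.inr (algebraMap A L (D a))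
      map_one' := by ext <;> simp
      map_zero' := by ext <;> simp
      map_add' a b := by ext <;> simp [Algebra.smul_def]
      map_mul' a b := by
        ext
        · simp
        · simp only [TrivSqZeroExt.snd_mul, TrivSqZeroExt.snd_add, TrivSqZeroExt.snd_inl,
            TrivSqZeroExt.snd_inr, TrivSqZeroExt.fst_add, TrivSqZeroExt.fst_inl,
            TrivSqZeroExt.fst_inr, zero_add, add_zero, smul_eq_mul, Derivation.leibniz, map_add,
            map_mul, op_smul_eq_mul]
          ring }
  have hg (s : S) : IsUnit (g s) := by
    rw [TrivSqZeroExt.isUnit_iff_isUnit_fst]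
    simpa [g] using IsLocalization.map_units L s
  let G : L →+* TrivSqZeroExt L L := IsLocalization.lift hg
  have hG (a : A) : G (algebraMap A L a) = g a := IsLocalization.lift_eq hg a
  have hfst (a : L) : (G a).fst = a := by
    have : ((TrivSqZeroExt.fstHom L L L).toRingHom.comp G) = RingHom.id L := by
      refine IsLocalization.ringHom_ext S (RingHom.ext fun a ↦ ?_)
      simp [hG, g]
    exact congrArg (fun f : L →+* L ↦ f a) this
  refine ⟨⟨⟨fun a ↦ (G a).snd, by simp⟩, by simp⟩, fun a b ↦ ?_, fun a ↦ ?_⟩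
  · change (G (a * b)).snd = a * (G b).snd + b * (G a).snd
    rw [map_mul, TrivSqZeroExt.snd_mul, hfst, hfst, smul_eq_mul, op_smul_eq_mul, mul_comm b]
  · change (G (algebraMap A L a)).snd = _
    rw [hG]
    exact (TrivSqZeroExt.snd_add _ _).trans (zero_add _)

variable {n : ℕ}

/-- The partial derivative with respect to a homogeneous coordinate on the local ring at a point. -/
def partialLoc (x : ProjectiveSpectrum (grading n)) (i : Fin (n + 1)) :
    LocAt (grading n) x →+ LocAt (grading n) x :=
  (exists_localizedDerivation x.asHomogeneousIdeal.toIdeal.primeCompl (MvPolynomial.pderiv i)).choose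

lemma partialLoc_mul (x : ProjectiveSpectrum (grading n)) (i : Fin (n + 1))
    (a b : LocAt (grading n) x) :
    partialLoc x i (a * b) = a * partialLoc x i b + b * partialLoc x i a :=
  (exists_localizedDerivation x.asHomogeneousIdeal.toIdeal.primeCompl
    (MvPolynomial.pderiv i)).choose_spec.1 a b

lemma partialLoc_toLocAt (x : ProjectiveSpectrum (grading n)) (i : Fin (n + 1))
    (p : MvPolynomial (Fin (n + 1)) ℂ) :
    partialLoc x i (toLocAt x p) = toLocAt x (MvPolynomial.pderiv i p) :=
  (exists_localizedDerivation x.asHomogeneousIdeal.toIdeal.primeCompl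
    (MvPolynomial.pderiv i)).choose_spec.2 p

/-- The quotient rule for `f = r / s`, with `y` playing the part of `1 / s`. -/
lemma partialLoc_eq_of_mul_eq {x : ProjectiveSpectrum (grading n)} (i : Fin (n + 1))
    {f y : LocAt (grading n) x} {r s : MvPolynomial (Fin (n + 1)) ℂ}
    (hf : f * toLocAt x s = toLocAt x r) (hy : toLocAt x s * y = 1) :
    partialLoc x i f = toLocAt x (MvPolynomial.pderiv i r) * y -
      f * (toLocAt x (MvPolynomial.pderiv i s) * y) := by
  have := congrArg (partialLoc x i) hf
  rw [partialLoc_mul, partialLoc_toLocAt, partialLoc_toLocAt] at this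
  linear_combination y * this - partialLoc x i f * hy

lemma degree_eq_of_mem_grading {d : ℕ} {r : MvPolynomial (Fin (n + 1)) ℂ} (hr : r ∈ grading n d) :
    ∀ m ∈ r.support, (m.degree : ℤ) = d := fun _ hm ↦ by
  rw [degree_of_mem_grading hr hm]

lemma degree_pderiv_eq {k : ℤ} {q : MvPolynomial (Fin (n + 1)) ℂ}
    (hq : ∀ m ∈ q.support, (m.degree : ℤ) = k) (i : Fin (n + 1)) :
    ∀ m ∈ (MvPolynomial.pderiv i q).support, (m.degree : ℤ) = k - 1 := by
  simpa using degree_pderiv hq 1 i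

lemma IsTwist.exists_mul_eq {k : ℤ} {U : Opens (PSpace n)} {f : ∀ x : U, LocAt (grading n) x.1}
    (hf : IsTwist k U f) (x : U) : ∃ (V : Opens (PSpace n)) (_ : x.1 ∈ V) (hV : V ≤ U)
      (i j : ℕ) (r s : MvPolynomial (Fin (n + 1)) ℂ) (y : ∀ x : V, LocAt (grading n) x.1),
      r ∈ grading n i ∧ s ∈ grading n j ∧ (i : ℤ) = j + k ∧ IsTwist (-j) V y ∧
      ∀ x : V, f ⟨x.1, hV x.2⟩ * toLocAt x.1 s = toLocAt x.1 r ∧ toLocAt x.1 s * y x = 1 := by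
  obtain ⟨V, hx, hV, i, j, ⟨r, hr⟩, ⟨s, hs⟩, hsx, hk, h⟩ := hf x
  refine ⟨V, hx, hV.le, i, j, r, s, _, hr, hs, hk,
    isTwist_mk SetLike.GradedOne.one_mem hs hsx (by simp), fun x ↦ ⟨?_, ?_⟩⟩
  · refine (congrArg (· * _) (h x)).trans ?_
    rw [Localization.mk_eq_mk']
    exact IsLocalization.mk'_spec _ _ _
  · exact algebraMap_mul_mk_one x.1 (hsx x)

lemma IsTwist.partialLoc {k : ℤ} {U : Opens (PSpace n)} {f : ∀ x : U, LocAt (grading n) x.1}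
    (hf : IsTwist k U f) (i : Fin (n + 1)) : IsTwist (k - 1) U (fun x ↦ partialLoc x.1 i (f x)) := by
  refine IsTwist.of_locally fun x ↦ ?_
  obtain ⟨V, hx, hV, a, b, r, s, y, hr, hs, hk, hy, h⟩ := hf.exists_mul_eq x
  refine ⟨V, hx, hV, ?_⟩
  have h1 := (isTwist_toLocAt (U := V) (degree_pderiv_eq (degree_eq_of_mem_grading hr) i)).mul hy
  have h2 := (hf.res hV).mul
    ((isTwist_toLocAt (U := V) (degree_pderiv_eq (degree_eq_of_mem_grading hs) i)).mul hy)
  convert (h1.of_eq (l := k - 1) (by omega)).sub (h2.of_eq (l := k - 1) (by omega)) using 2 with x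
  exact partialLoc_eq_of_mul_eq i (h x).1 (h x).2

/-- Euler's identity. -/
lemma IsTwist.sum_coord_mul_partialLoc {U : Opens (PSpace n)} {f : ∀ x : U, LocAt (grading n) x.1}
    (hf : IsTwist 0 U f) (x : U) : ∑ i, coord x.1 i * ProjForms.partialLoc x.1 i (f x) = 0 := by
  obtain ⟨V, hx, hV, a, b, r, s, y, hr, hs, hk, hy, h⟩ := hf.exists_mul_eq x
  obtain rfl : a = b := by omega
  have h1 (i : Fin (n + 1)) := partialLoc_eq_of_mul_eq i (h ⟨x.1, hx⟩).1 (h ⟨x.1, hx⟩).2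
  have h2 : f x * toLocAt x.1 s = toLocAt x.1 r := (h ⟨x.1, hx⟩).1
  -- Numerator and denominator have the same degree `a`, so their Euler terms `a r / s` and `(r / s)
  -- a` cancel.
  have hE (q : MvPolynomial (Fin (n + 1)) ℂ) (hq : q ∈ grading n a) :
      ∑ i, coord x.1 i * toLocAt x.1 (MvPolynomial.pderiv i q) =
        toLocAt x.1 (MvPolynomial.C (a : ℂ)) * toLocAt x.1 q := by
    have := sum_X_mul_pderiv (degree_eq_of_mem_grading hq)
    rw [Int.cast_natCast] at this
    rw [← map_mul, ← this, map_sum]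
    simp only [map_mul]
  have h3 : ∑ i, coord x.1 i * ProjForms.partialLoc x.1 i (f x) =
      (∑ i, coord x.1 i * toLocAt x.1 (MvPolynomial.pderiv i r)) * y ⟨x.1, hx⟩ -
      f x * ((∑ i, coord x.1 i * toLocAt x.1 (MvPolynomial.pderiv i s)) * y ⟨x.1, hx⟩) := by
    simp only [Finset.sum_mul, Finset.mul_sum, ← Finset.sum_sub_distrib]
    refine Finset.sum_congr rfl fun i _ ↦ ?_
    rw [show ProjForms.partialLoc x.1 i (f x) = _ from h1 i]
    ring
  rw [h3, hE r hr, hE s hs, ← h2]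
  ring

end LocalizedDerivation

/-! ### Constants and affine coordinates on the charts -/

section StructureMap

variable {n : ℕ}

/-- The value in the local ring at a point of a section of the structure sheaf. -/
def sectionVal {U : (ProjectiveSpace n).Opens} (x : U) :
    Γ(ProjectiveSpace n, U) →+* LocAt (grading n) x.1 where
  toFun c := (c.1 x).val
  map_zero' := HomogeneousLocalization.val_zero
  map_one' := HomogeneousLocalization.val_one
  map_add' _ _ := HomogeneousLocalization.val_add _ _
  map_mul' _ _ := HomogeneousLocalization.val_mul _ _

lemma section_ext {U : (ProjectiveSpace n).Opens} {a b : Γ(ProjectiveSpace n, U)}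
    (h : ∀ x : U, sectionVal x a = sectionVal x b) : a = b :=
  Subtype.ext (funext fun x ↦ HomogeneousLocalization.val_injective _ (h x))

/-- The structure morphism is defined through `D₊(1)`, identified with all of `Proj`. On global
functions these identifications amount to a restriction map. -/
lemma basicOpenToSpec_appTop_comp :
    (Scheme.Opens.topIso (Proj.basicOpen (grading n) 1)).inv ≫
      ((Scheme.isoOfEq _ (Proj.basicOpen_one (grading n))).inv).appTop ≫
      (Scheme.topIso (ProjectiveSpace n)).inv.appTop =
    (ProjectiveSpace n).presheaf.map (homOfLE (Proj.basicOpen_one (grading n)).ge).op := by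
  have : IsIso (Scheme.topIso (ProjectiveSpace n)).hom.appTop :=
    inferInstanceAs (IsIso ((Scheme.topIso (ProjectiveSpace n)).hom.app ⊤))
  rw [← cancel_mono (Scheme.topIso (ProjectiveSpace n)).hom.appTop]
  simp only [Category.assoc, ← Scheme.Hom.comp_appTop]
  simp only [Scheme.Opens.topIso_inv, Scheme.isoOfEq_inv, Scheme.topIso_hom]
  simp
  exact (Functor.map_comp (ProjectiveSpace n).presheaf _ _).symm.trans
    (Functor.map_comp (ProjectiveSpace n).presheaf _ _)

lemma ΓSpecIso_inv_comp_structureMorphism_appTop :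
    (Scheme.ΓSpecIso (CommRingCat.of ℂ)).inv ≫ (structureMorphism n).appTop =
      CommRingCat.ofHom (algebraMap ℂ (grading n 0)) ≫
      CommRingCat.ofHom (HomogeneousLocalization.fromZeroRingHom (grading n) _) ≫
      Proj.awayToSection (grading n) 1 ≫
      (ProjectiveSpace n).presheaf.map (homOfLE (Proj.basicOpen_one (grading n)).ge).op := by
  rw [← basicOpenToSpec_appTop_comp, structureMorphism, Proj.toSpecZero]
  simp only [Scheme.Hom.comp_appTop, Category.assoc]
  rw [← Scheme.ΓSpecIso_inv_naturality_assoc, ← Scheme.ΓSpecIso_inv_naturality_assoc]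
  have h : (Proj.basicOpenToSpec (grading n) 1).appTop = _ := Proj.basicOpenToSpec_app_top (grading n) 1
  rw [h]
  simp only [Category.assoc, Iso.inv_hom_id_assoc]

/-- This ties the abstract structure morphism to `ℂ ⊂ ℂ[x₀, …, xₙ]`, so that partial derivatives are
`ℂ`-linear in the sense required of Kähler differentials. -/
lemma sectionVal_structureMap {U : (ProjectiveSpace n).Opens} (x : U) (c : ℂ) :
    sectionVal x ((structureMap (structureMorphism n)).app (op U) c) =
      toLocAt x.1 (MvPolynomial.C c) := by
  have h := congrArg (fun φ ↦ φ.hom c) (ΓSpecIso_inv_comp_structureMorphism_appTop (n := n))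
  have h2 := congrArg (sectionVal (⟨x.1, trivial⟩ : (⊤ : (ProjectiveSpace n).Opens))) h
  refine Eq.trans (show _ = _ from h2) ?_
  refine (ProjectiveSpectrum.Proj.awayToSection_apply (grading n) 1
    (HomogeneousLocalization.fromZeroRingHom (grading n) _ (algebraMap ℂ (grading n 0) c))
    ⟨x.1, (Proj.basicOpen_one (grading n)).ge trivial⟩).trans ?_
  have : (HomogeneousLocalization.fromZeroRingHom (grading n) (Submonoid.powers 1)
      (algebraMap ℂ (grading n 0) c)).val =
      algebraMap (MvPolynomial (Fin (n + 1)) ℂ) _ (MvPolynomial.C c) := by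
    rw [← Localization.mk_one_eq_algebraMap]
    rfl
  rw [this, IsLocalization.map_eq]
  rfl

/-- Dehomogenisation: in a form of degree `N`, substituting `xₐ / xᵢ` for `xₐ` divides each monomial
by `xᵢ^N`. -/
lemma eval₂_mul_pow_eq {L : Type*} [CommRing L] (φ : MvPolynomial (Fin (n + 1)) ℂ →+* L)
    {i : Fin (n + 1)} {t : Fin (n + 1) → L}
    (ht : ∀ a, t a * φ (MvPolynomial.X i) = φ (MvPolynomial.X a)) {N : ℕ}
    {p : MvPolynomial (Fin (n + 1)) ℂ} (hp : p ∈ grading n N) :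
    MvPolynomial.eval₂ (φ.comp MvPolynomial.C) t p * φ (MvPolynomial.X i) ^ N = φ p := by
  have h : φ p = MvPolynomial.eval₂ (φ.comp MvPolynomial.C) (fun a ↦ φ (MvPolynomial.X a)) p := by
    conv_lhs => rw [← MvPolynomial.eval₂_eta p]
    rw [MvPolynomial.hom_eval₂]
  rw [h, MvPolynomial.eval₂_eq', MvPolynomial.eval₂_eq', Finset.sum_mul]
  refine Finset.sum_congr rfl fun m hm ↦ ?_
  have h1 (a : Fin (n + 1)) : φ (MvPolynomial.X a) ^ m a = t a ^ m a * φ (MvPolynomial.X i) ^ m a := by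
    rw [← mul_pow, ht a]
  rw [Finset.prod_congr rfl fun a _ ↦ h1 a, Finset.prod_mul_distrib, Finset.prod_pow_eq_pow_sum,
    ← Finsupp.degree_eq_sum, degree_of_mem_grading hp hm, mul_assoc]

/-- The coefficient map of the sections of the structure sheaf. -/
def constantSection (U : (ProjectiveSpace n).Opens) : ℂ →+* Γ(ProjectiveSpace n, U) :=
  ((structureMap (structureMorphism n)).app (op U)).hom

lemma exists_ratio {U : (ProjectiveSpace n).Opens} {i : Fin (n + 1)} (h : U ≤ chart i)
    (a : Fin (n + 1)) :
    ∃ t : Γ(ProjectiveSpace n, U), ∀ x, sectionVal x t * coord x.1 i = coord x.1 a := by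
  obtain ⟨y, hy, hxy⟩ := exists_isTwist_coord_mul_eq_one (U := U) h
  obtain ⟨c, hc⟩ := (((isTwist_coord a).mul hy).of_eq (by omega : (1 : ℤ) + -1 = 0)).exists_section
  refine ⟨c, fun x ↦ ?_⟩
  have h1 : sectionVal x c = coord x.1 a * y x := hc x
  rw [h1]
  linear_combination coord x.1 a * hxy x

/-- The affine coordinates `x_a / x_i`. -/
def ratio {U : (ProjectiveSpace n).Opens} {i : Fin (n + 1)} (h : U ≤ chart i) (a : Fin (n + 1)) :
    Γ(ProjectiveSpace n, U) := (exists_ratio h a).choose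

lemma sectionVal_ratio {U : (ProjectiveSpace n).Opens} {i : Fin (n + 1)} (h : U ≤ chart i)
    (a : Fin (n + 1)) (x : U) : sectionVal x (ratio h a) * coord x.1 i = coord x.1 a :=
  (exists_ratio h a).choose_spec x

lemma coord_ne_zero (x : ProjectiveSpectrum (grading n)) (i : Fin (n + 1)) : coord x i ≠ 0 :=
  fun h ↦ MvPolynomial.X_ne_zero i (algebraMap_locAt_injective x (h.trans (map_zero _).symm))

/-- A function on the chart is `p / xᵢ^N` with `p` homogeneous of degree `N`, hence `p` evaluated at
the ratios `xₐ / xᵢ`. -/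
lemma exists_eval₂_eq_map {U : (ProjectiveSpace n).Opens} {i : Fin (n + 1)} (h : U ≤ chart i)
    (b : Γ(ProjectiveSpace n, chart i)) : ∃ p : MvPolynomial (Fin (n + 1)) ℂ,
      (ProjectiveSpace n).presheaf.map (homOfLE h).op b =
        MvPolynomial.eval₂ (constantSection U) (ratio h) p := by
  obtain ⟨N, p, hp, hN⟩ := exists_section_mul_pow_eq (grading n) (X_mem_grading i) one_pos b
  rw [mul_one] at hp
  refine ⟨p, section_ext fun x ↦ mul_right_cancel₀ (pow_ne_zero N (coord_ne_zero x.1 i)) ?_⟩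
  rw [MvPolynomial.hom_eval₂]
  have h1 : (sectionVal x).comp (constantSection U) = (toLocAt x.1).comp MvPolynomial.C :=
    RingHom.ext fun c ↦ sectionVal_structureMap x c
  rw [h1]
  refine Eq.trans ?_ (eval₂_mul_pow_eq (toLocAt x.1) (fun a ↦ sectionVal_ratio h a x) hp).symm
  rw [← map_pow]
  exact hN ⟨x.1, h x.2⟩

lemma exists_mul_map_pow_eq {X : Scheme.{u}} {V : X.Opens} (hV : IsAffineOpen V) (f : Γ(X, V))
    (a : Γ(X, X.basicOpen f)) : ∃ (N : ℕ) (b : Γ(X, V)),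
      a * X.presheaf.map (homOfLE (X.basicOpen_le f)).op (f ^ N) =
        X.presheaf.map (homOfLE (X.basicOpen_le f)).op b ∧
      IsUnit (X.presheaf.map (homOfLE (X.basicOpen_le f)).op (f ^ N)) := by
  have := hV.isLocalization_basicOpen f
  obtain ⟨N, b, hb⟩ := IsLocalization.Away.surj f a
  refine ⟨N, b, ?_, ?_⟩
  · rw [map_pow]
    exact hb
  · rw [map_pow]
    exact (IsLocalization.Away.algebraMap_isUnit (S := Γ(X, X.basicOpen f)) f).pow N

/-- A derivation of the sections over a distinguished open set is determined by its values at the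
affine coordinates. -/
lemma derivation_eq_zero {U : (ProjectiveSpace n).Opens} {i : Fin (n + 1)} (hU : IsDistinguished i U)
    (h : U ≤ chart i) {M : Type*} [AddCommGroup M] [Module Γ(ProjectiveSpace n, U) M]
    (d : Γ(ProjectiveSpace n, U) →+ M) (hmul : ∀ a b, d (a * b) = a • d b + b • d a)
    (hC : ∀ c, d (constantSection U c) = 0) (hd : ∀ a, d (ratio h a) = 0) : d = 0 := by
  have h1 (p : MvPolynomial (Fin (n + 1)) ℂ) :
      d (MvPolynomial.eval₂ (constantSection U) (ratio h) p) = 0 := by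
    induction p using MvPolynomial.induction_on with
    | C c => rw [MvPolynomial.eval₂_C, hC]
    | add p q hp hq => rw [MvPolynomial.eval₂_add, map_add, hp, hq, add_zero]
    | mul_X p a hp =>
      rw [MvPolynomial.eval₂_mul, MvPolynomial.eval₂_X, hmul, hp, hd, smul_zero, smul_zero, add_zero]
  have h2 (b : Γ(ProjectiveSpace n, chart i)) :
      d ((ProjectiveSpace n).presheaf.map (homOfLE h).op b) = 0 := by
    obtain ⟨p, hp⟩ := exists_eval₂_eq_map h b
    rw [hp, h1]
  obtain ⟨f, rfl⟩ := hU
  ext a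
  -- In `a f^N = b` the derivation kills `b` and `f^N`, which come from the chart. Since `f^N` is a
  -- unit, it kills `a` too.
  obtain ⟨N, b, hb, hf⟩ := exists_mul_map_pow_eq (X := ProjectiveSpace n) (isAffineOpen_chart i) f a
  have h4 := congrArg d hb
  rw [hmul, h2 b, h2 (f ^ N), smul_zero, zero_add] at h4
  exact hf.smul_eq_zero.1 h4

end StructureMap

/-! ### The comparison map from Kähler differentials given by the gradient -/

section FormMap

lemma universalDesc_app_d {C : Type*} [Category* C] {S R : Cᵒᵖ ⥤ CommRingCat.{u}} (φ : S ⟶ R)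
    {M : PresheafOfModules.{u} (R ⋙ forget₂ CommRingCat.{u} RingCat.{u})} (d : M.Derivation' φ)
    (Y : Cᵒᵖ) (b : R.obj Y) :
    (((PresheafOfModules.DifferentialsConstruction.isUniversal' φ).desc d).app Y).hom
      (CommRingCat.KaehlerDifferential.d (f := φ.app Y) b) = d.d b :=
  ModuleCat.Derivation.desc_d (d.app Y) b

variable {n : ℕ}

/-- The model of `Ω¹` as a sheaf of modules. -/
abbrev formsOne (n : ℕ) (k : ℤ) : (ProjectiveSpace n).Modules :=
  linearSheaf (grading n) (Fin (n + 1)) (k - 1) eulerOne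

/-- The model of `Ω²` as a sheaf of modules. -/
abbrev formsTwo (n : ℕ) (k : ℤ) : (ProjectiveSpace n).Modules :=
  linearSheaf (grading n) (Fin (n + 1) × Fin (n + 1)) (k - 2) eulerTwo

/-- The gradient of a function, in homogeneous coordinates. -/
def gradient (U : (ProjectiveSpace n).Opens) (a : Γ(ProjectiveSpace n, U)) :
    (linearPresheaf (grading n) (Fin (n + 1)) (0 - 1) eulerOne).obj (op U) :=
  linearMk (fun x i ↦ partialLoc x.1 i (sectionVal x a))
    (fun i ↦ (isTwist_val a).partialLoc i) fun x ↦ (isTwist_val a).sum_coord_mul_partialLoc x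

section

variable {U : (ProjectiveSpace n).Opens} (a b : Γ(ProjectiveSpace n, U))

lemma gradient_add : gradient U (a + b) = gradient U a + gradient U b :=
  linear_ext fun x i ↦ (congrArg (partialLoc x.1 i) (map_add (sectionVal x) a b)).trans
    (AddMonoidHom.map_add (partialLoc x.1 i) _ _)

lemma gradient_constantSection (c : ℂ) : gradient U (constantSection U c) = 0 :=
  linear_ext fun x i ↦
    (congrArg (partialLoc x.1 i) (sectionVal_structureMap x c)).trans
      ((partialLoc_toLocAt x.1 i _).trans (by rw [MvPolynomial.pderiv_C]; exact map_zero _))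

end

/-- The derivation of the structure sheaf given by the gradient. -/
def gradientDerivation (n : ℕ) :
    PresheafOfModules.Derivation' (formsOne n 0).val (structureMap (structureMorphism n)) where
  d := AddMonoidHom.mk' (gradient _) gradient_add
  d_mul a b := linear_ext fun x i ↦
    (congrArg (partialLoc x.1 i) (map_mul (sectionVal x) a b)).trans (partialLoc_mul _ _ _ _)
  d_map _ _ := rfl
  d_app c := gradient_constantSection c

/-- The comparison of the presheaf of Kähler differentials with its model. -/
def kaehlerMap (n : ℕ) :
    PresheafOfModules.DifferentialsConstruction.relativeDifferentials'
      (structureMap (structureMorphism n)) ⟶ (formsOne n 0).val :=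
  (PresheafOfModules.DifferentialsConstruction.isUniversal' _).desc (gradientDerivation n)

/-- The differential of a function, in the presheaf of Kähler differentials. -/
abbrev kd (U : (ProjectiveSpace n).Opens) (a : Γ(ProjectiveSpace n, U)) :
    (PresheafOfModules.DifferentialsConstruction.relativeDifferentials'
      (structureMap (structureMorphism n))).obj (op U) :=
  CommRingCat.KaehlerDifferential.d (f := (structureMap (structureMorphism n)).app (op U)) a

lemma kaehlerMap_kd (U : (ProjectiveSpace n).Opens) (a : Γ(ProjectiveSpace n, U)) :
    ((kaehlerMap n).app (op U)).hom (kd U a) = gradient U a :=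
  universalDesc_app_d _ (gradientDerivation n) (op U) a

end FormMap

/-! ### One-forms on distinguished open sets -/

section LocalForms

variable {n : ℕ} {U : (ProjectiveSpace n).Opens}

/-- The Kähler differentials of the sections of the structure sheaf. -/
abbrev Kd (U : (ProjectiveSpace n).Opens) : ModuleCat Γ(ProjectiveSpace n, U) :=
  CommRingCat.KaehlerDifferential ((structureMap (structureMorphism n)).app (op U))

/-- A pointwise linear condition on families of elements of the local rings. -/
abbrev LinCond (n : ℕ) (T : Type) : Type :=
  ∀ x : ProjectiveSpectrum (grading n), Submodule (LocAt (grading n) x) (T → LocAt (grading n) x)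

/-- The sections over `U` of a sheaf of families of sections of `𝒪(k)`, as a module. -/
def linMod (U : (ProjectiveSpace n).Opens) (T : Type) (k : ℤ) (P : LinCond n T) :
    ModuleCat Γ(ProjectiveSpace n, U) :=
  @ModuleCat.of Γ(ProjectiveSpace n, U) _ ((linearPresheaf (grading n) T k P).obj (op U)) _
    (linearModule (grading n) T k P (op U))

section

variable {T : Type} {k : ℤ} {P : LinCond n T}

/-- The family of functions of a section. -/
def linVal (x : U) (t : T) : linMod U T k P →+ LocAt (grading n) x.1 :=
  linearEval (𝒜 := grading n) (T := T) (k := k) (P := P) (U := U) x t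

lemma linVal_smul (c : Γ(ProjectiveSpace n, U)) (s : linMod U T k P) (x : U) (t : T) :
    linVal x t (c • s) = sectionVal x c * linVal x t s := rfl

lemma linMod_ext {s s' : linMod U T k P} (h : ∀ x t, linVal x t s = linVal x t s') : s = s' :=
  linear_ext h

/-- Multiplying a component by a form of the opposite degree produces a section of `𝒪(0)`, that is,
a function. This yields linear coefficient functionals. -/
lemma exists_coefficient {q : MvPolynomial (Fin (n + 1)) ℂ} {l : ℕ} (hq : q ∈ grading n l)
    (hl : l + k = 0) (t : T) : ∃ c : linMod U T k P →ₗ[Γ(ProjectiveSpace n, U)] Γ(ProjectiveSpace n, U),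
      ∀ v x, sectionVal x (c v) = toLocAt x.1 q * linVal x t v := by
  have h (v : linMod U T k P) : ∃ c : Γ(ProjectiveSpace n, U),
      ∀ x, sectionVal x c = toLocAt x.1 q * linVal x t v :=
    (((isTwist_algebraMap hq rfl).mul (linearVal_isTwist (𝒜 := grading n) (T := T) (k := k) (P := P)
      (U := U) v t)).of_eq hl).exists_section
  choose c hc using h
  exact ⟨{  toFun := c
            map_add' := fun v w ↦ section_ext fun x ↦ by
              rw [hc, map_add, map_add, hc, hc, mul_add]
            map_smul' := fun a v ↦ section_ext fun x ↦ by
              rw [hc, linVal_smul, RingHom.id_apply, smul_eq_mul, map_mul, hc, mul_left_comm] }, hc⟩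

end

/-- The gradient of a function. -/
def grad (a : Γ(ProjectiveSpace n, U)) : linMod U (Fin (n + 1)) (0 - 1) eulerOne := gradient U a

lemma linVal_grad (a : Γ(ProjectiveSpace n, U)) (x : U) (i : Fin (n + 1)) :
    linVal x i (grad a) = partialLoc x.1 i (sectionVal x a) := rfl

/-- The comparison of Kähler differentials with their model. -/
def kaehlerHom (U : (ProjectiveSpace n).Opens) :
    Kd U →ₗ[Γ(ProjectiveSpace n, U)] linMod U (Fin (n + 1)) (0 - 1) eulerOne where
  toFun m := ((kaehlerMap n).app (op U)).hom m
  map_add' a b := map_add ((kaehlerMap n).app (op U)).hom a b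
  map_smul' c a := map_smul ((kaehlerMap n).app (op U)).hom c a

/-- The differential of a function. -/
abbrev dd (a : Γ(ProjectiveSpace n, U)) : Kd U := CommRingCat.KaehlerDifferential.d a

lemma kaehlerHom_dd (a : Γ(ProjectiveSpace n, U)) : kaehlerHom U (dd a) = grad a :=
  kaehlerMap_kd U a

lemma grad_add (a b : Γ(ProjectiveSpace n, U)) : grad (a + b) = grad a + grad b := gradient_add a b

lemma grad_mul (a b : Γ(ProjectiveSpace n, U)) : grad (a * b) = a • grad b + b • grad a :=
  (gradientDerivation n).d_mul (X := op U) a b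

lemma grad_constantSection (c : ℂ) : grad (constantSection U c) = 0 := gradient_constantSection c

lemma dd_add (a b : Γ(ProjectiveSpace n, U)) : dd (a + b) = dd a + dd b :=
  ModuleCat.Derivation.d_add _ a b

lemma dd_mul (a b : Γ(ProjectiveSpace n, U)) : dd (a * b) = a • dd b + b • dd a :=
  ModuleCat.Derivation.d_mul _ a b

lemma dd_constantSection (c : ℂ) : dd (constantSection U c) = 0 :=
  ModuleCat.Derivation.d_map (f := (structureMap (structureMorphism n)).app (op U)) _ c

lemma dd_one : dd (1 : Γ(ProjectiveSpace n, U)) = 0 := by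
  rw [← map_one (constantSection U), dd_constantSection]

variable {i : Fin (n + 1)} (h : U ≤ chart i)

lemma ratio_self : ratio h i = 1 := section_ext fun x ↦
  mul_right_cancel₀ (coord_ne_zero x.1 i) (by rw [sectionVal_ratio, map_one, one_mul])

/-- Differentiate `r xᵢ = xₐ` with respect to `x_l`. -/
lemma coord_mul_partialLoc {x : ProjectiveSpectrum (grading n)} {i a : Fin (n + 1)}
    {r : LocAt (grading n) x} (hr : r * coord x i = coord x a) (l : Fin (n + 1)) :
    coord x i * partialLoc x l r = (if a = l then 1 else 0) - r * (if i = l then 1 else 0) := by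
  have h1 (j : Fin (n + 1)) : partialLoc x l (coord x j) = if j = l then 1 else 0 := by
    rw [partialLoc_toLocAt, MvPolynomial.pderiv_X, Pi.single_apply]
    split_ifs
    · exact map_one _
    · exact map_zero _
  have h2 := congrArg (partialLoc x l) hr
  rw [partialLoc_mul, h1, h1] at h2
  linear_combination h2

lemma coord_mul_partialLoc_ratio (x : U) (a l : Fin (n + 1)) :
    coord x.1 i * partialLoc x.1 l (sectionVal x (ratio h a)) =
      (if a = l then 1 else 0) - sectionVal x (ratio h a) * (if i = l then 1 else 0) :=
  coord_mul_partialLoc (sectionVal_ratio h a x) l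

lemma sum_mul_ratio {x : U} {v : Fin (n + 1) → LocAt (grading n) x.1} (hv : v ∈ eulerOne x.1) :
    ∑ a, v a * sectionVal x (ratio h a) = 0 := by
  refine mul_right_cancel₀ (coord_ne_zero x.1 i) ?_
  rw [zero_mul, Finset.sum_mul, ← mem_eulerOne.1 hv]
  refine Finset.sum_congr rfl fun a _ ↦ ?_
  rw [mul_assoc, sectionVal_ratio, mul_comm]

/-- The coefficients of a form with respect to the differentials of the affine coordinates. -/
def coeffOne (i a : Fin (n + 1)) :
    linMod U (Fin (n + 1)) (0 - 1) eulerOne →ₗ[Γ(ProjectiveSpace n, U)] Γ(ProjectiveSpace n, U) :=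
  (exists_coefficient (X_mem_grading i) (by norm_num) a).choose

lemma sectionVal_coeffOne (i a : Fin (n + 1)) (v : linMod U (Fin (n + 1)) (0 - 1) eulerOne) (x : U) :
    sectionVal x (coeffOne i a v) = coord x.1 i * linVal x a v :=
  (exists_coefficient (X_mem_grading i) (by norm_num) a).choose_spec v x

lemma linVal_mem {T : Type} {k : ℤ} {P : LinCond n T} (s : linMod U T k P) (x : U) :
    (fun t ↦ linVal x t s) ∈ P x.1 :=
  linearVal_mem (𝒜 := grading n) (T := T) (k := k) (P := P) (U := U) s x

/-- The map `v ↦ ∑ xᵢ vₐ d(xₐ/xᵢ)` is a right inverse of the comparison. Expanding the gradients of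
the ratios leaves `v` plus a multiple of `∑ vₐ xₐ / xᵢ = 0`. -/
lemma kaehlerHom_sum (v : linMod U (Fin (n + 1)) (0 - 1) eulerOne) :
    kaehlerHom U (∑ a, coeffOne i a v • dd (ratio h a)) = v := by
  refine linMod_ext fun x l ↦ ?_
  have h1 (a : Fin (n + 1)) : linVal x l (kaehlerHom U (coeffOne i a v • dd (ratio h a))) =
      linVal x a v * ((if a = l then 1 else 0) -
        sectionVal x (ratio h a) * (if i = l then 1 else 0)) := by
    rw [map_smul, kaehlerHom_dd, linVal_smul, sectionVal_coeffOne, linVal_grad,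
      ← coord_mul_partialLoc_ratio h x a l]
    ring
  rw [map_sum, map_sum, Finset.sum_congr rfl fun a _ ↦ h1 a]
  have h2 := sum_mul_ratio h (linVal_mem v x)
  simp only [mul_sub, Finset.sum_sub_distrib, ← mul_assoc, ← Finset.sum_mul] at h2 ⊢
  rw [h2, zero_mul, sub_zero]
  simp

/-- The difference of the two sides is a derivation in `f` that kills constants. It kills the ratios
as well, since the surplus term contains `d(xᵢ/xᵢ) = d1 = 0`. -/
lemma sum_coeffOne_grad (hU : IsDistinguished i U) (f : Γ(ProjectiveSpace n, U)) :
    ∑ a, coeffOne i a (grad f) • dd (ratio h a) = dd f := by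
  let d : Γ(ProjectiveSpace n, U) →+ Kd U := AddMonoidHom.mk'
    (fun f ↦ ∑ a, coeffOne i a (grad f) • dd (ratio h a) - dd f) fun f g ↦ by
      simp only [grad_add, map_add, add_smul, Finset.sum_add_distrib, dd_add]
      abel
  have hd : d = 0 := by
    refine derivation_eq_zero hU h d (fun f g ↦ ?_) (fun c ↦ ?_) fun b ↦ ?_
    · change ∑ a, coeffOne i a (grad (f * g)) • dd (ratio h a) - dd (f * g) =
        f • (∑ a, coeffOne i a (grad g) • dd (ratio h a) - dd g) +
        g • (∑ a, coeffOne i a (grad f) • dd (ratio h a) - dd f)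
      simp only [grad_mul, map_add, map_smul, add_smul, Finset.sum_add_distrib, dd_mul, smul_eq_mul,
        mul_smul, smul_sub, Finset.smul_sum]
      abel
    · change ∑ a, coeffOne i a (grad (constantSection U c)) • dd (ratio h a) -
        dd (constantSection U c) = 0
      simp [grad_constantSection, dd_constantSection]
    · change ∑ a, coeffOne i a (grad (ratio h b)) • dd (ratio h a) - dd (ratio h b) = 0
      have h1 (a : Fin (n + 1)) : coeffOne i a (grad (ratio h b)) =
          (if b = a then 1 else 0) - ratio h b * (if i = a then 1 else 0) := section_ext fun x ↦ by
        rw [sectionVal_coeffOne, linVal_grad, coord_mul_partialLoc_ratio h x b a, map_sub, map_mul,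
          apply_ite (sectionVal x), apply_ite (sectionVal x), map_one, map_zero]
      simp only [h1, sub_smul, Finset.sum_sub_distrib, mul_ite, mul_one, mul_zero, ite_smul,
        one_smul, zero_smul, Finset.sum_ite_eq, Finset.mem_univ, if_true]
      rw [ratio_self, dd_one, smul_zero, sub_zero, sub_self]
  exact sub_eq_zero.1 (congrArg (fun d ↦ d f) hd)

/-- This is the left inverse property. A linear endomorphism of the Kähler differentials is
determined by its values on exact differentials. -/
lemma sum_coeffOne_kaehlerHom (hU : IsDistinguished i U) (m : Kd U) :
    ∑ a, coeffOne i a (kaehlerHom U m) • dd (ratio h a) = m := by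
  let S : Kd U →ₗ[Γ(ProjectiveSpace n, U)] Kd U :=
    ∑ a, ((coeffOne i a).comp (kaehlerHom U)).smulRight (dd (ratio h a))
  have hS : ModuleCat.ofHom S = 𝟙 (Kd U) := CommRingCat.KaehlerDifferential.ext fun b ↦ by
    refine Eq.trans ?_ (sum_coeffOne_grad h hU b)
    change S (dd b) = _
    simp only [S, LinearMap.sum_apply, LinearMap.smulRight_apply, LinearMap.comp_apply, kaehlerHom_dd]
  have := congrArg (fun φ ↦ φ.hom m) hS
  simpa [S] using this

end LocalForms

/-! ### Criteria for maps out of exterior powers -/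

section Alternating

variable {R M K J : Type*} [CommRing R] [AddCommGroup M] [Module R M] [AddCommGroup K] [Module R K]
  [Fintype J]

/-- The two identities make `w ↦ ∑ c_j(w) e_j` a two-sided inverse. The `e_j` need not be a basis,
so all `n + 1` ratios can be used, including the trivial one. -/
lemma bijective_alternatingMapLinearEquiv {p : ℕ} (φ : M [⋀^Fin p]→ₗ[R] K) (e : J → Fin p → M)
    (c : J → K →ₗ[R] R) (h₁ : ∀ m, ∑ j, c j (φ m) • exteriorPower.ιMulti R p (e j) =
      exteriorPower.ιMulti R p m) (h₂ : ∀ w, ∑ j, c j w • φ (e j) = w) :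
    Function.Bijective (exteriorPower.alternatingMapLinearEquiv φ) := by
  let S : K →ₗ[R] ⋀[R]^p M := ∑ j, (c j).smulRight (exteriorPower.ιMulti R p (e j))
  have hS (w : K) : S w = ∑ j, c j w • exteriorPower.ιMulti R p (e j) := by simp [S]
  have h : S ∘ₗ exteriorPower.alternatingMapLinearEquiv φ = LinearMap.id := by
    refine exteriorPower.linearMap_ext (AlternatingMap.ext fun m ↦ ?_)
    change S (exteriorPower.alternatingMapLinearEquiv φ (exteriorPower.ιMulti R p m)) =
      exteriorPower.ιMulti R p m
    rw [exteriorPower.alternatingMapLinearEquiv_apply_ιMulti, hS, h₁]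
  refine Function.bijective_iff_has_inverse.2 ⟨S, fun x ↦ LinearMap.congr_fun h x, fun w ↦ ?_⟩
  rw [hS, map_sum]
  simp only [map_smul, exteriorPower.alternatingMapLinearEquiv_apply_ιMulti, h₂]

/-- The alternating map in two variables given by an alternating bilinear map. -/
def alternatingOfBilin (B : M →ₗ[R] M →ₗ[R] K) (hB : ∀ m, B m m = 0) : M [⋀^Fin 2]→ₗ[R] K where
  toFun m := B (m 0) (m 1)
  map_update_add' m i x y := by fin_cases i <;> simp
  map_update_smul' m i c x := by fin_cases i <;> simp
  map_eq_zero_of_eq' m i j h hij := by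
    have h' : m 0 = m 1 := by
      fin_cases i <;> fin_cases j <;> first | exact absurd rfl hij | exact h | exact h.symm
    rw [h', hB]

lemma alternating_swap (ι : M [⋀^Fin 2]→ₗ[R] K) (x y : M) : ι ![y, x] = - ι ![x, y] := by
  rw [← ι.map_swap ![x, y] (zero_ne_one (α := Fin 2))]
  congr 1
  ext i
  fin_cases i <;> rfl

/-- The bilinear map of an alternating map in two variables. -/
def bilinOfAlternating (ι : M [⋀^Fin 2]→ₗ[R] K) : M →ₗ[R] M →ₗ[R] K :=
  LinearMap.mk₂ R (fun x y ↦ ι ![x, y]) (fun x x' y ↦ ι.map_vecCons_add ![y] x x')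
    (fun c x y ↦ ι.map_vecCons_smul ![y] c x)
    (fun x y y' ↦ by
      rw [← neg_inj, neg_add, ← alternating_swap, ← alternating_swap, ← alternating_swap]
      exact ι.map_vecCons_add ![x] y y')
    (fun c x y ↦ by
      rw [← neg_inj, ← smul_neg, ← alternating_swap, ← alternating_swap]
      exact ι.map_vecCons_smul ![x] c y)

/-- Expand both arguments through `h`. The antisymmetrised coefficients give twice the value, which
`a = 1/2` corrects. -/
lemma sum_smul_alternating {a : R} (ha : a + a = 1) {d : J → M} {c : J → M →ₗ[R] R}
    (h : ∀ m, ∑ j, c j m • d j = m) (ι : M [⋀^Fin 2]→ₗ[R] K) (m : Fin 2 → M) :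
    ∑ p : J × J, (a * (c p.1 (m 0) * c p.2 (m 1) - c p.2 (m 0) * c p.1 (m 1))) •
      ι ![d p.1, d p.2] = ι m := by
  have key (x y : M) : ∑ p : J × J, (c p.1 x * c p.2 y) • ι ![d p.1, d p.2] = ι ![x, y] := by
    conv_rhs => rw [← h x, ← h y]
    change _ = bilinOfAlternating ι _ _
    rw [Fintype.sum_prod_type]
    simp only [map_sum, map_smul, LinearMap.sum_apply, LinearMap.smul_apply, Finset.smul_sum,
      smul_smul]
    rw [Finset.sum_comm]
    refine Finset.sum_congr rfl fun j _ ↦ Finset.sum_congr rfl fun k _ ↦ ?_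
    rw [mul_comm]
    rfl
  have hm : ![m 0, m 1] = m := by
    ext i
    fin_cases i <;> rfl
  have key' := key (m 1) (m 0)
  rw [alternating_swap, hm] at key'
  have key'' := key (m 0) (m 1)
  rw [hm] at key''
  have hp (p : J × J) : (a * (c p.1 (m 0) * c p.2 (m 1) - c p.2 (m 0) * c p.1 (m 1))) •
      ι ![d p.1, d p.2] = a • ((c p.1 (m 0) * c p.2 (m 1)) • ι ![d p.1, d p.2] -
        (c p.1 (m 1) * c p.2 (m 0)) • ι ![d p.1, d p.2]) := by
    rw [mul_smul, sub_smul, mul_comm (c p.1 (m 1))]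
  rw [Finset.sum_congr rfl fun p _ ↦ hp p, ← Finset.smul_sum, Finset.sum_sub_distrib, key', key'',
    sub_neg_eq_add, smul_add, ← add_smul, ha, one_smul]

end Alternating

/-! ### First and second exterior powers compared with the models -/

section FormPowers

variable {n : ℕ} {U : (ProjectiveSpace n).Opens}

/-- The comparison of the first exterior power of the Kähler differentials with its model. -/
def kaehlerOne (U : (ProjectiveSpace n).Opens) :
    Kd U [⋀^Fin 1]→ₗ[Γ(ProjectiveSpace n, U)] linMod U (Fin (n + 1)) (0 - 1) eulerOne :=
  AlternatingMap.ofSubsingleton _ _ _ 0 (kaehlerHom U)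

variable {i : Fin (n + 1)}

lemma bijective_kaehlerOne (h : U ≤ chart i) (hU : IsDistinguished i U) :
    Function.Bijective (exteriorPower.alternatingMapLinearEquiv (kaehlerOne U)) := by
  refine bijective_alternatingMapLinearEquiv _ (fun a _ ↦ dd (ratio h a)) (coeffOne i)
    (fun m ↦ ?_) fun w ↦ ?_
  · let L := (AlternatingMap.ofSubsingleton Γ(ProjectiveSpace n, U) (Kd U) _ (0 : Fin 1)).symm
      (exteriorPower.ιMulti Γ(ProjectiveSpace n, U) 1)
    have hm : m = fun _ ↦ m 0 := by
      ext j
      rw [Subsingleton.elim j 0]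
    rw [hm]
    change _ = L (m 0)
    rw [← sum_coeffOne_kaehlerHom h hU (m 0), map_sum]
    refine Finset.sum_congr rfl fun a _ ↦ ?_
    rw [map_smul, sum_coeffOne_kaehlerHom h hU]
    rfl
  · refine Eq.trans ?_ (kaehlerHom_sum h w)
    rw [map_sum]
    refine Finset.sum_congr rfl fun a _ ↦ ?_
    rw [map_smul]
    rfl

lemma wedge_mem {x : ProjectiveSpectrum (grading n)} {v w : Fin (n + 1) → LocAt (grading n) x}
    (hv : v ∈ eulerOne x) (hw : w ∈ eulerOne x) :
    (fun p : Fin (n + 1) × Fin (n + 1) ↦ v p.1 * w p.2 - v p.2 * w p.1) ∈ eulerTwo x := by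
  rw [mem_eulerOne] at hv hw
  refine mem_eulerTwo.2 ⟨mem_antisymmetric.2 fun a b ↦ by ring, fun a ↦ mem_eulerOne.2 ?_⟩
  have h (b : Fin (n + 1)) : coord x b * (v a * w b - v b * w a) =
      v a * (coord x b * w b) - (coord x b * v b) * w a := by ring
  simp only [h, Finset.sum_sub_distrib, ← Finset.mul_sum, ← Finset.sum_mul]
  rw [hv, hw, mul_zero, zero_mul, sub_zero]

/-- The wedge product of two forms. -/
def wedge (v w : linMod U (Fin (n + 1)) (0 - 1) eulerOne) :
    linMod U (Fin (n + 1) × Fin (n + 1)) (0 - 2) eulerTwo :=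
  linearMk (𝒜 := grading n) (T := Fin (n + 1) × Fin (n + 1)) (k := 0 - 2) (P := eulerTwo) (U := U)
    (fun x p ↦ linVal x p.1 v * linVal x p.2 w - linVal x p.2 v * linVal x p.1 w)
    (fun p ↦ ((((linearVal_isTwist (𝒜 := grading n) (P := eulerOne) v p.1).mul
      (linearVal_isTwist (𝒜 := grading n) (P := eulerOne) w p.2)).sub
      ((linearVal_isTwist (𝒜 := grading n) (P := eulerOne) v p.2).mul
      (linearVal_isTwist (𝒜 := grading n) (P := eulerOne) w p.1)))).of_eq (by norm_num))
    fun x ↦ wedge_mem (linVal_mem v x) (linVal_mem w x)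

lemma linVal_wedge (v w : linMod U (Fin (n + 1)) (0 - 1) eulerOne) (x : U)
    (p : Fin (n + 1) × Fin (n + 1)) : linVal x p (wedge v w) =
      linVal x p.1 v * linVal x p.2 w - linVal x p.2 v * linVal x p.1 w := rfl

/-- The wedge product as a bilinear map. -/
def wedgeBilin (U : (ProjectiveSpace n).Opens) :
    linMod U (Fin (n + 1)) (0 - 1) eulerOne →ₗ[Γ(ProjectiveSpace n, U)]
    linMod U (Fin (n + 1)) (0 - 1) eulerOne →ₗ[Γ(ProjectiveSpace n, U)]
    linMod U (Fin (n + 1) × Fin (n + 1)) (0 - 2) eulerTwo :=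
  LinearMap.mk₂ _ wedge
    (fun v v' w ↦ linMod_ext fun x p ↦ by simp only [linVal_wedge, map_add]; ring)
    (fun c v w ↦ linMod_ext fun x p ↦ by simp only [linVal_wedge, linVal_smul]; ring)
    (fun v w w' ↦ linMod_ext fun x p ↦ by simp only [linVal_wedge, map_add]; ring)
    (fun c v w ↦ linMod_ext fun x p ↦ by simp only [linVal_wedge, linVal_smul]; ring)

/-- The comparison of the second exterior power of the Kähler differentials with its model. -/
def kaehlerTwo (U : (ProjectiveSpace n).Opens) :
    Kd U [⋀^Fin 2]→ₗ[Γ(ProjectiveSpace n, U)]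
      linMod U (Fin (n + 1) × Fin (n + 1)) (0 - 2) eulerTwo :=
  alternatingOfBilin ((wedgeBilin U).compl₁₂ (kaehlerHom U) (kaehlerHom U)) fun m ↦
    linMod_ext fun x p ↦ by
      change linVal x p (wedge _ _) = _
      rw [linVal_wedge, map_zero, mul_comm, sub_self]

/-- The square of `xᵢ` clears the degree `-2`. The factor one half compensates for summing over
ordered pairs. -/
lemma exists_coeffTwo (i : Fin (n + 1)) (p : Fin (n + 1) × Fin (n + 1)) :
    ∃ c : linMod U (Fin (n + 1) × Fin (n + 1)) (0 - 2) eulerTwo →ₗ[Γ(ProjectiveSpace n, U)]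
      Γ(ProjectiveSpace n, U), ∀ v x, sectionVal x (c v) =
        toLocAt x.1 (MvPolynomial.C (1 / 2)) * coord x.1 i ^ 2 * linVal x p v := by
  obtain ⟨c, hc⟩ := exists_coefficient (U := U) (P := eulerTwo) (k := 0 - 2) (l := 2)
    (q := MvPolynomial.C (1 / 2) * MvPolynomial.X i ^ 2) (by
      rw [← MvPolynomial.smul_eq_C_mul]
      exact Submodule.smul_mem _ _ (SetLike.pow_mem_graded 2 (X_mem_grading i))) (by norm_num) p
  exact ⟨c, fun v x ↦ by rw [hc, map_mul, map_pow]⟩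

lemma half_add_half (x : ProjectiveSpectrum (grading n)) :
    toLocAt x (MvPolynomial.C (1 / 2)) + toLocAt x (MvPolynomial.C (1 / 2)) = 1 := by
  rw [← map_add, ← map_add, add_halves, map_one, map_one]

lemma sum_mul_partialLoc (h : U ≤ chart i) {x : U} {v : Fin (n + 1) → LocAt (grading n) x.1} (hv : v ∈ eulerOne x.1)
    (l : Fin (n + 1)) :
    ∑ a, v a * (coord x.1 i * partialLoc x.1 l (sectionVal x (ratio h a))) = v l := by
  have h2 := sum_mul_ratio h hv
  simp only [coord_mul_partialLoc_ratio h x, mul_sub, Finset.sum_sub_distrib, ← mul_assoc,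
    ← Finset.sum_mul]
  rw [h2, zero_mul, sub_zero]
  simp

/-- The inverse sends `w` to `½ ∑ xᵢ² w_ab d(xₐ/xᵢ) ∧ d(x_b/xᵢ)`. -/
lemma bijective_kaehlerTwo (h : U ≤ chart i) (hU : IsDistinguished i U) :
    Function.Bijective (exteriorPower.alternatingMapLinearEquiv (kaehlerTwo U)) := by
  choose c hc using exists_coeffTwo (U := U) i
  refine bijective_alternatingMapLinearEquiv _ (fun p ↦ ![dd (ratio h p.1), dd (ratio h p.2)]) c
    (fun m ↦ ?_) fun w ↦ linMod_ext fun x p ↦ ?_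
  · have ha : constantSection U (1 / 2) + constantSection U (1 / 2) = 1 := by
      rw [← map_add, add_halves, map_one]
    refine Eq.trans ?_ (sum_smul_alternating ha
      (c := fun a ↦ (coeffOne i a).comp (kaehlerHom U)) (sum_coeffOne_kaehlerHom h hU)
      (exteriorPower.ιMulti Γ(ProjectiveSpace n, U) 2) m)
    refine Finset.sum_congr rfl fun p _ ↦ ?_
    congr 1
    refine section_ext fun x ↦ ?_
    simp only [LinearMap.comp_apply, map_mul, map_sub, sectionVal_coeffOne, hc]
    have h1 : sectionVal x (constantSection U (1 / 2)) = toLocAt x.1 (MvPolynomial.C (1 / 2)) :=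
      sectionVal_structureMap x (1 / 2)
    rw [h1]
    change _ * _ * linVal x p (wedge _ _) = _
    rw [linVal_wedge]
    ring
  · rw [map_sum]
    have hw := mem_eulerTwo.1 (linVal_mem w x)
    -- Contracting one index at a time returns `w`: the second by the Euler condition on rows, the
    -- first by antisymmetry and the same condition.
    have h1 (l m : Fin (n + 1)) : ∑ p : Fin (n + 1) × Fin (n + 1), linVal x p w *
        (coord x.1 i * partialLoc x.1 l (sectionVal x (ratio h p.1))) *
        (coord x.1 i * partialLoc x.1 m (sectionVal x (ratio h p.2))) = linVal x (l, m) w := by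
      rw [Fintype.sum_prod_type]
      simp only [mul_right_comm _ (coord x.1 i * partialLoc x.1 l _), ← Finset.sum_mul]
      simp only [fun a ↦ sum_mul_partialLoc h (hw.2 a) m]
      have h2 := sum_mul_partialLoc h (hw.2 m) l
      have h3 (a b : Fin (n + 1)) : linVal x (a, b) w = - linVal x (b, a) w := hw.1 a b
      rw [h3 l m, ← h2, ← Finset.sum_neg_distrib]
      refine Finset.sum_congr rfl fun a _ ↦ ?_
      rw [h3 a m, neg_mul]
    have h2 (q : Fin (n + 1) × Fin (n + 1)) :
        linVal x p (c q w • kaehlerTwo U ![dd (ratio h q.1), dd (ratio h q.2)]) =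
        toLocAt x.1 (MvPolynomial.C (1 / 2)) * (linVal x q w *
        (coord x.1 i * partialLoc x.1 p.1 (sectionVal x (ratio h q.1))) *
        (coord x.1 i * partialLoc x.1 p.2 (sectionVal x (ratio h q.2))) - linVal x q w *
        (coord x.1 i * partialLoc x.1 p.2 (sectionVal x (ratio h q.1))) *
        (coord x.1 i * partialLoc x.1 p.1 (sectionVal x (ratio h q.2)))) := by
      rw [linVal_smul, hc]
      change _ * _ * _ * linVal x p (wedge (kaehlerHom U (dd _)) (kaehlerHom U (dd _))) = _
      rw [linVal_wedge, kaehlerHom_dd, kaehlerHom_dd]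
      simp only [linVal_grad]
      ring
    rw [Finset.sum_congr rfl fun q _ ↦ h2 q, ← Finset.mul_sum, Finset.sum_sub_distrib, h1, h1]
    have h3 : linVal x (p.2, p.1) w = - linVal x p w := hw.1 p.2 p.1
    have h4 := half_add_half x.1
    rw [h3]
    change _ * (linVal x p w - _) = _
    linear_combination (linVal x p w) * h4

end FormPowers

/-! ### Comparison morphisms of presheaves and the models of `Ω¹` and `Ω²` -/

section PresheafMaps

/-- The morphism from an exterior power of a presheaf of modules given by alternating maps. -/
def exteriorDesc {X : Scheme.{u}}
    {M N : PresheafOfModules.{u} (X.presheaf ⋙ forget₂ CommRingCat.{u} RingCat.{u})} {p : ℕ}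
    (φ : ∀ U : X.Opens, ModuleCat.AlternatingMap (R := Γ(X, U)) (M.obj (op U)) (N.obj (op U)) p)
    (ψ : ∀ U : X.Opens, (Fin p → M.obj (op U)) → N.obj (op U)) (hψ : ∀ U m, φ U m = ψ U m)
    (hφ : ∀ (U V : X.Opens) (f : op U ⟶ op V) (m : Fin p → M.obj (op U)),
      N.map f (ψ U m) = ψ V (fun i ↦ (M.map f (m i) : M.obj (op V)))) :
    presheafExteriorPower M p ⟶ N where
  app U := ModuleCat.exteriorPower.desc (R := X.presheaf.obj U) (φ U.unop)
  naturality {U V} f := by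
    refine ModuleCat.exteriorPower.hom_ext (R := X.presheaf.obj U) ?_
    ext m
    have h1 := congrArg (ModuleCat.exteriorPower.desc (R := X.presheaf.obj V) (φ V.unop)).hom
      (exteriorPowerMap_mk M p f m)
    have h2 := congrArg (N.map f).hom
      (ModuleCat.exteriorPower.desc_mk (R := X.presheaf.obj U) (φ U.unop) m)
    refine h1.trans (Eq.trans ?_ h2.symm)
    refine (ModuleCat.exteriorPower.desc_mk (R := X.presheaf.obj V) (φ V.unop) _).trans ?_
    exact ((hψ V.unop _).trans (hφ U.unop V.unop f m).symm).trans (congrArg _ (hψ U.unop m)).symm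

variable {n : ℕ}

/-- The presheaf of Kähler differentials of projective space. -/
abbrev kdPresheaf (n : ℕ) := PresheafOfModules.DifferentialsConstruction.relativeDifferentials'
  (structureMap (structureMorphism n))

lemma kaehlerHom_map {U V : (ProjectiveSpace n).Opens} (f : op U ⟶ op V) (m : Kd U) :
    ((formsOne n 0).val.map f).hom (kaehlerHom U m) =
      kaehlerHom V (((kdPresheaf n).map f).hom m) :=
  (PresheafOfModules.naturality_apply (kaehlerMap n) f m).symm

lemma kaehlerOne_apply {U : (ProjectiveSpace n).Opens} (m : Fin 1 → Kd U) :
    kaehlerOne U m = kaehlerHom U (m 0) := rfl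

lemma kaehlerTwo_apply {U : (ProjectiveSpace n).Opens} (m : Fin 2 → Kd U) :
    kaehlerTwo U m = wedge (kaehlerHom U (m 0)) (kaehlerHom U (m 1)) := rfl

lemma wedge_map {U V : (ProjectiveSpace n).Opens} (f : op U ⟶ op V)
    (v w : linMod U (Fin (n + 1)) (0 - 1) eulerOne) :
    ((formsTwo n 0).val.map f).hom (wedge v w) =
      wedge (U := V) (((formsOne n 0).val.map f).hom v) (((formsOne n 0).val.map f).hom w) := rfl

/-- The comparison map for one-forms. -/
def omegaOneMap (n : ℕ) : presheafExteriorPower (kdPresheaf n) 1 ⟶ (formsOne n 0).val :=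
  exteriorDesc (fun U ↦ kaehlerOne U) (fun U m ↦ kaehlerHom U (m 0))
    (fun _ m ↦ kaehlerOne_apply m) fun _ _ f m ↦ kaehlerHom_map f (m 0)

/-- The comparison map for two-forms. -/
def omegaTwoMap (n : ℕ) : presheafExteriorPower (kdPresheaf n) 2 ⟶ (formsTwo n 0).val :=
  exteriorDesc (fun U ↦ kaehlerTwo U) (fun U m ↦ wedge (kaehlerHom U (m 0)) (kaehlerHom U (m 1)))
    (fun _ m ↦ kaehlerTwo_apply m) fun _ _ f m ↦ (wedge_map f _ _).trans
      (congrArg₂ wedge (kaehlerHom_map f (m 0)) (kaehlerHom_map f (m 1)))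

lemma IsDistinguished.le_chart {U : (ProjectiveSpace n).Opens} {i : Fin (n + 1)}
    (h : IsDistinguished i U) : U ≤ chart i := by
  obtain ⟨f, rfl⟩ := h
  exact (ProjectiveSpace n).basicOpen_le f

lemma nonempty_iso_formsOne (n : ℕ) : Nonempty (SheafIso _ (Omega n 1) (formsOne n 0)) :=
  nonempty_iso_sheafOfPresheaf (omegaOneMap n) (fun U ↦ ∃ i, IsDistinguished i U)
    (fun _ _ ↦ exists_isDistinguished) fun _ ⟨_, h⟩ ↦ bijective_kaehlerOne h.le_chart h

lemma nonempty_iso_formsTwo (n : ℕ) : Nonempty (SheafIso _ (Omega n 2) (formsTwo n 0)) :=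
  nonempty_iso_sheafOfPresheaf (omegaTwoMap n) (fun U ↦ ∃ i, IsDistinguished i U)
    (fun _ _ ↦ exists_isDistinguished) fun _ ⟨_, h⟩ ↦ bijective_kaehlerTwo h.le_chart h

end PresheafMaps

/-! ### Tensoring the models with twisting sheaves -/

section Twisting

/-- Since `g` generates `N`, every tensor has the form `m ⊗ g`, and the map is determined by `m ↦ β
m g`. -/
lemma bijective_lift_of_generator {R M N K : Type*} [CommRing R] [AddCommGroup M] [Module R M]
    [AddCommGroup N] [Module R N] [AddCommGroup K] [Module R K] (β : M →ₗ[R] N →ₗ[R] K) {g : N}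
    (hg : ∀ y, ∃ c : R, c • g = y) (h : Function.Bijective fun m ↦ β m g) :
    Function.Bijective (TensorProduct.lift β) := by
  have key (z : TensorProduct R M N) : ∃ m, z = m ⊗ₜ[R] g := by
    induction z with
    | zero => exact ⟨0, (TensorProduct.zero_tmul _ _).symm⟩
    | tmul m y =>
      obtain ⟨c, rfl⟩ := hg y
      exact ⟨c • m, (TensorProduct.smul_tmul _ _ _).symm⟩
    | add z w hz hw =>
      obtain ⟨m, rfl⟩ := hz
      obtain ⟨m', rfl⟩ := hw
      exact ⟨m + m', (TensorProduct.add_tmul _ _ _).symm⟩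
  constructor
  · intro z w hzw
    obtain ⟨m, rfl⟩ := key z
    obtain ⟨m', rfl⟩ := key w
    rw [TensorProduct.lift.tmul, TensorProduct.lift.tmul] at hzw
    rw [h.1 hzw]
  · intro q
    obtain ⟨m, rfl⟩ := h.2 q
    exact ⟨m ⊗ₜ g, TensorProduct.lift.tmul _ _⟩

/-- The morphism from a tensor product of presheaves of modules given by bilinear maps. -/
def tensorDesc {X : Scheme.{u}}
    {M N K : PresheafOfModules.{u} (X.presheaf ⋙ forget₂ CommRingCat.{u} RingCat.{u})}
    (β : ∀ U : X.Opens, letI := (M.obj (op U)).isModule; letI := (N.obj (op U)).isModule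
      letI := (K.obj (op U)).isModule
      M.obj (op U) →ₗ[Γ(X, U)] N.obj (op U) →ₗ[Γ(X, U)] K.obj (op U))
    (hβ : ∀ (U V : X.Opens) (f : op U ⟶ op V) (m : M.obj (op U)) (y : N.obj (op U)),
      K.map f (β U m y) = β V (M.map f m : M.obj (op V)) (N.map f y : N.obj (op V))) :
    PresheafOfModules.Monoidal.tensorObj (R := X.presheaf) M N ⟶ K where
  app U := ModuleCat.MonoidalCategory.tensorLift (R := X.presheaf.obj U)
    (M₁ := M.obj U) (M₂ := N.obj U) (M₃ := K.obj U)
    (fun m y ↦ β U.unop m y) (fun m m' y ↦ (β U.unop).map_add₂ m m' y)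
    (fun c m y ↦ (β U.unop).map_smul₂ c m y) (fun m y y' ↦ (β U.unop m).map_add y y')
    (fun c m y ↦ (β U.unop m).map_smul c y)
  naturality {U V} f := ModuleCat.MonoidalCategory.tensor_ext (R := X.presheaf.obj U) fun m y ↦
    (hβ U.unop V.unop f m y).symm

lemma nonempty_iso_tensor {X : Scheme.{u}} {F G : X.Modules} (e : SheafIso X F G) (E : X.Modules) :
    Nonempty (SheafIso X (tensor F E) (tensor G E)) := by
  let e' := (SheafOfModules.forget X.ringCatSheaf).mapIso e
  exact ⟨(PresheafOfModules.sheafification (𝟙 X.ringCatSheaf.obj)).mapIso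
    (@MonoidalCategory.whiskerRightIso _ _
      (PresheafOfModules.monoidalCategory (R := X.presheaf)) _ _ e' E.val)⟩

variable {n : ℕ} {U : (ProjectiveSpace n).Opens} {T : Type} {k l m : ℤ} {P : LinCond n T}

/-- The sections over `U` of `𝒪(k)`, as a module. -/
def twMod (U : (ProjectiveSpace n).Opens) (k : ℤ) : ModuleCat Γ(ProjectiveSpace n, U) :=
  @ModuleCat.of Γ(ProjectiveSpace n, U) _ (twistSections (grading n) k (op U)) _
    (twistModule (grading n) k (op U))

/-- The function of a section of `𝒪(k)`. -/
def twVal (x : U) : twMod U k →+ LocAt (grading n) x.1 where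
  toFun s := (show twistSections (grading n) k (op U) from s).1 x
  map_zero' := rfl
  map_add' _ _ := rfl

lemma twVal_smul (c : Γ(ProjectiveSpace n, U)) (s : twMod U k) (x : U) :
    twVal x (c • s) = sectionVal x c * twVal x s := rfl

lemma twMod_ext {s s' : twMod U k} (h : ∀ x, twVal x s = twVal x s') : s = s' :=
  Subtype.ext (funext h)

lemma twVal_isTwist (s : twMod U k) : IsTwist k U (fun x ↦ twVal x s) :=
  (show twistSections (grading n) k (op U) from s).2

/-- The section given by a function. -/
def twMk (f : ∀ x : U, LocAt (grading n) x.1) (hf : IsTwist k U f) : twMod U k := ⟨f, hf⟩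

lemma linVal_isTwist (s : linMod U T k P) (t : T) : IsTwist k U (fun x ↦ linVal x t s) :=
  linearVal_isTwist (𝒜 := grading n) (T := T) (k := k) (P := P) (U := U) s t

/-- The family given by functions. -/
def linMk (f : ∀ x : U, T → LocAt (grading n) x.1) (h₁ : ∀ t, IsTwist k U (fun x ↦ f x t))
    (h₂ : ∀ x : U, f x ∈ P x.1) : linMod U T k P := linearMk f h₁ h₂

/-- The product of a family of sections of `𝒪(l)` with a section of `𝒪(k)`. -/
def twMul (h : k + l = m) (s : linMod U T l P) (y : twMod U k) : linMod U T m P :=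
  linMk (fun x t ↦ twVal x y * linVal x t s)
    (fun t ↦ ((twVal_isTwist y).mul (linVal_isTwist s t)).of_eq h)
    fun x ↦ (P x.1).smul_mem (twVal x y) (linVal_mem s x)

lemma linVal_twMul (h : k + l = m) (s : linMod U T l P) (y : twMod U k) (x : U) (t : T) :
    linVal x t (twMul h s y) = twVal x y * linVal x t s := rfl

/-- The multiplication of families with sections of `𝒪(k)`, as a bilinear map. -/
def twMulBilin (U : (ProjectiveSpace n).Opens) (P : LinCond n T) (h : k + l = m) :
    linMod U T l P →ₗ[Γ(ProjectiveSpace n, U)] twMod U k →ₗ[Γ(ProjectiveSpace n, U)]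
      linMod U T m P :=
  LinearMap.mk₂ _ (twMul h)
    (fun v v' w ↦ linMod_ext fun x t ↦ by simp only [linVal_twMul, map_add]; ring)
    (fun c v w ↦ linMod_ext fun x t ↦ by simp only [linVal_twMul, linVal_smul]; ring)
    (fun v w w' ↦ linMod_ext fun x t ↦ by simp only [linVal_twMul, map_add]; ring)
    (fun c v w ↦ linMod_ext fun x t ↦ by simp only [linVal_twMul, linVal_smul, twVal_smul]; ring)

/-- On a chart `e = xᵢ^k` generates `𝒪(k)`, and multiplication by it is undone by `e' = xᵢ^(-k)`,
which preserves the linear condition. -/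
lemma bijective_twMulBilin (h : k + l = m) {i : Fin (n + 1)} (hU : U ≤ chart i) :
    Function.Bijective (TensorProduct.lift (twMulBilin U P h)) := by
  obtain ⟨e, e', he, he', hee⟩ := exists_isTwist_mul_eq_one (X_mem_grading i) (X_notMem hU) k
  refine bijective_lift_of_generator (g := twMk e he) _ (fun y ↦ ?_) ⟨fun v w hvw ↦ ?_, fun w ↦ ?_⟩
  · obtain ⟨c, hc⟩ := ((he'.mul (twVal_isTwist y)).of_eq (neg_add_cancel k)).exists_section
    refine ⟨c, twMod_ext fun x ↦ ?_⟩
    have hc' : sectionVal x c = e' x * twVal x y := hc x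
    refine Eq.trans (b := sectionVal x c * e x) rfl ?_
    rw [hc']
    linear_combination (twVal x y) * hee x
  · refine linMod_ext fun x t ↦ ?_
    have h1 : e x * linVal x t v = e x * linVal x t w := congrArg (linVal x t) hvw
    linear_combination e' x * h1 - (linVal x t v - linVal x t w) * hee x
  · refine ⟨linMk (fun x t ↦ e' x * linVal x t w)
      (fun t ↦ (he'.mul (linVal_isTwist w t)).of_eq (by omega))
      fun x ↦ (P x.1).smul_mem (e' x) (linVal_mem w x), linMod_ext fun x t ↦ ?_⟩
    change e x * (e' x * linVal x t w) = _
    linear_combination (linVal x t w) * hee x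

variable (T) in
/-- The multiplication of families with sections of `𝒪(k)`, as a morphism of presheaves. -/
def twistMap (P : LinCond n T) (h : k + l = m) :
    PresheafOfModules.Monoidal.tensorObj (R := (ProjectiveSpace n).presheaf)
      (linearSheaf (grading n) T l P).val (twistingSheaf (grading n) k).val ⟶
      (linearSheaf (grading n) T m P).val :=
  tensorDesc (fun U ↦ twMulBilin U P h) fun _ _ _ _ _ ↦ rfl

lemma nonempty_iso_twist {F : (ProjectiveSpace n).Modules}
    (e : Nonempty (SheafIso _ F (linearSheaf (grading n) T l P))) (h : k + l = m) :
    Nonempty (SheafIso _ (twist k F) (linearSheaf (grading n) T m P)) := by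
  obtain ⟨e⟩ := e
  obtain ⟨e₁⟩ := nonempty_iso_tensor e (twistingSheaf (grading n) k)
  obtain ⟨e₂⟩ := nonempty_iso_sheafOfPresheaf (twistMap T P h) (fun U ↦ ∃ i, IsDistinguished i U)
    (fun _ _ ↦ exists_isDistinguished) fun _ ⟨_, hU⟩ ↦ bijective_twMulBilin h hU.le_chart
  exact ⟨e₁ ≪≫ e₂⟩

end Twisting

/-! ### Transfer of vanishing from the models to twisted differential forms -/

section Comparison

variable {n q : ℕ} {k : ℤ}

lemma cohomology_twist_omegaOne (h : Subsingleton (HH (omegaOne n k) q)) :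
    Subsingleton (cohomology q (twist k (Omega n 1))) :=
  cohomology_subsingleton_of_linear (nonempty_iso_twist (nonempty_iso_formsOne n) (by ring)) h

lemma cohomology_twist_omegaTwo (h : Subsingleton (HH (omegaTwo n k) q)) :
    Subsingleton (cohomology q (twist k (Omega n 2))) :=
  cohomology_subsingleton_of_linear (nonempty_iso_twist (nonempty_iso_formsTwo n) (by ring)) h

end Comparison

end ProjForms

end

theorem mainTheorem3 (r : ℤ) :
    (r > -2 → Subsingleton (ProjForms.cohomology 0 (ProjForms.twist (-r) (ProjForms.Omega 3 1)))) ∧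
    (r > -3 → Subsingleton (ProjForms.cohomology 0 (ProjForms.twist (-r) (ProjForms.Omega 3 2)))) ∧
    (r ≠ 0 → Subsingleton (ProjForms.cohomology 1 (ProjForms.twist (-r) (ProjForms.Omega 3 1)))) ∧
    Subsingleton (ProjForms.cohomology 1 (ProjForms.twist (-r) (ProjForms.Omega 3 2))) ∧
    Subsingleton (ProjForms.cohomology 2 (ProjForms.twist (-r) (ProjForms.Omega 3 1))) ∧
    (r ≠ 0 → Subsingleton (ProjForms.cohomology 2 (ProjForms.twist (-r) (ProjForms.Omega 3 2)))) ∧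
    (r < 3 → Subsingleton (ProjForms.cohomology 3 (ProjForms.twist (-r) (ProjForms.Omega 3 1)))) ∧
    (r < 2 → Subsingleton (ProjForms.cohomology 3 (ProjForms.twist (-r) (ProjForms.Omega 3 2)))) := by
  have h1 (hr : -r ≠ 0) := ProjForms.HH_one_omegaOne (n := 3) (by norm_num) hr
  refine ⟨fun hr ↦ ?_, fun hr ↦ ?_, fun hr ↦ ?_, ?_, ?_, fun hr ↦ ?_, fun hr ↦ ?_, fun hr ↦ ?_⟩
  · exact ProjForms.cohomology_twist_omegaOne (ProjForms.HH_zero_omegaOne (by norm_num) (by omega))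
  · exact ProjForms.cohomology_twist_omegaTwo (ProjForms.HH_zero_omegaTwo (by norm_num) (by omega))
  · exact ProjForms.cohomology_twist_omegaOne (h1 (by omega))
  · exact ProjForms.cohomology_twist_omegaTwo (ProjForms.HH_one_omegaTwo (by norm_num))
  · exact ProjForms.cohomology_twist_omegaOne (ProjForms.HH_succ_omegaOne (q := 0)
      (by norm_num) (by norm_num))
  -- The condition `r ≠ 0` is inherited from `H¹(Ω¹(-r))`, which precedes this group in the long
  -- exact sequence.
  · exact ProjForms.cohomology_twist_omegaTwo (ProjForms.HH_succ_omegaTwo (q := 0)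
      (h1 (by omega)) (by norm_num))
  · exact ProjForms.cohomology_twist_omegaOne (ProjForms.HH_succ_omegaOne (q := 1)
      (by norm_num) (by omega))
  -- Here the preceding group `H²(Ω¹(-r))` always vanishes. The bound `r < 2` comes from `H³(𝒪(-r -
  -- 2))`, which vanishes for `-r - 2 > -4`.
  · exact ProjForms.cohomology_twist_omegaTwo (ProjForms.HH_succ_omegaTwo (q := 1)
      (ProjForms.HH_succ_omegaOne (q := 0) (by norm_num) (by norm_num)) (by omega))
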